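/- **Setting.** An *integrable system* with $n$ degrees of freedom is a proper surjective map $\pi:M\to O$ from a symplectic manifold $(M^{2n},\omega)$ onto a Hausdorff paracompact space $O$ (the base space) such that every $x\in O$ has an open neighbourhood $U$ with a *moment map* over it: smooth functions $F_1,\dots,F_n$ on $\pi^{-1}(U)$ that Poisson-commute, whose differentials are linearly independent on a dense subset of $\pi^{-1}(U)$, and such that the fibers $\pi^{-1}(y)$, $y\in U$, are the connected components of the level sets of $(F_1,\dots,F_n)$ on $\pi^{-1}(U)$. The *rank* of $p\in M$ is the maximum of $\dim\langle dF_1(p),\dots,dF_n(p)\rangle$ over all moment maps near the fiber through $p$; a fiber is *singular* if it contains a point of rank $<n$. The *strata* of a fiber are the orbits in it of the Hamiltonian flows of the components of moment maps. A vector at $p$ is *tangent to the fibration* if it is a linear combination of Hamiltonian vectors at $p$ of components of moment maps near the fiber through $p$. For $U\subset O$ open, let $\mathcal Z^1(U)$ be the group of smooth closed 1-forms on $\pi^{-1}(U)$ that vanish on all vectors tangent to the fibration, and let $\mathcal R(U)\subset\mathcal Z^1(U)$ be the group of those $\beta$ for which the vector field $X$ with $i_X\omega=\beta$ generates an action of $\mathbb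 R/\mathbb Z$. Let $\mathcal Z^1/\mathcal R$ be the quotient sheaf on $O$. A section $s$ of $\mathcal Z^1/\mathcal R$ over $U$ *represents* an automorphism $g$ of $\pi^{-1}(U)$ if, locally on $U$, $s$ is the class of a form $\beta\in\mathcal Z^1$ such that $g$ is the time-one map of the vector field $X$ with $i_X\omega=\beta$. An automorphism of $\pi^{-1}(U)$ is *admissible* if it preserves each stratum of each fiber and induces the identity on the fundamental group of each stratum and on the first integral homology group of each fiber. A *symplectic equivalence* of two systems is a fibration-preserving symplectic diffeomorphism (it covers a homeomorphism of the base spaces). A *rough symplectic equivalence* $E$ from $\pi_0:M_0\to O_0$ to $\pi_1:M_1\to O_1$ consists of a homeomorphism $\phi:O_0\to O_1$, an open cover $(U_i)$ of $O_0$ and symplectic diffeomorphisms $\Phi_i:\pi_0^{-1}(U_i)\to\pi_1^{-1}(\phi(U_i))$ covering $\phi$, such that $\Phi_i^{-1}\circ\Phi_j$ is admissible over $U_i\cap U_j$ for all $i,j$. A *Lagrangian class* of the second system, with the framing $E$, relative to the reference system $M_0$ is a class $\mu_L(E)\in H^1(O_0,\mathcal Z^1/\mathcal R)$ (Čech cohomology,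 sheaves of the reference system) of a cocycle $(s_{xy})$, over an open cover refining $(U_i)$ through $x\mapsto i(x)$, such that $s_{xy}$ represents $\Phi_{i(x)}^{-1}\circ\Phi_{i(y)}$. **Theorem.** Let $\pi_0:M_0\to O_0$ be an integrable system (the reference system) with the following two properties. 1. Each fiber is the disjoint union of finitely many strata, each of which is a submanifold whose dimension is the rank of its points. 2. If $x\in O_0$ has a singular fiber, $U$ is an open neighbourhood of $x$, and $g$ is a symplectomorphism of $\pi_0^{-1}(U)$ onto itself that preserves every stratum of every fiber, then over some smaller neighbourhood of $x$ the map $g$ is the time-one map of a symplectic vector field tangent to the fibration. Let $\pi_1:M_1\to O_1$ and $\pi_2:M_2\to O_2$ be integrable systems that are roughly symplectically equivalent to the reference system (hence to each other). Then: (a) for $k=1,2$ and every rough symplectic equivalence $E_k$ from $M_0$ to $M_k$, the Lagrangian class $\mu_L(E_k)\in H^1(O_0,\mathcal Z^1/\mathcal R)$ exists and is unique; (b) $M_1$ and $M_2$ are symplectically equivalent if and only if they have the same Lagrangian class relative to $M_0$, i.e. $\mu_L(E_1)=\mu_L(E_2)$ for some rough symplectic equivalences $E_1$ from $M_0$ to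 $M_1$ and $E_2$ from $M_0$ to $M_2$; if they are symplectically equivalent, then $E_1$ can be prescribed; (c) for given $E_1=(\phi_1,(\Phi_i^1))$ and $E_2=(\phi_2,(\Phi_j^2))$, one has $\mu_L(E_1)=\mu_L(E_2)$ if and only if there is a symplectic equivalence $\Psi:M_1\to M_2$ that covers $\phi_2\circ\phi_1^{-1}$ and for which all the automorphisms $(\Phi^2_j)^{-1}\circ\Psi\circ\Phi^1_i$ of the reference system are admissible. -/

import Mathlib

open CategoryTheory TopologicalSpace Set
open scoped Manifold ContDiff

universe u v w

/-! ### Čech cohomology in degree one -/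

/-- An open cover of `X` indexed by the points of `X`, the `x`-th member containing `x`.
Every open cover is refined by one of this form. -/
structure PointCover (X : Type v) [TopologicalSpace X] where
  nhd : X → Opens X
  mem : ∀ x, x ∈ nhd x

/-- Covers are ordered by refinement: the finer cover is the larger one. -/
instance (X : Type v) [TopologicalSpace X] : Preorder (PointCover X) where
  le W W' := ∀ x, W'.nhd x ≤ W.nhd x
  le_refl _ _ := le_rfl
  le_trans _ _ _ h h' x := (h' x).trans (h x)

namespace Cech

variable {X : Type v} [TopologicalSpace X] (F : (Opens X)ᵒᵖ ⥤ AddCommGrpCat.{w})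

/-- Restriction of sections, as a homomorphism of groups. -/
def res {U V : Opens X} (h : V ≤ U) : F.obj (.op U) →+ F.obj (.op V) :=
  (F.map (homOfLE h).op).hom

theorem res_res {U V V' : Opens X} (h : V ≤ U) (h' : V' ≤ V) (s : F.obj (.op U)) :
    res F h' (res F h s) = res F (h'.trans h) s := by
  have : (homOfLE (h'.trans h)).op = (homOfLE h).op ≫ (homOfLE h').op := rfl
  simp only [res, this, F.map_comp]
  rfl

/-- Čech 1-cochains of the cover `W`. -/
abbrev Cochain (W : PointCover X) : Type _ :=
  ∀ x y : X, F.obj (.op (W.nhd x ⊓ W.nhd y))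

/-- Čech 1-cocycles: `c x y + c y z = c x z` on triple intersections. -/
def cocycles (W : PointCover X) : AddSubgroup (Cochain F W) where
  carrier := {c | ∀ x y z : X,
    res F (V := W.nhd x ⊓ W.nhd y ⊓ W.nhd z) inf_le_left (c x y)
      + res F (le_inf (inf_le_left.trans inf_le_right) inf_le_right) (c y z)
      = res F (le_inf (inf_le_left.trans inf_le_left) inf_le_right) (c x z)}
  zero_mem' := by intro x y z; simp
  add_mem' := by
    intro a b ha hb x y z
    simp only [Pi.add_apply, map_add]
    rw [← ha x y z, ← hb x y z]; abel
  neg_mem' := by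
    intro a ha x y z
    simp only [Pi.neg_apply, map_neg]
    rw [← ha x y z]; abel

/-- Čech 1-coboundaries: `c x y = b y - b x` on double intersections. -/
def coboundaries (W : PointCover X) : AddSubgroup (Cochain F W) where
  carrier := {c | ∃ b : ∀ x : X, F.obj (.op (W.nhd x)),
    ∀ x y, c x y = res F inf_le_right (b y) - res F inf_le_left (b x)}
  zero_mem' := ⟨0, by intro x y; simp⟩
  add_mem' := by
    rintro a a' ⟨b, hb⟩ ⟨b', hb'⟩
    refine ⟨b + b', fun x y => ?_⟩
    simp only [Pi.add_apply, map_add, hb, hb']; abel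
  neg_mem' := by
    rintro a ⟨b, hb⟩
    refine ⟨-b, fun x y => ?_⟩
    simp only [Pi.neg_apply, map_neg, hb]; abel

/-- First Čech cohomology of the cover `W`: cocycles modulo coboundaries. -/
abbrev H1Cover (W : PointCover X) : Type _ :=
  cocycles F W ⧸ (coboundaries F W).addSubgroupOf (cocycles F W)

/-- Restriction of cocycles to a finer cover. -/
def refine {W W' : PointCover X} (h : W ≤ W') : cocycles F W →+ cocycles F W' where
  toFun c := ⟨fun x y => res F (inf_le_inf (h x) (h y)) (c.1 x y), by
    intro x y z
    have hc := congrArg (res F (inf_le_inf (inf_le_inf (h x) (h y)) (h z))) (c.2 x y z)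
    simp only [map_add, res_res] at hc ⊢
    exact hc⟩
  map_zero' := by ext x y; simp
  map_add' a b := by ext x y; simp

/-- Restriction to a finer cover, on cohomology. -/
def refineH1 {W W' : PointCover X} (h : W ≤ W') : H1Cover F W →+ H1Cover F W' :=
  QuotientAddGroup.map _ _ (refine F h) (by
    rintro c ⟨b, hb⟩
    refine ⟨fun x => res F (h x) (b x), fun x y => ?_⟩
    have := congrArg (res F (inf_le_inf (h x) (h y))) (hb x y)
    simp only [map_sub, res_res] at this ⊢
    exact this)

open Classical in
/-- The Čech cohomology group `H¹(X, F)`: the direct limit over all covers. -/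
abbrev H1 : Type _ :=
  AddCommGroup.DirectLimit (H1Cover F) (fun _ _ h => refineH1 F h)

open Classical in
/-- The class in `H¹(X, F)` of a cocycle. -/
noncomputable def H1.mk (W : PointCover X) (c : cocycles F W) : H1 F :=
  AddCommGroup.DirectLimit.of (H1Cover F) (fun _ _ h => refineH1 F h) W (QuotientAddGroup.mk c)

end Cech

/-! ### Differential forms on a manifold of dimension `2n` -/

/-- The model space `ℝ²ⁿ`. -/
abbrev Model (n : ℕ) : Type := EuclideanSpace ℝ (Fin (2 * n))

/-- A (not necessarily smooth) differential `k`-form on `M`. -/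
abbrev MForm (n k : ℕ) (M : Type u) [TopologicalSpace M] [ChartedSpace (Model n) M] : Type u :=
  ∀ p : M, TangentSpace 𝓘(ℝ, Model n) p [⋀^Fin k]→L[ℝ] ℝ

namespace MForm

variable {n k : ℕ} {M : Type u} [TopologicalSpace M] [ChartedSpace (Model n) M]

/-- The expression of a form in the preferred chart at `p₀`: its pull-back under the inverse of
the chart, a form on an open subset of `ℝ²ⁿ`. -/
noncomputable def inChart (β : MForm n k M) (p₀ : M) (e : Model n) : Model n [⋀^Fin k]→L[ℝ] ℝ :=
  (β ((extChartAt 𝓘(ℝ, Model n) p₀).symm e)).compContinuousLinearMap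
    (mfderiv 𝓘(ℝ, Model n) 𝓘(ℝ, Model n) (extChartAt 𝓘(ℝ, Model n) p₀).symm e)

/-- The image in `ℝ²ⁿ` of the part of `A` that lies in the domain of the chart at `p₀`. -/
def chartDomain (n : ℕ) {M : Type u} [TopologicalSpace M] [ChartedSpace (Model n) M]
    (A : Set M) (p₀ : M) : Set (Model n) :=
  (extChartAt 𝓘(ℝ, Model n) p₀).target ∩ (extChartAt 𝓘(ℝ, Model n) p₀).symm ⁻¹' A

/-- `β` is smooth on the open set `A`. -/
def SmoothOn (β : MForm n k M) (A : Set M) : Prop :=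
  ∀ p₀ : M, ContDiffOn ℝ ∞ (β.inChart p₀) (chartDomain n A p₀)

/-- `dβ = 0` on the open set `A` (for `β` smooth on `A`). -/
def ClosedOn (β : MForm n k M) (A : Set M) : Prop :=
  ∀ p₀ : M, ∀ e ∈ chartDomain n A p₀, extDeriv (β.inChart p₀) e = 0

theorem inChart_zero (p₀ : M) : (0 : MForm n k M).inChart p₀ = 0 := by
  funext e; ext v; rfl

theorem inChart_add (β β' : MForm n k M) (p₀ : M) :
    (β + β').inChart p₀ = β.inChart p₀ + β'.inChart p₀ := by
  funext e; ext v; rfl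

theorem inChart_neg (β : MForm n k M) (p₀ : M) : (-β).inChart p₀ = -β.inChart p₀ := by
  funext e; ext v; rfl

end MForm

/-- The differential `df(p)` of a function. -/
noncomputable def differential {n : ℕ} {M : Type u} [TopologicalSpace M]
    [ChartedSpace (Model n) M] (f : M → ℝ) (p : M) :
    TangentSpace 𝓘(ℝ, Model n) p →L[ℝ] ℝ :=
  mfderiv 𝓘(ℝ, Model n) 𝓘(ℝ, ℝ) f p

/-! ### Integrable systems -/

/-- The data of a singular fibration of a symplectic manifold of dimension `2n`: a proper
surjective map `π : M → O` and a symplectic form `form` (written `ω` in the comments) on `M`. -/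
structure SymplecticFibration (n : ℕ) (M : Type u) (O : Type v)
    [TopologicalSpace M] [ChartedSpace (Model n) M] [TopologicalSpace O] where
  π : M → O
  isProperMap : IsProperMap π
  surjective : Function.Surjective π
  form : MForm n 2 M
  smooth : form.SmoothOn univ
  closed : form.ClosedOn univ
  nondegenerate : ∀ (p : M) (a : TangentSpace 𝓘(ℝ, Model n) p),
    (∀ b, form p ![a, b] = 0) → a = 0

namespace SymplecticFibration

variable {n : ℕ} {M : Type u} {O : Type v}
  [TopologicalSpace M] [ChartedSpace (Model n) M] [TopologicalSpace O]
  (S : SymplecticFibration n M O)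

/-- `a` is the value at `p` of the Hamiltonian vector field of `f`: `ω(a, ·) = df(p)`. -/
def IsHamiltonianAt (f : M → ℝ) (p : M) (a : TangentSpace 𝓘(ℝ, Model n) p) : Prop :=
  ∀ b : TangentSpace 𝓘(ℝ, Model n) p,
    S.form p ![a, b] = differential f p b

/-- `F = (F₁, …, Fₙ)` is a moment map of the fibration over the open set `U`: on `π⁻¹(U)` the
`Fᵢ` are smooth, they Poisson-commute, they are functionally independent (their differentials are
linearly independent at the points of a dense subset), and the fibers over `U` are the connected
components of the level sets of `F` on `π⁻¹(U)`. -/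
structure IsMomentMap (U : Opens O) (F : Fin n → M → ℝ) : Prop where
  smooth : ∀ i, ContMDiffOn 𝓘(ℝ, Model n) 𝓘(ℝ, ℝ) ∞ (F i) (S.π ⁻¹' U)
  commute : ∀ i j, ∀ p ∈ S.π ⁻¹' U, ∀ a b : TangentSpace 𝓘(ℝ, Model n) p,
    S.IsHamiltonianAt (F i) p a → S.IsHamiltonianAt (F j) p b → S.form p ![a, b] = 0
  independent : S.π ⁻¹' U ⊆ closure {p | p ∈ S.π ⁻¹' U ∧
    LinearIndependent ℝ (fun i : Fin n => differential (n := n) (F i) p)}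
  fiber_eq : ∀ p ∈ S.π ⁻¹' U,
    S.π ⁻¹' {S.π p} = connectedComponentIn {q | q ∈ S.π ⁻¹' U ∧ ∀ i, F i q = F i p} p

end SymplecticFibration

/-- An integrable system, from the geometric point of view: a singular fibration of a symplectic
manifold that is defined, near each fiber, by a moment map. -/
structure IntegrableSystem (n : ℕ) (M : Type u) (O : Type v)
    [TopologicalSpace M] [ChartedSpace (Model n) M] [TopologicalSpace O]
    extends SymplecticFibration n M O where
  exists_momentMap : ∀ x : O, ∃ U : Opens O, x ∈ U ∧
    ∃ F : Fin n → M → ℝ, toSymplecticFibration.IsMomentMap U F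

namespace IntegrableSystem

variable {n : ℕ} {M : Type u} {O : Type v}
  [TopologicalSpace M] [ChartedSpace (Model n) M] [TopologicalSpace O]
  (S : IntegrableSystem n M O)

/-- The rank of `p`: the maximum, over all moment maps `F` near the fiber through `p`, of the
dimension of the span of `dF₁(p), …, dFₙ(p)`. -/
noncomputable def rank (p : M) : ℕ :=
  sSup {r | ∃ U : Opens O, S.π p ∈ U ∧ ∃ F : Fin n → M → ℝ, S.IsMomentMap U F ∧
    r = Module.finrank ℝ (Submodule.span ℝ (range fun i : Fin n =>
      differential (n := n) (F i) p))}

/-- `x` is a singular point of the base: its fiber contains a point of rank `< n`. -/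
def IsSingular (x : O) : Prop := ∃ p ∈ S.π ⁻¹' {x}, S.rank p < n

/-- `q` lies on the integral curve through `p` of the Hamiltonian vector field of a component of
a moment map near the fiber through `p`. -/
def FlowRel (p q : M) : Prop :=
  ∃ U : Opens O, S.π p ∈ U ∧ ∃ F : Fin n → M → ℝ, S.IsMomentMap U F ∧
    ∃ (i : Fin n) (Y : ∀ q : M, TangentSpace 𝓘(ℝ, Model n) q),
      (∀ q ∈ S.π ⁻¹' U, S.IsHamiltonianAt (F i) q (Y q)) ∧
      ∃ γ : ℝ → M, IsMIntegralCurve (I := 𝓘(ℝ, Model n)) γ Y ∧ (∀ t, γ t ∈ S.π ⁻¹' U) ∧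
        γ 0 = p ∧ ∃ t, γ t = q

/-- The stratum (of the fiber through `p`) that contains `p`: the orbit of `p` under the
Hamiltonian flows of the moment maps, that is, under the Poisson actions. -/
def stratum (p : M) : Set M := {q | Relation.EqvGen S.FlowRel p q}

/-- The tangent space of the fibration at `p`, i.e. of the stratum through `p`: the span of the
Hamiltonian vectors at `p` of the components of moment maps. -/
noncomputable def tangent (p : M) : Submodule ℝ (TangentSpace 𝓘(ℝ, Model n) p) :=
  Submodule.span ℝ {a | ∃ U : Opens O, S.π p ∈ U ∧ ∃ F : Fin n → M → ℝ, S.IsMomentMap U F ∧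
    ∃ i, S.IsHamiltonianAt (F i) p a}

/-! #### Closed 1-forms and the affine monodromy sheaf -/

/-- The group `𝒵¹(U)` of closed 1-forms on the open set `U` of the base: smooth closed 1-forms on
`π⁻¹(U)` that vanish on the vectors tangent to the fibration. (Its elements are forms on all of
`M` of which only the restriction to `π⁻¹(U)` matters.) -/
noncomputable def closedForms (U : Opens O) : AddSubgroup (MForm n 1 M) where
  carrier := {β | β.SmoothOn (S.π ⁻¹' U) ∧ β.ClosedOn (S.π ⁻¹' U) ∧
    ∀ p ∈ S.π ⁻¹' U, ∀ a ∈ S.tangent p, β p ![a] = 0}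
  zero_mem' := by
    refine ⟨fun p₀ => ?_, fun p₀ e _ => ?_, fun _ _ _ _ => rfl⟩
    · rw [MForm.inChart_zero]; exact contDiffOn_const
    · rw [MForm.inChart_zero]
      exact ContinuousAlternatingMap.ext fun v => by
        simp [extDeriv, ContinuousAlternatingMap.alternatizeUncurryFin_apply]
  add_mem' := by
    rintro β β' ⟨h1, h2, h3⟩ ⟨h1', h2', h3'⟩
    refine ⟨fun p₀ => ?_, fun p₀ e he => ?_, fun p hp a ha => ?_⟩
    · rw [MForm.inChart_add]; exact (h1 p₀).add (h1' p₀)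
    · have ho : IsOpen (MForm.chartDomain n (S.π ⁻¹' U) p₀) :=
        (continuousOn_extChartAt_symm p₀).isOpen_inter_preimage
          (isOpen_extChartAt_target p₀)
          (U.isOpen.preimage S.isProperMap.continuous)
      have hd := ((h1 p₀).differentiableOn (by simp) e he).differentiableAt (ho.mem_nhds he)
      have hd' := ((h1' p₀).differentiableOn (by simp) e he).differentiableAt (ho.mem_nhds he)
      rw [MForm.inChart_add, extDeriv_add hd hd', h2 p₀ e he, h2' p₀ e he, add_zero]
    · have e1 := h3 p hp a ha
      have e2 := h3' p hp a ha
      simp [e1, e2]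
  neg_mem' := by
    rintro β ⟨h1, h2, h3⟩
    refine ⟨fun p₀ => ?_, fun p₀ e he => ?_, fun p hp a ha => ?_⟩
    · rw [MForm.inChart_neg]; exact (h1 p₀).neg
    · rw [MForm.inChart_neg, ← neg_one_smul ℝ, extDeriv_smul, h2 p₀ e he, smul_zero]
    · have e1 := h3 p hp a ha
      simp [e1]

theorem closedForms_mono {U V : Opens O} (h : V ≤ U) : S.closedForms U ≤ S.closedForms V := by
  rintro β ⟨h1, h2, h3⟩
  exact ⟨fun p₀ => (h1 p₀).mono fun e he => ⟨he.1, h he.2⟩,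
    fun p₀ e he => h2 p₀ e ⟨he.1, h he.2⟩, fun p hp => h3 p (h hp)⟩

/-- `Y` is the vector field dual to `β`: `i_Y ω = β`. -/
def IsDual (Y : ∀ p : M, TangentSpace 𝓘(ℝ, Model n) p) (β : MForm n 1 M) : Prop :=
  ∀ (p : M) (b : TangentSpace 𝓘(ℝ, Model n) p), S.form p ![Y p, b] = β p ![b]

/-- On `π⁻¹(U)`, the map `g` is the time-one map of the vector field `Y`. -/
def IsTimeOneMap (U : Opens O) (Y : ∀ p : M, TangentSpace 𝓘(ℝ, Model n) p) (g : M → M) : Prop :=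
  ∀ p ∈ S.π ⁻¹' U, ∃ γ : ℝ → M, IsMIntegralCurve (I := 𝓘(ℝ, Model n)) γ Y ∧
    (∀ t, γ t ∈ S.π ⁻¹' U) ∧ γ 0 = p ∧ γ 1 = g p

/-- `β` belongs to `ℛ(U)`: it is a closed 1-form on `U` whose dual (symplectic,
fiber-preserving) vector field generates an action of the circle `ℝ/ℤ` on `π⁻¹(U)`, i.e. all its
integral curves there exist for all times and have period `1`. -/
def IsCircleForm (U : Opens O) (β : MForm n 1 M) : Prop :=
  β ∈ S.closedForms U ∧ ∃ Y, S.IsDual Y β ∧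
    ∀ p ∈ S.π ⁻¹' U, ∃ γ : ℝ → M, IsMIntegralCurve (I := 𝓘(ℝ, Model n)) γ Y ∧
      (∀ t, γ t ∈ S.π ⁻¹' U) ∧ γ 0 = p ∧ ∀ t, γ (t + 1) = γ t

/-- The 1-forms whose germ along the fiber over `x` belongs to the stalk `ℛ_x` of the affine
monodromy sheaf. Forms that vanish near the fiber are among them. (The fiber-preserving circle
actions commute, so these forms are already closed under addition.) -/
noncomputable def circleGerms (x : O) : AddSubgroup (MForm n 1 M) :=
  AddSubgroup.closure {β | ∃ U : Opens O, x ∈ U ∧ S.IsCircleForm U β}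

/-- Sections over `U` of the quotient sheaf `𝒵¹/ℛ`: families of classes modulo `ℛ_y`, `y ∈ U`,
that are locally given by sections of `𝒵¹`. -/
noncomputable def quotientSections (U : Opens O) :
    AddSubgroup (∀ y : U, MForm n 1 M ⧸ S.circleGerms y.1) where
  carrier := {s | ∀ x : U, ∃ V : Opens O, x.1 ∈ V ∧ ∃ hV : V ≤ U, ∃ β ∈ S.closedForms V,
    ∀ (y : O) (hy : y ∈ V), s ⟨y, hV hy⟩ = QuotientAddGroup.mk β}
  zero_mem' := fun x => ⟨U, x.2, le_rfl, 0, zero_mem _, fun _ _ => rfl⟩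
  add_mem' := by
    intro s s' h h' x
    obtain ⟨V, hx, hV, β, hβ, hs⟩ := h x
    obtain ⟨V', hx', hV', β', hβ', hs'⟩ := h' x
    refine ⟨V ⊓ V', ⟨hx, hx'⟩, inf_le_left.trans hV, β + β',
      add_mem (S.closedForms_mono inf_le_left hβ) (S.closedForms_mono inf_le_right hβ'),
      fun y hy => ?_⟩
    rw [Pi.add_apply, hs y hy.1, hs' y hy.2]; rfl
  neg_mem' := by
    intro s h x
    obtain ⟨V, hx, hV, β, hβ, hs⟩ := h x
    refine ⟨V, hx, hV, -β, neg_mem hβ, fun y hy => ?_⟩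
    rw [Pi.neg_apply, hs y hy]; rfl

/-- The sheaf `𝒵¹/ℛ` of Abelian groups on the base space. -/
noncomputable def quotientSheaf : (Opens O)ᵒᵖ ⥤ AddCommGrpCat.{max u v} where
  obj U := AddCommGrpCat.of (S.quotientSections U.unop)
  map {U V} h := AddCommGrpCat.ofHom
    { toFun := fun s => ⟨fun y => s.1 ⟨y.1, h.unop.le y.2⟩, by
        intro x
        obtain ⟨V', hx, hV', β, hβ, hs⟩ := s.2 ⟨x.1, h.unop.le x.2⟩
        exact ⟨V' ⊓ V.unop, ⟨hx, x.2⟩, inf_le_right, β, S.closedForms_mono inf_le_left hβ,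
          fun y hy => hs y hy.1⟩⟩
      map_zero' := rfl
      map_add' := fun _ _ => rfl }
  map_id _ := rfl
  map_comp _ _ := rfl

/-- The automorphism `g` of `π⁻¹(U)` corresponds to the section `s` of `𝒵¹/ℛ` under the
identification of the sheaf of local symplectomorphisms of the system with `𝒵¹/ℛ`: locally, `s` is
the class of a closed 1-form `β` such that `g` is the time-one map of the vector field `Y` with
`i_Y ω = β`. -/
def Represents (U : Opens O) (s : S.quotientSections U) (g : M → M) : Prop :=
  ∀ x ∈ U, ∃ V : Opens O, x ∈ V ∧ ∃ hV : V ≤ U, ∃ β ∈ S.closedForms V,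
    (∀ (y : O) (hy : y ∈ V), s.1 ⟨y, hV hy⟩ = QuotientAddGroup.mk β) ∧
    ∃ Y, S.IsDual Y β ∧ S.IsTimeOneMap V Y g

/-! #### Admissible automorphisms -/

/-- The map `g` maps `P` into itself continuously and induces the identity on the fundamental
group of `P`: each loop in `P` is freely homotopic in `P` to its image. (The strata are orbits of
Abelian groups, so their fundamental groups are Abelian and base points play no role.) -/
def ActsTriviallyOnLoops (P : Set M) (g : M → M) : Prop :=
  ∃ f : C(P, P), (∀ p, (f p : M) = g p) ∧ ∀ γ : C(Circle, P), (f.comp γ).Homotopic γ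

/-- The map `g` maps `N` into itself continuously and induces the identity on `H₁(N, ℤ)`. -/
def ActsTriviallyOnH1 (N : Set M) (g : M → M) : Prop :=
  ∃ f : C(N, N), (∀ p, (f p : M) = g p) ∧
    ((AlgebraicTopology.singularHomologyFunctor (ModuleCat.{u} ℤ) 1).obj
      (ModuleCat.of ℤ (ULift.{u} ℤ))).map (TopCat.ofHom f) = 𝟙 _

/-- The topological conditions on an automorphism `g` of the fibration over `U` to be admissible:
it preserves each stratum of each fiber, and it induces the identity on the fundamental group of
each stratum and on the first integral homology group of each fiber. -/
def IsAdmissible (U : Opens O) (g : M → M) : Prop :=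
  (∀ p ∈ S.π ⁻¹' U, g p ∈ S.stratum p) ∧
  (∀ p ∈ S.π ⁻¹' U, ActsTriviallyOnLoops (S.stratum p) g) ∧
  (∀ x ∈ U, ActsTriviallyOnH1 (S.π ⁻¹' {x}) g)

end IntegrableSystem

/-! ### Hypotheses on the singularities -/

/-- `N` is an embedded smooth submanifold of `M` of dimension `d`. -/
def IsEmbeddedSubmanifold {n : ℕ} {M : Type u} [TopologicalSpace M] [ChartedSpace (Model n) M]
    (N : Set M) (d : ℕ) : Prop :=
  ∀ p ∈ N, ∃ χ ∈ IsManifold.maximalAtlas 𝓘(ℝ, Model n) ∞ M, p ∈ χ.source ∧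
    χ '' (N ∩ χ.source) = χ.target ∩ {e : Model n | ∀ i : Fin (2 * n), d ≤ i.1 → e i = 0}

/-- The homeomorphism `g` between open subsets of `M₁` and `M₂` is a smooth symplectomorphism. -/
structure IsSymplectomorphism {n : ℕ} {M₁ : Type*} {O₁ : Type*} {M₂ : Type*} {O₂ : Type*}
    [TopologicalSpace M₁] [ChartedSpace (Model n) M₁] [TopologicalSpace O₁]
    [TopologicalSpace M₂] [ChartedSpace (Model n) M₂] [TopologicalSpace O₂]
    (S₁ : IntegrableSystem n M₁ O₁) (S₂ : IntegrableSystem n M₂ O₂)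
    (g : OpenPartialHomeomorph M₁ M₂) : Prop where
  smooth : ContMDiffOn 𝓘(ℝ, Model n) 𝓘(ℝ, Model n) ∞ g g.source
  smooth_symm : ContMDiffOn 𝓘(ℝ, Model n) 𝓘(ℝ, Model n) ∞ g.symm g.target
  symplectic : ∀ p ∈ g.source, (S₂.form (g p)).compContinuousLinearMap
    (mfderiv 𝓘(ℝ, Model n) 𝓘(ℝ, Model n) g p) = S₁.form p

namespace IntegrableSystem

variable {n : ℕ} {M : Type u} {O : Type v}
  [TopologicalSpace M] [ChartedSpace (Model n) M] [TopologicalSpace O]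
  (S : IntegrableSystem n M O)

/-- Each fiber is the disjoint union of finitely many strata (orbits), each of which is a
submanifold whose dimension is the rank of its points. -/
def FiniteStrata : Prop :=
  ∀ x : O, ∃ (k : ℕ) (N : Fin k → Set M) (d : Fin k → ℕ),
    Pairwise (fun i j => Disjoint (N i) (N j)) ∧ (⋃ i, N i) = S.π ⁻¹' {x} ∧
    ∀ i, IsEmbeddedSubmanifold (n := n) (N i) (d i) ∧
      ∀ p ∈ N i, N i = S.stratum p ∧ S.rank p = d i

/-- Near each singular fiber, a symplectomorphism onto itself of a saturated neighborhood which
preserves every stratum of every fiber is the time-one map of a symplectic vector field tangent to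
the fibration. -/
def SymplectomorphismsAreTimeOneMaps : Prop :=
  ∀ x : O, S.IsSingular x → ∀ U : Opens O, x ∈ U → ∀ g : OpenPartialHomeomorph M M,
    g.source = S.π ⁻¹' U → g.target = S.π ⁻¹' U → IsSymplectomorphism S S g →
    (∀ p ∈ S.π ⁻¹' U, g p ∈ S.stratum p) →
    ∃ V : Opens O, x ∈ V ∧ V ≤ U ∧
      ∃ (Y : ∀ p : M, TangentSpace 𝓘(ℝ, Model n) p) (β : MForm n 1 M),
        S.IsDual Y β ∧ β.SmoothOn (S.π ⁻¹' V) ∧ β.ClosedOn (S.π ⁻¹' V) ∧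
        (∀ p ∈ S.π ⁻¹' V, Y p ∈ S.tangent p) ∧ S.IsTimeOneMap V Y g

end IntegrableSystem

/-! ### Equivalences of systems and the Lagrangian class -/

section Equivalences

variable {n : ℕ} {M₀ M₁ M₂ : Type u} {O₀ O₁ O₂ : Type v}
  [TopologicalSpace M₀] [ChartedSpace (Model n) M₀] [TopologicalSpace O₀]
  [TopologicalSpace M₁] [ChartedSpace (Model n) M₁] [TopologicalSpace O₁]
  [TopologicalSpace M₂] [ChartedSpace (Model n) M₂] [TopologicalSpace O₂]

/-- A symplectic equivalence: a smooth fibration-preserving symplectomorphism. It covers a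
homeomorphism of the base spaces. -/
structure SymplecticEquivalence (S₁ : IntegrableSystem n M₁ O₁) (S₂ : IntegrableSystem n M₂ O₂) where
  base : O₁ ≃ₜ O₂
  map : M₁ ≃ₘ⟮𝓘(ℝ, Model n), 𝓘(ℝ, Model n)⟯ M₂
  comm : ∀ p, S₂.π (map p) = base (S₁.π p)
  symplectic : ∀ p, (S₂.form (map p)).compContinuousLinearMap
    (mfderiv 𝓘(ℝ, Model n) 𝓘(ℝ, Model n) map p) = S₁.form p

/-- A rough symplectic equivalence: a homeomorphism of the base spaces, together with local
fibration-preserving symplectomorphisms `Φᵢ` over the members of an open cover, covering it, such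
that the automorphisms `Φᵢ⁻¹ ∘ Φⱼ` are admissible. -/
structure RoughSymplecticEquivalence
    (S₀ : IntegrableSystem n M₀ O₀) (S₁ : IntegrableSystem n M₁ O₁) where
  base : O₀ ≃ₜ O₁
  ι : Type v
  U : ι → Opens O₀
  cover : ∀ x, ∃ i, x ∈ U i
  Φ : ι → OpenPartialHomeomorph M₀ M₁
  source_eq : ∀ i, (Φ i).source = S₀.π ⁻¹' (U i)
  target_eq : ∀ i, (Φ i).target = S₁.π ⁻¹' (base '' (U i))
  comm : ∀ i, ∀ p ∈ (Φ i).source, S₁.π (Φ i p) = base (S₀.π p)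
  symplectic : ∀ i, IsSymplectomorphism S₀ S₁ (Φ i)
  admissible : ∀ i j, S₀.IsAdmissible (U i ⊓ U j) (fun p => (Φ i).symm (Φ j p))

namespace RoughSymplecticEquivalence

variable {S₀ : IntegrableSystem n M₀ O₀} {S₁ : IntegrableSystem n M₁ O₁}
  {S₂ : IntegrableSystem n M₂ O₂}

/-- `c ∈ H¹(O₀, 𝒵¹/ℛ)` is the Lagrangian class, relative to the reference system `S₀`, of the
system `S₁` with the identification `E` of rough types: the class of the Čech cocycle
`Φᵢ⁻¹ ∘ Φⱼ` of local symplectomorphisms of `S₀`, written in `𝒵¹/ℛ`. -/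
def IsLagrangianClass (E : RoughSymplecticEquivalence S₀ S₁) (c : Cech.H1 S₀.quotientSheaf) :
    Prop :=
  ∃ (W : PointCover O₀) (i : O₀ → E.ι) (_ : ∀ x, W.nhd x ≤ E.U (i x))
    (s : Cech.cocycles S₀.quotientSheaf W),
    (∀ x y, S₀.Represents (W.nhd x ⊓ W.nhd y) (s.1 x y)
      (fun p => (E.Φ (i x)).symm (E.Φ (i y) p))) ∧
    c = Cech.H1.mk S₀.quotientSheaf W s

/-- The systems `S₁` and `S₂`, with identifications of their rough types with that of the common
reference system `S₀`, have the same Lagrangian class in `H¹(O₀, 𝒵¹/ℛ)`. -/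
def SameLagrangianClass (E₁ : RoughSymplecticEquivalence S₀ S₁)
    (E₂ : RoughSymplecticEquivalence S₀ S₂) : Prop :=
  ∃ c : Cech.H1 S₀.quotientSheaf, E₁.IsLagrangianClass c ∧ E₂.IsLagrangianClass c

end RoughSymplecticEquivalence

/-- The symplectic equivalence `Ψ` of `S₁` and `S₂` respects the given identifications of their
rough types with that of `S₀`: it covers the corresponding homeomorphism of base spaces, and it
is, read through the local identifications, an admissible automorphism of `S₀`. -/
def SymplecticEquivalence.RespectsRoughTypes {S₀ : IntegrableSystem n M₀ O₀}
    {S₁ : IntegrableSystem n M₁ O₁} {S₂ : IntegrableSystem n M₂ O₂}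
    (Ψ : SymplecticEquivalence S₁ S₂)
    (E₁ : RoughSymplecticEquivalence S₀ S₁) (E₂ : RoughSymplecticEquivalence S₀ S₂) : Prop :=
  (∀ x, Ψ.base (E₁.base x) = E₂.base x) ∧
  ∀ i j, S₀.IsAdmissible (E₁.U i ⊓ E₂.U j) (fun p => (E₂.Φ j).symm (Ψ.map (E₁.Φ i p)))

end Equivalences

/-!
Let `X` be the vector field with `i_X ω = β`, where `β` is a section of `𝒵¹`. The field `X` is
orthogonal to the tangent vectors of the fibration, so it is annihilated by the differentials of
the moment maps and its integral curves stay in the fibers. These are compact, so `X` has a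
complete flow over the open set where `β` is defined (`exists_localFlow`). By Cartan's formula the
flow is symplectic (`form_mfderiv_flow`). Since two such fields are orthogonal at regular points,
where the fibers are Lagrangian, and regular points are dense, the flows preserve all sections of
`𝒵¹` and commute (`form_dual_dual_eq_zero`, `flow_comm`). Thus `β ↦` (time-one map of `X`) is a
homomorphism (`flow_add_form`), whose kernel is `ℛ` (`mem_circleGerms_iff`), and a section of `𝒵¹/ℛ`
is the same as the automorphism that it represents.

Time-one maps are admissible (`isAdmissible_of_flow`). They preserve the strata: an integral curve
meets finitely many locally closed strata, so by Baire's theorem it is in a single one for some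
interval of time, and the flow, which commutes with the flows of the moment maps, permutes the
strata (`flow_mem_stratum`). They act trivially on loops and on homology because the flow is a
homotopy to the identity.

Conversely, a symplectomorphism `g` that preserves the strata is represented by a section of
`𝒵¹/ℛ` (`exists_section_of_symplectomorphism`). Near singular fibers this is the second hypothesis
on the reference system. Near regular fibers (`exists_flow_of_not_isSingular`), the joint flow of
a moment map `F` acts transitively on the fibers, and `g` commutes with it; so `g` is on each fiber
a translation by a time `T`, which can be taken as a smooth function of `F` by means of the
coordinates of `exists_flowCoordinates`. As `g` is symplectic, `∑ Tᵢ dFᵢ` is closed, and `g` is its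
time-one map.

The classification is then the usual one by Čech cocycles. The transition maps of a rough
equivalence are represented by a cocycle (`exists_isLagrangianClass`). A symplectic equivalence
that respects the rough types is, in terms of the reference system, a 0-cochain whose coboundary is
the difference of the two cocycles (`RespectsRoughTypes.lagrangianClass_eq`); for the identity
equivalence this is the uniqueness of the class. Conversely, such a 0-cochain is represented by
automorphisms of the reference system, which turn the local identifications of the two systems into
ones that agree on overlaps (`SameLagrangianClass.exists_respectsRoughTypes`). Transport of a rough
equivalence along a symplectic equivalence (`compRough`) does not change the cocycle.
-/

open Filter Topology

/-! ### Flows of vector fields on vector spaces -/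

/-- The superposition operator `γ ↦ f ∘ γ` on continuous maps from a compact space. -/
def ContinuousMap.superposition {K E F : Type*} [TopologicalSpace K] [TopologicalSpace E]
    [TopologicalSpace F] (f : C(E, F)) : C(K, E) → C(K, F) := fun γ => f.comp γ

/-- Pointwise application of a continuous family of linear maps, as a linear map into operators
between spaces of continuous functions. -/
noncomputable def ContinuousMap.applyFamily (K E F : Type*) [TopologicalSpace K] [CompactSpace K]
    [NormedAddCommGroup E] [NormedSpace ℝ E] [NormedAddCommGroup F] [NormedSpace ℝ F] :
    C(K, E →L[ℝ] F) →L[ℝ] C(K, E) →L[ℝ] C(K, F) :=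
  LinearMap.mkContinuous₂
    (LinearMap.mk₂ ℝ (fun (A : C(K, E →L[ℝ] F)) (h : C(K, E)) =>
        (⟨fun k => A k (h k), A.continuous.clm_apply h.continuous⟩ : C(K, F)))
      (fun _ _ _ => by ext; simp) (fun _ _ _ => by ext; simp)
      (fun _ _ _ => by ext; simp) (fun _ _ _ => by ext; simp)) 1 (fun A h => by
    rw [one_mul]
    refine (ContinuousMap.norm_le _ (by positivity)).2 fun k => ?_
    exact ((A k).le_opNorm (h k)).trans (mul_le_mul (A.norm_coe_le_norm k) (h.norm_coe_le_norm k)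
      (norm_nonneg (h k)) (norm_nonneg A)))

theorem ContinuousMap.hasFDerivAt_superposition {K E F : Type*} [TopologicalSpace K]
    [CompactSpace K] [NormedAddCommGroup E] [NormedSpace ℝ E] [NormedAddCommGroup F]
    [NormedSpace ℝ F] (f : C(E, F)) (f' : C(E, E →L[ℝ] F)) (hf : ∀ x, HasFDerivAt f (f' x) x)
    (γ : C(K, E)) :
    HasFDerivAt (ContinuousMap.superposition f)
      (ContinuousMap.applyFamily K E F (ContinuousMap.superposition f' γ)) γ := by
  rw [hasFDerivAt_iff_isLittleO_nhds_zero, Asymptotics.isLittleO_iff]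
  intro c hc
  have hu := (isCompact_range γ.continuous).uniformContinuousAt_of_continuousAt f'
    (fun a _ => f'.continuous.continuousAt) (Metric.dist_mem_uniformity hc)
  obtain ⟨δ, hδ, hu⟩ := Metric.mem_uniformity_dist.1 hu
  filter_upwards [Metric.ball_mem_nhds (0 : C(K, E)) hδ] with h hh
  rw [mem_ball_zero_iff] at hh
  refine (ContinuousMap.norm_le _ (by positivity)).2 fun k => ?_
  have hk : ‖h k‖ < δ := (h.norm_coe_le_norm k).trans_lt hh
  have key : ‖f (γ k + h k) - f (γ k) - f' (γ k) (γ k + h k - γ k)‖ ≤ c * ‖γ k + h k - γ k‖ := by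
    refine (convex_ball (γ k) δ).norm_image_sub_le_of_norm_hasFDerivWithin_le'
      (f' := f') (fun x _ => (hf x).hasFDerivWithinAt) (fun x hx => ?_)
      (Metric.mem_ball_self hδ) (by simpa [dist_eq_norm] using hk)
    have := @hu (γ k) x (by rw [dist_comm]; exact hx) ⟨k, rfl⟩
    rw [← dist_eq_norm, dist_comm]
    exact this.le
  rw [add_sub_cancel_left] at key
  exact key.trans (mul_le_mul_of_nonneg_left (h.norm_coe_le_norm k) hc.le)

theorem ContinuousMap.contDiff_superposition {K : Type*} {E F : Type w} [TopologicalSpace K]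
    [CompactSpace K] [NormedAddCommGroup E] [NormedSpace ℝ E] [NormedAddCommGroup F]
    [NormedSpace ℝ F] (m : ℕ) (f : C(E, F)) (hf : ContDiff ℝ m f) :
    ContDiff ℝ m (ContinuousMap.superposition f : C(K, E) → C(K, F)) := by
  induction m generalizing F with
  | zero => exact contDiff_zero.2 (ContinuousMap.continuous_postcomp f)
  | succ m ih =>
    push_cast at hf ⊢
    obtain ⟨f', h1, h2⟩ := contDiff_succ_iff_hasFDerivAt.1 hf
    have := ih ⟨f', h1.continuous⟩ h1
    exact contDiff_succ_iff_hasFDerivAt.2 ⟨fun γ => ContinuousMap.applyFamily K E F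
      (ContinuousMap.superposition ⟨f', h1.continuous⟩ γ),
      ContDiff.comp (g := ContinuousMap.applyFamily K E F)
        (ContinuousLinearMap.contDiff (E := C(K, E →L[ℝ] F)) (F := C(K, E) →L[ℝ] C(K, F)) _) this,
      fun γ => ContinuousMap.hasFDerivAt_superposition f ⟨f', h1.continuous⟩ h2 γ⟩

/-- Integration from `0`, as an operator on `C([0,1], E)`. -/
noncomputable def ContinuousMap.primitive (E : Type*) [NormedAddCommGroup E] [NormedSpace ℝ E]
    [CompleteSpace E] : C(unitInterval, E) →L[ℝ] C(unitInterval, E) :=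
  LinearMap.mkContinuous
    { toFun := fun γ => ⟨fun s => ∫ r in (0:ℝ)..s, γ (projIcc 0 1 zero_le_one r), by
        have : Continuous fun r => γ (projIcc 0 1 zero_le_one r) :=
          γ.continuous.comp continuous_projIcc
        exact (intervalIntegral.continuous_primitive
          (fun a b => this.intervalIntegrable a b) 0).comp continuous_subtype_val⟩
      map_add' := fun γ γ' => by
        have h : ∀ γ : C(unitInterval, E), Continuous fun r => γ (projIcc 0 1 zero_le_one r) :=
          fun γ => γ.continuous.comp continuous_projIcc
        ext s
        exact intervalIntegral.integral_add ((h γ).intervalIntegrable _ _)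
          ((h γ').intervalIntegrable _ _)
      map_smul' := fun c γ => by
        ext s
        exact intervalIntegral.integral_smul c _ } 1 (fun γ => by
    rw [one_mul]
    refine (ContinuousMap.norm_le _ (by positivity)).2 fun s => ?_
    have := intervalIntegral.norm_integral_le_of_norm_le_const (a := (0:ℝ)) (b := s) (C := ‖γ‖)
      (f := fun r => γ (projIcc 0 1 zero_le_one r)) (fun r _ => γ.norm_coe_le_norm _)
    refine this.trans ?_
    rw [sub_zero, abs_of_nonneg s.2.1]
    exact mul_le_of_le_one_right (norm_nonneg _) s.2.2)

theorem ContinuousMap.primitive_apply {E : Type*} [NormedAddCommGroup E] [NormedSpace ℝ E]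
    [CompleteSpace E] (γ : C(unitInterval, E)) (s : unitInterval) :
    ContinuousMap.primitive E γ s = ∫ r in (0:ℝ)..s, γ (projIcc 0 1 zero_le_one r) := rfl

/-- A smooth vector field has a local flow that is smooth near the initial time. The rescaled
integral equation `γ(s) = x + t ∫₀ˢ f(γ)` on `C([0,1], E)` has an invertible derivative in `γ` at
`t = 0`, so the implicit function theorem applies. -/
theorem exists_contDiffAt_localFlow_of_contDiff {E : Type w} [NormedAddCommGroup E]
    [NormedSpace ℝ E] [CompleteSpace E] {f : E → E} (hf : ContDiff ℝ ∞ f)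
    (x₀ : E) :
    ∃ α : ℝ × E → E, ContDiffAt ℝ ∞ α (0, x₀) ∧ ∀ᶠ p : ℝ × E in 𝓝 (0, x₀),
      α (0, p.2) = p.2 ∧ HasDerivAt (fun t => α (t, p.2)) (f (α p)) p.1 := by
  obtain ⟨ε, hε, a, r, L, K, hr, hpl⟩ := IsPicardLindelof.of_contDiffAt_one (hf.contDiffAt.of_le (by simp)
    : ContDiffAt ℝ 1 f x₀)
  obtain ⟨α, hα, hαc⟩ := (hpl 0).exists_forall_mem_closedBall_eq_hasDerivWithinAt_continuousOn
  simp only [zero_sub, zero_add] at hα hαc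
  -- The rescaled integral equation is `G ((t, x), γ) = 0`.
  let fc : C(E, E) := ⟨f, hf.continuous⟩
  let cst : E →L[ℝ] C(unitInterval, E) := 
    LinearMap.mkContinuous ⟨⟨ContinuousMap.const unitInterval, fun _ _ => rfl⟩, fun _ _ => rfl⟩ 1
      fun x => by rw [one_mul]; exact (ContinuousMap.norm_le _ (norm_nonneg x)).2 fun _ => le_rfl
  let G : (ℝ × E) × C(unitInterval, E) → C(unitInterval, E) := fun q =>
    q.2 - cst q.1.2 - q.1.1 • ContinuousMap.primitive E (ContinuousMap.superposition fc q.2)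
  have hGd : ContDiff ℝ ∞ G := by
    have h1 : ContDiff ℝ ∞ (ContinuousMap.superposition fc : C(unitInterval, E) → _) :=
      contDiff_infty.2 fun m => ContinuousMap.contDiff_superposition m fc
        (hf.of_le (by exact_mod_cast le_top))
    have h2 : ContDiff ℝ ∞ fun q : (ℝ × E) × C(unitInterval, E) =>
        ContinuousMap.primitive E (ContinuousMap.superposition fc q.2) :=
      (ContinuousMap.primitive E).contDiff.comp (h1.comp contDiff_snd)
    exact (contDiff_snd.sub (cst.contDiff.comp (contDiff_snd.comp contDiff_fst))).sub
      ((contDiff_fst.comp contDiff_fst).smul h2)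
  let u : (ℝ × E) × C(unitInterval, E) := ((0, x₀), cst x₀)
  have hGu : G u = 0 := by simp [G, u]
  have hinr : fderiv ℝ G u ∘L .inr ℝ (ℝ × E) C(unitInterval, E) = .id ℝ _ := by
    have h1 : HasFDerivAt (fun γ => G ((0, x₀), γ))
        (fderiv ℝ G u ∘L .inr ℝ (ℝ × E) C(unitInterval, E)) (cst x₀) :=
      ((hGd.differentiable (by simp)) u).hasFDerivAt.comp (cst x₀)
        (hasFDerivAt_prodMk_right (0, x₀) (cst x₀))
    have h2 : HasFDerivAt (fun γ => G ((0, x₀), γ)) (.id ℝ _) (cst x₀) := by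
      simpa [G] using (hasFDerivAt_id (𝕜 := ℝ) (cst x₀)).sub_const (cst x₀)
    exact h1.unique h2
  have hinv : (fderiv ℝ G u ∘L .inr ℝ (ℝ × E) C(unitInterval, E)).IsInvertible := by
    rw [hinr]; exact ⟨.refl ℝ _, rfl⟩
  have hm' : (∞ : WithTop ℕ∞) ≠ 0 := by simp
  let ψ := hGd.contDiffAt.implicitFunction (u := u) hm' hinv
  have hψ : ContDiffAt ℝ ∞ ψ (0, x₀) :=
    hGd.contDiffAt.contDiffAt_implicitFunction (u := u) hm' hinv
  have hψ' := hGd.contDiffAt.eventually_apply_eq_iff_implicitFunction (u := u) hm' hinv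
  rw [hGu] at hψ'
  obtain ⟨δ, hδ, hψ'⟩ := Metric.eventually_nhds_iff.1 hψ'
  have hα0 : α (x₀, 0) = x₀ := (hα x₀ (Metric.mem_closedBall_self r.2)).1
  have hdom : Metric.closedBall x₀ r ×ˢ Icc (-ε) ε ∈ 𝓝 ((x₀, 0) : E × ℝ) :=
    prod_mem_nhds (Metric.closedBall_mem_nhds x₀ hr) (Icc_mem_nhds (by linarith) hε)
  obtain ⟨η, hη, hαη⟩ := Metric.continuousAt_iff.1 (hαc.continuousAt hdom) (δ / 2) (by positivity)
  let η' := min (min η δ) (min ε r)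
  have hη' : 0 < η' := lt_min (lt_min hη hδ) (lt_min hε hr)
  -- The Picard–Lindelöf solution, rescaled to `[0,1]`, solves `G = 0`; hence it is the implicit
  -- function, and its value at time `t` is the value of the latter at `1`.
  have heq : ∀ p : ℝ × E, dist p (0, x₀) < η' → α (p.2, p.1) = ψ p 1 := by
    rintro ⟨t, x⟩ hp
    have ht : |t| < η' := by
      simpa [Real.dist_eq] using (le_max_left _ _).trans_lt (Prod.dist_eq.symm.trans_lt hp)
    have hx : dist x x₀ < η' := (le_max_right _ _).trans_lt (Prod.dist_eq.symm.trans_lt hp)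
    have hxr : x ∈ Metric.closedBall x₀ r :=
      (hx.trans_le ((min_le_right _ _).trans (min_le_right _ _))).le
    have htε : |t| < ε := ht.trans_le ((min_le_right _ _).trans (min_le_left _ _))
    have hts : ∀ s ∈ Icc (0:ℝ) 1, |t * s| ≤ |t| := fun s hs => by
      rw [abs_mul, abs_of_nonneg hs.1]; exact mul_le_of_le_one_right (abs_nonneg _) hs.2
    have hmem : ∀ s ∈ Icc (0:ℝ) 1, t * s ∈ Ioo (-ε) ε := fun s hs =>
      abs_lt.1 ((hts s hs).trans_lt htε)
    have hder : ∀ s ∈ Icc (0:ℝ) 1, HasDerivAt (fun s => α (x, t * s)) (t • f (α (x, t * s))) s := by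
      intro s hs
      have h1 := ((hα x hxr).2 (t * s) (Ioo_subset_Icc_self (hmem s hs))).hasDerivAt
        (Icc_mem_nhds (hmem s hs).1 (hmem s hs).2)
      exact h1.scomp s (by simpa using (hasDerivAt_id s).const_mul t)
    let c : C(unitInterval, E) := ⟨fun s => α (x, t * s), by
      rw [← continuousOn_univ]
      refine hαc.comp (by fun_prop) fun s _ => ⟨hxr, Ioo_subset_Icc_self (hmem s s.2)⟩⟩
    have hG : G ((t, x), c) = 0 := by
      ext s
      have hsub : uIcc (0:ℝ) s ⊆ Icc 0 1 := by
        rw [uIcc_of_le s.2.1]; exact Icc_subset_Icc_right s.2.2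
      have h1 := intervalIntegral.integral_eq_sub_of_hasDerivAt (a := 0) (b := (s:ℝ))
        (fun r hr => hder r (hsub hr)) (by
          refine ContinuousOn.intervalIntegrable fun r hr => ?_
          exact (continuousAt_const.smul (hf.continuous.continuousAt.comp
            (f := fun s => α (x, t * s)) (hder r (hsub hr)).continuousAt)).continuousWithinAt)
      rw [intervalIntegral.integral_smul] at h1
      have h2 : ContinuousMap.primitive E (ContinuousMap.superposition fc c) s
          = ∫ r in (0:ℝ)..s, f (α (x, t * r)) := by
        rw [ContinuousMap.primitive_apply]
        refine intervalIntegral.integral_congr fun r hr => ?_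
        simp only [ContinuousMap.superposition, ContinuousMap.comp_apply]
        rw [projIcc_of_mem _ (hsub hr)]
        rfl
      have h3 : α (x, 0) = x := (hα x hxr).1
      simp only [mul_zero, h3] at h1
      simp only [G, ContinuousMap.sub_apply, ContinuousMap.smul_apply, ContinuousMap.zero_apply, h2,
        h1]
      change α (x, t * s) - x - (α (x, t * s) - x) = 0
      exact sub_self _
    have hd : dist ((t, x), c) u < δ := by
      rw [Prod.dist_eq]
      refine max_lt (hp.trans_le ((min_le_left _ _).trans (min_le_right _ _))) ?_
      refine lt_of_le_of_lt ((ContinuousMap.dist_le (by positivity : 0 ≤ δ / 2)).2 fun s => ?_)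
        (half_lt_self hδ)
      have := @hαη (x, t * s) (by
        rw [Prod.dist_eq]
        refine max_lt (hx.trans_le ((min_le_left _ _).trans (min_le_left _ _))) ?_
        simp only [Real.dist_eq, sub_zero]
        exact (hts s s.2).trans_lt (ht.trans_le ((min_le_left _ _).trans (min_le_left _ _))))
      rw [hα0] at this
      exact this.le
    have h4 : ψ (t, x) = c := (hψ' hd).1 hG
    rw [h4]
    simp [c]
  have hev : ∀ᶠ p : ℝ × E in 𝓝 (0, x₀), dist p (0, x₀) < η' := Metric.ball_mem_nhds _ hη'
  refine ⟨fun p => α (p.2, p.1), ?_, ?_⟩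
  · refine ContDiffAt.congr_of_eventuallyEq
      ((ContinuousMap.evalCLM (R := ℝ) (M := E) (1 : unitInterval)).contDiff.contDiffAt.comp _ hψ)
      ?_
    filter_upwards [hev] with p hp using heq p hp
  · filter_upwards [hev] with p hp
    have ht : |p.1| < η' := by
      simpa [Real.dist_eq] using (le_max_left _ _).trans_lt (Prod.dist_eq.symm.trans_lt hp)
    have hx : dist p.2 x₀ < η' := (le_max_right _ _).trans_lt (Prod.dist_eq.symm.trans_lt hp)
    have hxr : p.2 ∈ Metric.closedBall x₀ r :=
      (hx.trans_le ((min_le_right _ _).trans (min_le_right _ _))).le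
    have htε := abs_lt.1 (ht.trans_le ((min_le_right _ _).trans (min_le_left _ _)))
    exact ⟨(hα _ hxr).1, ((hα _ hxr).2 p.1 (Ioo_subset_Icc_self htε)).hasDerivAt
      (Icc_mem_nhds htε.1 htε.2)⟩

/-- Cutting off with a bump function makes a function that is smooth near a point smooth
everywhere. -/
theorem exists_contDiff_eventuallyEq {E F : Type*} [NormedAddCommGroup E] [NormedSpace ℝ E]
    [FiniteDimensional ℝ E] [NormedAddCommGroup F] [NormedSpace ℝ F] {f : E → F} {x₀ : E}
    (hf : ∀ᶠ x in 𝓝 x₀, ContDiffAt ℝ ∞ f x) : ∃ g : E → F, ContDiff ℝ ∞ g ∧ g =ᶠ[𝓝 x₀] f := by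
  obtain ⟨ε, hε, h⟩ := Metric.eventually_nhds_iff_ball.1 hf
  let χ : ContDiffBump x₀ := ⟨ε / 3, ε / 2, by positivity, by linarith⟩
  refine ⟨fun x => χ x • f x, ?_, ?_⟩
  · refine contDiff_iff_contDiffAt.2 fun x => ?_
    by_cases hx : x ∈ Metric.ball x₀ ε
    · exact χ.contDiff.contDiffAt.smul (h x hx)
    · have : x ∉ tsupport χ := by
        rw [χ.tsupport_eq]
        intro hx'
        exact hx (Metric.closedBall_subset_ball (by simp only [χ]; linarith) hx')
      refine (contDiffAt_const (c := (0 : F))).congr_of_eventuallyEq ?_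
      filter_upwards [(isClosed_tsupport χ).isOpen_compl.mem_nhds this] with y hy
      rw [image_eq_zero_of_notMem_tsupport hy, zero_smul]
  · filter_upwards [χ.eventuallyEq_one] with x hx
    simp [hx]

/-- A vector field that is smooth near `x₀` has a local flow that is smooth at `(0, x₀)`. -/
theorem exists_contDiffAt_localFlow {E : Type w} [NormedAddCommGroup E]
    [NormedSpace ℝ E] [FiniteDimensional ℝ E] {f : E → E} {x₀ : E}
    (hf : ∀ᶠ x in 𝓝 x₀, ContDiffAt ℝ ∞ f x) :
    ∃ α : ℝ × E → E, ContDiffAt ℝ ∞ α (0, x₀) ∧ ∀ᶠ p : ℝ × E in 𝓝 (0, x₀),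
      α (0, p.2) = p.2 ∧ HasDerivAt (fun t => α (t, p.2)) (f (α p)) p.1 := by
  have : CompleteSpace E := FiniteDimensional.complete ℝ E
  obtain ⟨g, hg, hgf⟩ := exists_contDiff_eventuallyEq hf
  obtain ⟨α, h1, h2⟩ := exists_contDiffAt_localFlow_of_contDiff hg x₀
  refine ⟨α, h1, ?_⟩
  have h0 : α (0, x₀) = x₀ := h2.self_of_nhds.1
  have hc : Tendsto α (𝓝 (0, x₀)) (𝓝 x₀) := by simpa [h0] using h1.continuousAt.tendsto
  filter_upwards [h2, hc.eventually hgf] with p hp hp'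
  exact ⟨hp.1, hp' ▸ hp.2⟩

/-! ### Flows of vector fields on manifolds -/

theorem smulRight_one_apply {E F : Type*} [NormedAddCommGroup E] [NormedSpace ℝ E]
    [NormedAddCommGroup F] [NormedSpace ℝ F] (A : E →L[ℝ] F) (v : E) :
    (1 : ℝ →L[ℝ] ℝ).smulRight (A v) = A.comp (ContinuousLinearMap.toSpanSingleton ℝ v) := by
  ext; simp

section ManifoldFlow

variable {E : Type w} [NormedAddCommGroup E] [NormedSpace ℝ E]
  {M : Type*} [TopologicalSpace M] [ChartedSpace E M]

/-- The expression of a vector field in the preferred chart at `p₀`. -/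
noncomputable def chartField (V : ∀ p : M, TangentSpace 𝓘(ℝ, E) p) (p₀ : M) (e : E) : E :=
  mfderiv 𝓘(ℝ, E) 𝓘(ℝ, E) (extChartAt 𝓘(ℝ, E) p₀) ((extChartAt 𝓘(ℝ, E) p₀).symm e)
    (V ((extChartAt 𝓘(ℝ, E) p₀).symm e))

variable [IsManifold 𝓘(ℝ, E) ∞ M]

theorem mfderiv_extChartAt_symm_apply_mfderiv {p₀ q : M} (hq : q ∈ (extChartAt 𝓘(ℝ, E) p₀).source)
    (v : TangentSpace 𝓘(ℝ, E) q) :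
    mfderiv 𝓘(ℝ, E) 𝓘(ℝ, E) (extChartAt 𝓘(ℝ, E) p₀).symm (extChartAt 𝓘(ℝ, E) p₀ q)
      (mfderiv 𝓘(ℝ, E) 𝓘(ℝ, E) (extChartAt 𝓘(ℝ, E) p₀) q v) = v := by
  have := mfderivWithin_extChartAt_symm_comp_mfderiv_extChartAt' (I := 𝓘(ℝ, E)) hq
  simp only [modelWithCornersSelf_coe, range_id, mfderivWithin_univ] at this
  exact congrArg (fun A => A v) this

theorem mfderiv_extChartAt_apply_mfderiv_symm {p₀ : M} {e : E}
    (he : e ∈ (extChartAt 𝓘(ℝ, E) p₀).target) (v : E) :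
    mfderiv 𝓘(ℝ, E) 𝓘(ℝ, E) (extChartAt 𝓘(ℝ, E) p₀) ((extChartAt 𝓘(ℝ, E) p₀).symm e)
      (mfderiv 𝓘(ℝ, E) 𝓘(ℝ, E) (extChartAt 𝓘(ℝ, E) p₀).symm e v) = v := by
  have := mfderiv_extChartAt_comp_mfderivWithin_extChartAt_symm (I := 𝓘(ℝ, E)) he
  simp only [modelWithCornersSelf_coe, range_id, mfderivWithin_univ] at this
  exact congrArg (fun A => A v) this

theorem mfderiv_extChartAt_symm_chartField {V : ∀ p : M, TangentSpace 𝓘(ℝ, E) p} {p₀ : M} {e : E}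
    (he : e ∈ (extChartAt 𝓘(ℝ, E) p₀).target) :
    mfderiv 𝓘(ℝ, E) 𝓘(ℝ, E) (extChartAt 𝓘(ℝ, E) p₀).symm e (chartField (E := E) V p₀ e) =
      V ((extChartAt 𝓘(ℝ, E) p₀).symm e) := by
  have h1 := (extChartAt 𝓘(ℝ, E) p₀).map_target he
  have := mfderiv_extChartAt_symm_apply_mfderiv h1 (V ((extChartAt 𝓘(ℝ, E) p₀).symm e))
  rw [(extChartAt 𝓘(ℝ, E) p₀).right_inv he] at this
  exact this

theorem mdifferentiableAt_extChartAt_symm' {p₀ : M} {e : E}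
    (he : e ∈ (extChartAt 𝓘(ℝ, E) p₀).target) :
    MDifferentiableAt 𝓘(ℝ, E) 𝓘(ℝ, E) (extChartAt 𝓘(ℝ, E) p₀).symm e := by
  have := mdifferentiableWithinAt_extChartAt_symm (I := 𝓘(ℝ, E)) he
  simpa [mdifferentiableWithinAt_univ] using this

theorem contMDiffAt_extChartAt_symm {p₀ : M} {e : E}
    (he : e ∈ (extChartAt 𝓘(ℝ, E) p₀).target) :
    ContMDiffAt 𝓘(ℝ, E) 𝓘(ℝ, E) ∞ (extChartAt 𝓘(ℝ, E) p₀).symm e :=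
  (contMDiffOn_extChartAt_symm p₀).contMDiffAt
    ((isOpen_extChartAt_target p₀).mem_nhds he)

omit [IsManifold 𝓘(ℝ, E) ∞ M] in
theorem extChartAt_symm_tendsto {p₀ q : M} (hq : q ∈ (extChartAt 𝓘(ℝ, E) p₀).source) :
    Tendsto (extChartAt 𝓘(ℝ, E) p₀).symm (𝓝 (extChartAt 𝓘(ℝ, E) p₀ q)) (𝓝 q) := by
  have := (continuousAt_extChartAt_symm' (I := 𝓘(ℝ, E)) hq).tendsto
  rwa [(extChartAt 𝓘(ℝ, E) p₀).left_inv hq] at this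

theorem contMDiffAt_section_iff_chartField {V : ∀ p : M, TangentSpace 𝓘(ℝ, E) p} {p₀ q : M}
    (hq : q ∈ (extChartAt 𝓘(ℝ, E) p₀).source) :
    ContMDiffAt 𝓘(ℝ, E) 𝓘(ℝ, E).tangent ∞ (fun x => (⟨x, V x⟩ : TangentBundle 𝓘(ℝ, E) M)) q ↔
      ContDiffAt ℝ ∞ (chartField V p₀) (extChartAt 𝓘(ℝ, E) p₀ q) := by
  have hq' : q ∈ (chartAt E p₀).source := by rwa [← extChartAt_source (I := 𝓘(ℝ, E))]
  have : ContMDiffVectorBundle ∞ E (TangentSpace 𝓘(ℝ, E) : M → Type _) 𝓘(ℝ, E) :=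
    inferInstance
  rw [(trivializationAt E (TangentSpace 𝓘(ℝ, E)) p₀).contMDiffAt_section_iff
    (by simpa using hq')]
  have key : (fun x => ((trivializationAt E (TangentSpace 𝓘(ℝ, E)) p₀)
      ⟨x, V x⟩ : M × E).2) =ᶠ[𝓝 q]
      fun x => chartField V p₀ (extChartAt 𝓘(ℝ, E) p₀ x) := by
    filter_upwards [(isOpen_extChartAt_source (I := 𝓘(ℝ, E)) p₀).mem_nhds hq] with x hx
    have hx' : x ∈ (chartAt E p₀).source := by rwa [← extChartAt_source (I := 𝓘(ℝ, E))]
    have h1 := congrArg (fun A => A (V x))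
      (TangentBundle.continuousLinearMapAt_trivializationAt (I := 𝓘(ℝ, E)) hx')
    unfold chartField
    rw [(extChartAt 𝓘(ℝ, E) p₀).left_inv hx]
    refine Eq.trans ?_ h1
    simp only [Bundle.Trivialization.continuousLinearMapAt_apply]
    rw [Bundle.Trivialization.linearMapAt_apply, if_pos (by simpa using hx')]
  rw [Filter.EventuallyEq.contMDiffAt_iff key]
  constructor
  · intro h
    rw [← contMDiffAt_iff_contDiffAt]
    have h2 := contMDiffAt_extChartAt_symm ((extChartAt 𝓘(ℝ, E) p₀).map_source hq)
    have h3 := ContMDiffAt.comp_of_eq h h2 ((extChartAt 𝓘(ℝ, E) p₀).left_inv hq)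
    refine h3.congr_of_eventuallyEq ?_
    filter_upwards [(isOpen_extChartAt_target (I := 𝓘(ℝ, E)) p₀).mem_nhds
      ((extChartAt 𝓘(ℝ, E) p₀).map_source hq)] with e he
    exact congrArg _ ((extChartAt 𝓘(ℝ, E) p₀).right_inv he).symm
  · intro h
    exact h.contMDiffAt.comp q (contMDiffAt_extChartAt' hq')

theorem hasMFDerivAt_extChartAt_symm_comp {V : ∀ p : M, TangentSpace 𝓘(ℝ, E) p} {p₀ : M}
    {c : ℝ → E} {t : ℝ} (ht : c t ∈ (extChartAt 𝓘(ℝ, E) p₀).target)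
    (hc : HasDerivAt c (chartField V p₀ (c t)) t) :
    HasMFDerivAt 𝓘(ℝ, ℝ) 𝓘(ℝ, E) (fun s => (extChartAt 𝓘(ℝ, E) p₀).symm (c s)) t
      ((1 : ℝ →L[ℝ] ℝ).smulRight (V ((extChartAt 𝓘(ℝ, E) p₀).symm (c t)))) := by
  have h1 := (mdifferentiableAt_extChartAt_symm' ht).hasMFDerivAt
  have h2 := h1.comp t hc.hasFDerivAt.hasMFDerivAt
  let L : ℝ →L[ℝ] E := ContinuousLinearMap.toSpanSingleton ℝ (chartField V p₀ (c t))
  have h3 : (1 : ℝ →L[ℝ] ℝ).smulRight (V ((extChartAt 𝓘(ℝ, E) p₀).symm (c t))) =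
      (mfderiv 𝓘(ℝ, E) 𝓘(ℝ, E) (extChartAt 𝓘(ℝ, E) p₀).symm (c t)).comp L := by
    rw [← mfderiv_extChartAt_symm_chartField (V := V) ht]
    exact smulRight_one_apply (E := E) (F := E) _ _
  rw [h3]
  exact h2

/-- A vector field that is smooth near `p` has a local flow that is smooth at `(0, p)`. -/
theorem exists_contMDiffAt_localFlow [FiniteDimensional ℝ E]
    {V : ∀ p : M, TangentSpace 𝓘(ℝ, E) p} {p : M}
    (hV : ∀ᶠ q in 𝓝 p, ContMDiffAt 𝓘(ℝ, E) 𝓘(ℝ, E).tangent ∞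
      (fun x => (⟨x, V x⟩ : TangentBundle 𝓘(ℝ, E) M)) q) :
    ∃ α : ℝ × M → M, ContMDiffAt (𝓘(ℝ, ℝ).prod 𝓘(ℝ, E)) 𝓘(ℝ, E) ∞ α (0, p) ∧
      ∀ᶠ x : ℝ × M in 𝓝 (0, p), α (0, x.2) = x.2 ∧
        HasMFDerivAt 𝓘(ℝ, ℝ) 𝓘(ℝ, E) (fun t => α (t, x.2)) x.1
          ((1 : ℝ →L[ℝ] ℝ).smulRight (V (α x))) := by
  have hps := mem_extChartAt_source (I := 𝓘(ℝ, E)) p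
  have hpt := (extChartAt 𝓘(ℝ, E) p).map_source hps
  have htm := (isOpen_extChartAt_target (I := 𝓘(ℝ, E)) p).mem_nhds hpt
  have hsm := (isOpen_extChartAt_source (I := 𝓘(ℝ, E)) p).mem_nhds hps
  have h1 : ∀ᶠ e in 𝓝 (extChartAt 𝓘(ℝ, E) p p), ContDiffAt ℝ ∞ (chartField V p) e := by
    filter_upwards [(extChartAt_symm_tendsto hps).eventually hV, htm] with e he het
    have h2 := (extChartAt 𝓘(ℝ, E) p).map_target het
    have h3 := (contMDiffAt_section_iff_chartField h2).1 he
    rwa [(extChartAt 𝓘(ℝ, E) p).right_inv het] at h3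
  obtain ⟨α, hα, hev⟩ := exists_contDiffAt_localFlow h1
  have h0 : α (0, extChartAt 𝓘(ℝ, E) p p) = extChartAt 𝓘(ℝ, E) p p := hev.self_of_nhds.1
  have hch : ContMDiffAt (𝓘(ℝ, ℝ).prod 𝓘(ℝ, E)) 𝓘(ℝ, ℝ × E) ∞
      (fun x : ℝ × M => (x.1, extChartAt 𝓘(ℝ, E) p x.2)) (0, p) :=
    contMDiffAt_fst.prodMk_space
      ((contMDiffAt_extChartAt (I := 𝓘(ℝ, E)) (x := p)).comp (0, p) contMDiffAt_snd)
  refine ⟨fun x => (extChartAt 𝓘(ℝ, E) p).symm (α (x.1, extChartAt 𝓘(ℝ, E) p x.2)), ?_, ?_⟩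
  · have h4 : ContMDiffAt (𝓘(ℝ, ℝ).prod 𝓘(ℝ, E)) 𝓘(ℝ, E) ∞
        (fun x : ℝ × M => α (x.1, extChartAt 𝓘(ℝ, E) p x.2)) (0, p) :=
      ContMDiffAt.comp (g := α) (0, p) hα.contMDiffAt hch
    exact ContMDiffAt.comp_of_eq (contMDiffAt_extChartAt_symm hpt) h4 h0
  · have hc : Tendsto (fun x : ℝ × M => (x.1, extChartAt 𝓘(ℝ, E) p x.2)) (𝓝 (0, p))
        (𝓝 (0, extChartAt 𝓘(ℝ, E) p p)) := hch.continuousAt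
    have hαc : Tendsto α (𝓝 (0, extChartAt 𝓘(ℝ, E) p p)) (𝓝 (extChartAt 𝓘(ℝ, E) p p)) := by
      have := hα.continuousAt.tendsto
      rwa [h0] at this
    have hsnd : Tendsto (fun x : ℝ × M => x.2) (𝓝 (0, p)) (𝓝 p) := continuous_snd.continuousAt
    filter_upwards [hc.eventually hev, (hαc.comp hc).eventually htm, hsnd.eventually hsm]
      with x hx hxt hxs
    refine ⟨?_, hasMFDerivAt_extChartAt_symm_comp hxt hx.2⟩
    rw [hx.1]
    exact (extChartAt 𝓘(ℝ, E) p).left_inv hxs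

/-- Integral curves that stay in a set on which the vector field is smooth are determined by
their value at one time. -/
theorem IsMIntegralCurve.eq_of_contMDiffAt [CompleteSpace E] [T2Space M]
    {V : ∀ p : M, TangentSpace 𝓘(ℝ, E) p}
    {γ γ' : ℝ → M} (hV : ∀ t, ContMDiffAt 𝓘(ℝ, E) 𝓘(ℝ, E).tangent ∞
      (fun x => (⟨x, V x⟩ : TangentBundle 𝓘(ℝ, E) M)) (γ t))
    (hγ : IsMIntegralCurve (I := 𝓘(ℝ, E)) γ V) (hγ' : IsMIntegralCurve (I := 𝓘(ℝ, E)) γ' V)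
    {t₀ : ℝ} (h : γ t₀ = γ' t₀) : γ = γ' := by
  have hcl : IsClopen {t | γ t = γ' t} := by
    refine ⟨isClosed_eq hγ.continuous hγ'.continuous, isOpen_iff_mem_nhds.2 fun t ht => ?_⟩
    exact isMIntegralCurveAt_eventuallyEq_of_contMDiffAt_boundaryless ((hV t).of_le (by simp))
      (hγ.isMIntegralCurveAt t) (hγ'.isMIntegralCurveAt t) ht
  have := hcl.eq_univ ⟨t₀, h⟩
  funext t
  exact this.symm.subset (mem_univ t)

/-- A compactly supported smooth vector field has a global smooth flow. -/
theorem exists_flow_of_compact_support [FiniteDimensional ℝ E] [T2Space M]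
    {V : ∀ p : M, TangentSpace 𝓘(ℝ, E) p}
    (hV : ∀ q, ContMDiffAt 𝓘(ℝ, E) 𝓘(ℝ, E).tangent ∞
      (fun x => (⟨x, V x⟩ : TangentBundle 𝓘(ℝ, E) M)) q)
    {K : Set M} (hK : IsCompact K) (hVK : ∀ p ∉ K, V p = 0) :
    ∃ Φ : ℝ → M → M, (∀ p, Φ 0 p = p) ∧ (∀ p, IsMIntegralCurve (I := 𝓘(ℝ, E)) (Φ · p) V) ∧
      ContMDiff (𝓘(ℝ, ℝ).prod 𝓘(ℝ, E)) 𝓘(ℝ, E) ∞ (fun x : ℝ × M => Φ x.1 x.2) := by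
  have : CompleteSpace E := FiniteDimensional.complete ℝ E
  have hV1 : ContMDiff 𝓘(ℝ, E) 𝓘(ℝ, E).tangent 1
      (fun x => (⟨x, V x⟩ : TangentBundle 𝓘(ℝ, E) M)) := fun q => (hV q).of_le (by simp)
  choose α hα hev using fun p => exists_contMDiffAt_localFlow (Eventually.of_forall hV) (p := p)
  have hloc : ∀ p, ∃ ε > 0, ∃ N ∈ 𝓝 p, ∀ q ∈ N, α p (0, q) = q ∧
      IsMIntegralCurveOn (I := 𝓘(ℝ, E)) (fun t => α p (t, q)) V (Ioo (-ε) ε) := by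
    intro p
    have h1 := hev p
    rw [nhds_prod_eq] at h1
    obtain ⟨S, hS, N, hN, hSN⟩ := Filter.mem_prod_iff.1 h1
    obtain ⟨ε, hε, hεS⟩ := Metric.mem_nhds_iff.1 hS
    rw [Real.ball_eq_Ioo] at hεS
    simp only [zero_sub, zero_add] at hεS
    exact ⟨ε, hε, N, hN, fun q hq => ⟨(hSN (mk_mem_prod (mem_of_mem_nhds hS) hq)).1,
      fun t ht => (hSN (mk_mem_prod (hεS ht) hq)).2.hasMFDerivWithinAt⟩⟩
  choose ε hε N hN hloc using hloc
  obtain ⟨T, -, hT⟩ := hK.elim_nhds_subcover N fun p _ => hN p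
  obtain ⟨δ, hδ, hδT⟩ : ∃ δ > 0, ∀ p ∈ T, δ ≤ ε p := by
    rcases T.eq_empty_or_nonempty with rfl | hne
    · exact ⟨1, one_pos, by simp⟩
    · obtain ⟨p, _, hp⟩ := T.exists_min_image ε hne
      exact ⟨ε p, hε p, hp⟩
  have hex : ∀ p, ∃ γ : ℝ → M, γ 0 = p ∧ IsMIntegralCurve (I := 𝓘(ℝ, E)) γ V :=
    exists_isMIntegralCurve_of_isMIntegralCurveOn hV1 hδ fun q => by
      by_cases hq : q ∈ K
      · obtain ⟨p, hpT, hqp⟩ := mem_iUnion₂.1 (hT hq)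
        exact ⟨_, (hloc p q hqp).1, (hloc p q hqp).2.mono
          (Ioo_subset_Ioo (neg_le_neg (hδT p hpT)) (hδT p hpT))⟩
      · exact ⟨fun _ => q, rfl, (isMIntegralCurve_const (hVK q hq)).isMIntegralCurveOn _⟩
  choose Φ' hΦ0 hΦ using hex
  have huniq : ∀ {γ : ℝ → M}, IsMIntegralCurve (I := 𝓘(ℝ, E)) γ V → γ = Φ' (γ 0) := fun h =>
    isMIntegralCurve_Ioo_eq_of_contMDiff_boundaryless (t₀ := 0) hV1 h (hΦ _) (hΦ0 _).symm
  have hgrp : ∀ s t p, Φ' p (s + t) = Φ' (Φ' p t) s := fun s t p => by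
    have := huniq ((hΦ p).comp_add t)
    simpa using congrFun this s
  have hconst : ∀ p ∉ K, ∀ t, Φ' p t = p := fun p hp t => by
    have := huniq (γ := fun _ => p) (isMIntegralCurve_const (hVK p hp))
    exact (congrFun this t).symm
  refine ⟨fun t p => Φ' p t, hΦ0, hΦ, contMDiff_infty.2 fun m => ?_⟩
  let Ψ : ℝ × M → M := fun x => Φ' x.2 x.1
  have hzero : ∀ p, ContMDiffAt (𝓘(ℝ, ℝ).prod 𝓘(ℝ, E)) 𝓘(ℝ, E) ∞ Ψ (0, p) := by
    intro p
    refine (hα p).congr_of_eventuallyEq ?_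
    have : Ioo (-ε p) (ε p) ×ˢ N p ∈ 𝓝 ((0, p) : ℝ × M) :=
      prod_mem_nhds (Ioo_mem_nhds (by linarith [hε p]) (hε p)) (hN p)
    filter_upwards [this] with x hx
    have h1 := isMIntegralCurveOn_Ioo_eqOn_of_contMDiff_boundaryless (t₀ := 0)
      ⟨by linarith [hε p], hε p⟩ hV1 ((hΦ x.2).isMIntegralCurveOn _) (hloc p x.2 hx.2).2
      ((hΦ0 x.2).trans (hloc p x.2 hx.2).1.symm)
    exact h1 hx.1
  -- There is a uniform time interval on which the flow is of class `C^m`. The order `m` is finite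
  -- because `C^∞` at a point does not give a neighborhood on which all derivatives exist.
  have hunif : ∃ δ > 0, ∀ t p, |t| ≤ δ →
      ContMDiffAt (𝓘(ℝ, ℝ).prod 𝓘(ℝ, E)) 𝓘(ℝ, E) m Ψ (t, p) := by
    have h1 : ∀ p, ∃ ε > 0, ∃ N ∈ 𝓝 p, ∀ t, |t| < ε → ∀ q ∈ N,
        ContMDiffAt (𝓘(ℝ, ℝ).prod 𝓘(ℝ, E)) 𝓘(ℝ, E) m Ψ (t, q) := by
      intro p
      have h2 := contMDiffAt_iff_contMDiffAt_nhds (by simp) |>.1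
        ((hzero p).of_le (m := m) (by exact_mod_cast le_top))
      rw [nhds_prod_eq] at h2
      obtain ⟨S, hS, N, hN, hSN⟩ := Filter.mem_prod_iff.1 h2
      obtain ⟨ε, hε, hεS⟩ := Metric.mem_nhds_iff.1 hS
      exact ⟨ε, hε, N, hN, fun t ht q hq => hSN (mk_mem_prod (hεS (by simpa using ht)) hq)⟩
    choose ε' hε' N' hN' h1 using h1
    obtain ⟨T, -, hT⟩ := hK.elim_nhds_subcover N' fun p _ => hN' p
    obtain ⟨δ, hδ, hδT⟩ : ∃ δ > 0, ∀ p ∈ T, δ < ε' p := by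
      rcases T.eq_empty_or_nonempty with rfl | hne
      · exact ⟨1, one_pos, by simp⟩
      · obtain ⟨p, _, hp⟩ := T.exists_min_image ε' hne
        exact ⟨ε' p / 2, half_pos (hε' p), fun q hq =>
          (half_lt_self (hε' p)).trans_le (hp q hq)⟩
    refine ⟨δ, hδ, fun t p ht => ?_⟩
    by_cases hp : p ∈ K
    · obtain ⟨q, hqT, hpq⟩ := mem_iUnion₂.1 (hT hp)
      exact h1 q t (ht.trans_lt (hδT q hqT)) p hpq
    · refine ContMDiffAt.congr_of_eventuallyEq contMDiffAt_snd ?_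
      have : (univ : Set ℝ) ×ˢ Kᶜ ∈ 𝓝 (t, p) :=
        prod_mem_nhds univ_mem (hK.isClosed.isOpen_compl.mem_nhds hp)
      filter_upwards [this] with x hx using hconst x.2 hx.2 x.1
  obtain ⟨δ, hδ, hunif⟩ := hunif
  -- Longer times are split into steps of length at most `δ`.
  have hall : ∀ k : ℕ, ∀ t p, |t| ≤ k * δ →
      ContMDiffAt (𝓘(ℝ, ℝ).prod 𝓘(ℝ, E)) 𝓘(ℝ, E) m Ψ (t, p) := by
    intro k
    induction k with
    | zero =>
      intro t p ht
      exact hunif t p (ht.trans (by simpa using hδ.le))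
    | succ k ih =>
      intro t p ht
      have hk : (0 : ℝ) < k + 1 := by positivity
      push_cast at ht
      have hs : |t / (k + 1)| ≤ δ := by
        rw [abs_div, abs_of_pos hk, div_le_iff₀ hk]; linarith
      have ha : |t - t / (k + 1)| ≤ k * δ := by
        have : t - t / (k + 1) = k * (t / (k + 1)) := by field_simp; ring
        rw [this, abs_mul, abs_of_nonneg (Nat.cast_nonneg k)]
        exact mul_le_mul_of_nonneg_left hs (Nat.cast_nonneg k)
      set s := t / (k + 1)
      set a := t - s
      have h3 : Ψ = fun x : ℝ × M => Ψ (x.1 - a, Ψ (a, x.2)) := by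
        funext x
        simp only [Ψ]
        rw [← hgrp]; simp
      rw [h3]
      have h4 : ContMDiffAt (𝓘(ℝ, ℝ).prod 𝓘(ℝ, E)) 𝓘(ℝ, E) m (fun x : ℝ × M => Ψ (a, x.2))
          (t, p) :=
        ContMDiffAt.comp (g := Ψ) (f := fun x : ℝ × M => (a, x.2)) (t, p) (ih a p ha)
          (contMDiffAt_const.prodMk contMDiffAt_snd)
      have h6 : ContMDiffAt (𝓘(ℝ, ℝ).prod 𝓘(ℝ, E)) 𝓘(ℝ, ℝ) m (fun x : ℝ × M => x.1 - a) (t, p) :=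
        ((contDiff_id.sub contDiff_const).contMDiff (n := m)).contMDiffAt.comp (t, p)
          contMDiffAt_fst
      exact ContMDiffAt.comp_of_eq (g := Ψ)
        (hunif s (Ψ (a, p)) hs) (h6.prodMk h4) (by simp [a, s])
  rintro ⟨t, p⟩
  obtain ⟨k, hk⟩ := exists_nat_ge (|t| / δ)
  exact hall k t p ((div_le_iff₀ hδ).1 hk)

end ManifoldFlow

/-! ### Closed forms and Lie derivatives on vector spaces -/

section Forms

variable {E : Type*} [NormedAddCommGroup E] [NormedSpace ℝ E]

variable (E) in
/-- Alternating 1-forms as linear functionals. -/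
noncomputable def oneFormEquiv : (E [⋀^Fin 1]→L[ℝ] ℝ) ≃ₗᵢ[ℝ] (E →L[ℝ] ℝ) :=
  (ContinuousAlternatingMap.ofSubsingletonLIE (𝕜 := ℝ) (E := E) (F := ℝ) (0 : Fin 1)).symm

theorem oneFormEquiv_apply (β : E [⋀^Fin 1]→L[ℝ] ℝ) (a : E) : oneFormEquiv E β a = β ![a] := by
  change β (fun _ => a) = _
  congr 1
  ext i
  fin_cases i; rfl

variable (E) in
/-- Alternating 2-forms as bilinear forms. -/
noncomputable def twoFormCurry : (E [⋀^Fin 2]→L[ℝ] ℝ) →L[ℝ] E →L[ℝ] E →L[ℝ] ℝ :=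
  (ContinuousLinearMap.compL ℝ E (E [⋀^Fin 1]→L[ℝ] ℝ) (E →L[ℝ] ℝ)
    (oneFormEquiv E).toContinuousLinearEquiv.toContinuousLinearMap).comp
    (ContinuousAlternatingMap.curryLeftLI (𝕜 := ℝ) (E := E) (F := ℝ) (n := 1)).toContinuousLinearMap

theorem twoFormCurry_apply (Ω : E [⋀^Fin 2]→L[ℝ] ℝ) (a b : E) :
    twoFormCurry E Ω a b = Ω ![a, b] := by
  change oneFormEquiv E (Ω.curryLeft a) b = _
  rw [oneFormEquiv_apply]
  rfl

theorem hasFDerivAt_twoFormCurry (Ω : E [⋀^Fin 2]→L[ℝ] ℝ) :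
    HasFDerivAt (twoFormCurry E) (twoFormCurry E) Ω :=
  ContinuousLinearMap.hasFDerivAt (E := E [⋀^Fin 2]→L[ℝ] ℝ) (F := E →L[ℝ] E →L[ℝ] ℝ) _

theorem contDiff_twoFormCurry {m : WithTop ℕ∞} : ContDiff ℝ m (twoFormCurry E) :=
  ContinuousLinearMap.contDiff (E := E [⋀^Fin 2]→L[ℝ] ℝ) (F := E →L[ℝ] E →L[ℝ] ℝ) _

theorem twoForm_swap (Ω : E [⋀^Fin 2]→L[ℝ] ℝ) (a b : E) : Ω ![a, b] = -Ω ![b, a] := by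
  have := Ω.toAlternatingMap.map_swap ![a, b] (i := 0) (j := 1) (by simp)
  have h : (![a, b] ∘ Equiv.swap (0 : Fin 2) 1 : Fin 2 → E) = ![b, a] := by
    ext i; fin_cases i <;> simp
  rw [h] at this
  have h2 : Ω ![b, a] = -Ω ![a, b] := this
  rw [h2, neg_neg]

theorem fderiv_oneFormEquiv {β : E → E [⋀^Fin 1]→L[ℝ] ℝ} {e : E} (hβ : DifferentiableAt ℝ β e)
    (a b : E) :
    fderiv ℝ (fun x => oneFormEquiv E (β x)) e a b = fderiv ℝ β e a ![b] := by
  have := ((oneFormEquiv E).toContinuousLinearEquiv.toContinuousLinearMap.hasFDerivAt.comp e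
    hβ.hasFDerivAt).fderiv
  have h2 : fderiv ℝ (fun x => oneFormEquiv E (β x)) e a = oneFormEquiv E (fderiv ℝ β e a) :=
    congrArg (fun A => A a) this
  rw [h2, oneFormEquiv_apply]

theorem fderiv_twoFormCurry {Ω : E → E [⋀^Fin 2]→L[ℝ] ℝ} {e : E} (hΩ : DifferentiableAt ℝ Ω e)
    (a b c : E) :
    fderiv ℝ (fun x => twoFormCurry E (Ω x)) e a b c = fderiv ℝ Ω e a ![b, c] := by
  have := (HasFDerivAt.comp (E := E) (F := E [⋀^Fin 2]→L[ℝ] ℝ) (G := E →L[ℝ] E →L[ℝ] ℝ) e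
    (hasFDerivAt_twoFormCurry (Ω e)) hΩ.hasFDerivAt).fderiv
  have h2 : fderiv ℝ (fun x => twoFormCurry E (Ω x)) e a = twoFormCurry E (fderiv ℝ Ω e a) :=
    congrArg (fun A => A a) this
  rw [h2, twoFormCurry_apply]

/-- A 1-form is closed at `e` exactly when its derivative is a symmetric bilinear form. -/
theorem extDeriv_oneForm_eq_zero_iff {β : E → E [⋀^Fin 1]→L[ℝ] ℝ} {e : E}
    (hβ : DifferentiableAt ℝ β e) :
    extDeriv β e = 0 ↔ ∀ a b, fderiv ℝ (fun x => oneFormEquiv E (β x)) e a b =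
      fderiv ℝ (fun x => oneFormEquiv E (β x)) e b a := by
  have key : ∀ v : Fin 2 → E, extDeriv β e v =
      fderiv ℝ β e (v 0) ![v 1] - fderiv ℝ β e (v 1) ![v 0] := by
    intro v
    rw [extDeriv, ContinuousAlternatingMap.alternatizeUncurryFin_apply, Fin.sum_univ_two]
    have h0 : Fin.removeNth 0 v = ![v 1] := by ext i; fin_cases i; rfl
    have h1 : Fin.removeNth 1 v = ![v 0] := by ext i; fin_cases i; rfl
    rw [h0, h1]
    simp [sub_eq_add_neg]
  simp only [fderiv_oneFormEquiv hβ]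
  constructor
  · intro h a b
    have := key ![a, b]
    rw [h] at this
    exact sub_eq_zero.1 this.symm
  · intro h
    ext v
    rw [key, h, sub_self]; rfl

theorem fderiv_twoForm_cyclic {Ω : E → E [⋀^Fin 2]→L[ℝ] ℝ} {e : E} (hΩ : DifferentiableAt ℝ Ω e)
    (h : extDeriv Ω e = 0) (a b c : E) :
    fderiv ℝ (fun x => twoFormCurry E (Ω x)) e a b c
      - fderiv ℝ (fun x => twoFormCurry E (Ω x)) e b a c
      + fderiv ℝ (fun x => twoFormCurry E (Ω x)) e c a b = 0 := by
  have := congrArg (fun A => A ![a, b, c]) h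
  simp only [extDeriv, ContinuousAlternatingMap.alternatizeUncurryFin_apply] at this
  replace this := (Fin.sum_univ_three _).symm.trans this
  have h0 : Fin.removeNth 0 ![a, b, c] = ![b, c] := by ext i; fin_cases i <;> rfl
  have h1 : Fin.removeNth 1 ![a, b, c] = ![a, c] := by ext i; fin_cases i <;> rfl
  have h2 : Fin.removeNth 2 ![a, b, c] = ![a, b] := by ext i; fin_cases i <;> rfl
  rw [h0, h1, h2] at this
  simp only [fderiv_twoFormCurry hΩ]
  simpa [sub_eq_add_neg] using this

/-- Cartan's formula: a closed 2-form has zero Lie derivative along `f` if its contraction with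
`f` is closed. -/
theorem lieDeriv_twoForm_eq_zero {Ω : E → E [⋀^Fin 2]→L[ℝ] ℝ} {β : E → E [⋀^Fin 1]→L[ℝ] ℝ}
    {f : E → E} {e : E} (hΩ : DifferentiableAt ℝ Ω e) (hf : DifferentiableAt ℝ f e)
    (hdΩ : extDeriv Ω e = 0) (hβ : DifferentiableAt ℝ β e) (hdβ : extDeriv β e = 0)
    (h : ∀ᶠ x in 𝓝 e, ∀ w, Ω x ![f x, w] = β x ![w]) (a b : E) :
    fderiv ℝ (fun x => twoFormCurry E (Ω x)) e (f e) a b + Ω e ![fderiv ℝ f e a, b]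
      + Ω e ![a, fderiv ℝ f e b] = 0 := by
  set W := fun x => twoFormCurry E (Ω x) with hW
  have hWd : DifferentiableAt ℝ W e := 
    (HasFDerivAt.comp (E := E) (F := E [⋀^Fin 2]→L[ℝ] ℝ) (G := E →L[ℝ] E →L[ℝ] ℝ) e
      (hasFDerivAt_twoFormCurry (Ω e)) hΩ.hasFDerivAt).differentiableAt
  have h1 : (fun x => oneFormEquiv E (β x)) =ᶠ[𝓝 e] fun x => W x (f x) := by
    filter_upwards [h] with x hx
    ext w
    rw [oneFormEquiv_apply, ← hx, hW, twoFormCurry_apply]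
  have h2 : ∀ a b, fderiv ℝ (fun x => oneFormEquiv E (β x)) e a b =
      W e (fderiv ℝ f e a) b + fderiv ℝ W e a (f e) b := by
    intro a b
    rw [h1.fderiv_eq, (hWd.hasFDerivAt.clm_apply hf.hasFDerivAt).fderiv]
    simp
  have h3 := (extDeriv_oneForm_eq_zero_iff hβ).1 hdβ a b
  rw [h2, h2] at h3
  have h4 := fderiv_twoForm_cyclic hΩ hdΩ (f e) a b
  simp only [hW, twoFormCurry_apply] at h3 h4 ⊢
  rw [twoForm_swap (Ω e) a]
  linarith

/-- Cartan's formula for a closed 1-form whose contraction with `f` vanishes. -/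
theorem lieDeriv_oneForm_eq_zero {β : E → E [⋀^Fin 1]→L[ℝ] ℝ}
    {f : E → E} {e : E} (hf : DifferentiableAt ℝ f e)
    (hβ : DifferentiableAt ℝ β e) (hdβ : extDeriv β e = 0)
    (h : ∀ᶠ x in 𝓝 e, β x ![f x] = 0) (a : E) :
    fderiv ℝ (fun x => oneFormEquiv E (β x)) e (f e) a + β e ![fderiv ℝ f e a] = 0 := by
  set B := fun x => oneFormEquiv E (β x) with hB
  have hBd : DifferentiableAt ℝ B e :=
    (oneFormEquiv E).toContinuousLinearEquiv.toContinuousLinearMap.differentiableAt.comp e hβ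
  have h1 : (fun x => B x (f x)) =ᶠ[𝓝 e] fun _ => 0 := by
    filter_upwards [h] with x hx
    rw [hB, oneFormEquiv_apply, hx]
  have h2 := congrArg (fun A => A a) ((hBd.hasFDerivAt.clm_apply hf.hasFDerivAt).fderiv.symm.trans
    (h1.fderiv_eq))
  simp only [fderiv_fun_const] at h2
  rw [(extDeriv_oneForm_eq_zero_iff hβ).1 hdβ, ← oneFormEquiv_apply, add_comm]
  simpa using h2

/-- The variational equation: the derivative of a flow in the initial point solves the linearized
equation. -/
theorem hasDerivAt_fderiv_flow {F : Type*} [NormedAddCommGroup F] [NormedSpace ℝ F]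
    {u : ℝ × F → E} {f : E → E} {t₀ : ℝ} {x₀ : F} (hu : ContDiffAt ℝ 2 u (t₀, x₀))
    (hf : DifferentiableAt ℝ f (u (t₀, x₀)))
    (h : ∀ᶠ x in 𝓝 (t₀, x₀), fderiv ℝ u x (1, 0) = f (u x)) (v : F) :
    HasDerivAt (fun t => fderiv ℝ u (t, x₀) (0, v))
      (fderiv ℝ f (u (t₀, x₀)) (fderiv ℝ u (t₀, x₀) (0, v))) t₀ := by
  have h1 : HasFDerivAt (fderiv ℝ u) (fderiv ℝ (fderiv ℝ u) (t₀, x₀)) (t₀, x₀) :=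
    ((hu.fderiv_right (m := 1) (by norm_num)).differentiableAt (by simp)).hasFDerivAt
  have hsym : fderiv ℝ (fderiv ℝ u) (t₀, x₀) (1, 0) (0, v) =
      fderiv ℝ (fderiv ℝ u) (t₀, x₀) (0, v) (1, 0) :=
    (hu.isSymmSndFDerivAt (by simp)).eq _ _
  have hu1 : HasFDerivAt u (fderiv ℝ u (t₀, x₀)) (t₀, x₀) :=
    (hu.differentiableAt (by simp)).hasFDerivAt
  generalize fderiv ℝ (fderiv ℝ u) (t₀, x₀) = D at h1 hsym
  generalize hL : fderiv ℝ u (t₀, x₀) = L at hu1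
  have h2 : D (0, v) (1, 0) = fderiv ℝ f (u (t₀, x₀)) (L (0, v)) := by
    have h3 : HasFDerivAt (fun x => fderiv ℝ u x (1, 0)) ((fderiv ℝ f (u (t₀, x₀))).comp L)
        (t₀, x₀) := (hf.hasFDerivAt.comp (t₀, x₀) hu1).congr_of_eventuallyEq h
    have h4 : HasFDerivAt (fun x => fderiv ℝ u x (1, 0)) (D.flip (1, 0)) (t₀, x₀) :=
      (ContinuousLinearMap.apply ℝ E ((1 : ℝ), (0 : F))).hasFDerivAt.comp (t₀, x₀) h1
    exact congrArg (fun A => A (0, v)) (h4.unique h3)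
  have h5 : HasDerivAt (fun t : ℝ => (t, x₀)) ((1 : ℝ), (0 : F)) t₀ :=
    (hasDerivAt_id t₀).prodMk (hasDerivAt_const t₀ x₀)
  have h6 : HasDerivAt (fun t => fderiv ℝ u (t, x₀)) (D (1, 0)) t₀ :=
    h1.comp_hasDerivAt t₀ h5
  have h7 : HasDerivAt (fun t => fderiv ℝ u (t, x₀) (0, v)) (D (1, 0) (0, v)) t₀ :=
    (ContinuousLinearMap.apply ℝ E ((0 : ℝ), v)).hasFDerivAt.comp_hasDerivAt t₀ h6
  rwa [hsym, h2] at h7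

end Forms

/-! ### The variational equation on manifolds -/

section Variation

variable {E : Type w} [NormedAddCommGroup E] [NormedSpace ℝ E]
  {M : Type*} [TopologicalSpace M] [ChartedSpace E M] [IsManifold 𝓘(ℝ, E) ∞ M]

/-- The derivative of a curve in the manifold, read in a chart. -/
theorem HasMFDerivAt.hasDerivAt_extChartAt {V : ∀ p : M, TangentSpace 𝓘(ℝ, E) p} {γ : ℝ → M}
    {t : ℝ} {q₀ : M} (hq : γ t ∈ (extChartAt 𝓘(ℝ, E) q₀).source)
    (hγ : HasMFDerivAt 𝓘(ℝ, ℝ) 𝓘(ℝ, E) γ t ((1 : ℝ →L[ℝ] ℝ).smulRight (V (γ t)))) :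
    HasDerivAt (fun s => extChartAt 𝓘(ℝ, E) q₀ (γ s))
      (chartField V q₀ (extChartAt 𝓘(ℝ, E) q₀ (γ t))) t := by
  have hq' : γ t ∈ (chartAt E q₀).source := by rwa [← extChartAt_source (I := 𝓘(ℝ, E))]
  have h1 := (mdifferentiableAt_extChartAt (I := 𝓘(ℝ, E)) hq').hasMFDerivAt.comp t hγ
  let A : ℝ →L[ℝ] E := (mfderiv 𝓘(ℝ, E) 𝓘(ℝ, E) (extChartAt 𝓘(ℝ, E) q₀) (γ t)).comp
    ((1 : ℝ →L[ℝ] ℝ).smulRight (V (γ t)))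
  have h2 : HasFDerivAt (fun s => extChartAt 𝓘(ℝ, E) q₀ (γ s)) A t := h1.hasFDerivAt
  refine h2.hasDerivAt.congr_deriv ?_
  unfold chartField
  rw [(extChartAt 𝓘(ℝ, E) q₀).left_inv hq]
  refine congrArg (mfderiv 𝓘(ℝ, E) 𝓘(ℝ, E) (extChartAt 𝓘(ℝ, E) q₀) (γ t)) ?_
  exact one_smul ℝ (V (γ t))

/-- The variational equation for a flow on a manifold, read in a chart. -/
theorem hasDerivAt_mfderiv_flow {V : ∀ p : M, TangentSpace 𝓘(ℝ, E) p} {φ : ℝ × M → M}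
    {t₀ : ℝ} {p q₀ : M} (hφ : ContMDiffAt (𝓘(ℝ, ℝ).prod 𝓘(ℝ, E)) 𝓘(ℝ, E) ∞ φ (t₀, p))
    (hq : φ (t₀, p) ∈ (extChartAt 𝓘(ℝ, E) q₀).source)
    (hV : DifferentiableAt ℝ (chartField V q₀) (extChartAt 𝓘(ℝ, E) q₀ (φ (t₀, p))))
    (hflow : ∀ᶠ x in 𝓝 (t₀, p), HasMFDerivAt 𝓘(ℝ, ℝ) 𝓘(ℝ, E) (fun t => φ (t, x.2)) x.1
      ((1 : ℝ →L[ℝ] ℝ).smulRight (V (φ x)))) (v : TangentSpace 𝓘(ℝ, E) p) :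
    HasDerivAt (fun t => (mfderiv 𝓘(ℝ, E) 𝓘(ℝ, E) (extChartAt 𝓘(ℝ, E) q₀) (φ (t, p))
        (mfderiv 𝓘(ℝ, E) 𝓘(ℝ, E) (fun q => φ (t, q)) p v) : E))
      (fderiv ℝ (chartField V q₀) (extChartAt 𝓘(ℝ, E) q₀ (φ (t₀, p)))
        (mfderiv 𝓘(ℝ, E) 𝓘(ℝ, E) (extChartAt 𝓘(ℝ, E) q₀) (φ (t₀, p))
          (mfderiv 𝓘(ℝ, E) 𝓘(ℝ, E) (fun q => φ (t₀, q)) p v))) t₀ := by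
  have hps := mem_extChartAt_source (I := 𝓘(ℝ, E)) p
  have hpt := (extChartAt 𝓘(ℝ, E) p).map_source hps
  set x₀ := extChartAt 𝓘(ℝ, E) p p with hx₀
  set u : ℝ × E → E := fun x => extChartAt 𝓘(ℝ, E) q₀ (φ (x.1, (extChartAt 𝓘(ℝ, E) p).symm x.2))
    with hu
  have hsymm : (extChartAt 𝓘(ℝ, E) p).symm x₀ = p := (extChartAt 𝓘(ℝ, E) p).left_inv hps
  have hq' : φ (t₀, p) ∈ (chartAt E q₀).source := by rwa [← extChartAt_source (I := 𝓘(ℝ, E))]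
  have hin : ContMDiffAt 𝓘(ℝ, ℝ × E) (𝓘(ℝ, ℝ).prod 𝓘(ℝ, E)) ∞
      (fun x : ℝ × E => (x.1, (extChartAt 𝓘(ℝ, E) p).symm x.2)) (t₀, x₀) := by
    have h1 : ContMDiffAt 𝓘(ℝ, ℝ × E) 𝓘(ℝ, ℝ) ∞ (fun x : ℝ × E => x.1) (t₀, x₀) :=
      contDiffAt_fst.contMDiffAt
    have h2 : ContMDiffAt 𝓘(ℝ, ℝ × E) 𝓘(ℝ, E) ∞ (fun x : ℝ × E => x.2) (t₀, x₀) :=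
      contDiffAt_snd.contMDiffAt
    exact h1.prodMk (ContMDiffAt.comp (t₀, x₀) (contMDiffAt_extChartAt_symm hpt) h2)
  have huC : ContDiffAt ℝ ∞ u (t₀, x₀) := by
    rw [← contMDiffAt_iff_contDiffAt]
    have h1 : ContMDiffAt 𝓘(ℝ, ℝ × E) 𝓘(ℝ, E) ∞
        (fun x : ℝ × E => φ (x.1, (extChartAt 𝓘(ℝ, E) p).symm x.2)) (t₀, x₀) :=
      ContMDiffAt.comp_of_eq hφ hin (by rw [hsymm])
    refine ContMDiffAt.comp_of_eq (contMDiffAt_extChartAt' hq') h1 (by rw [hsymm])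
  have hu0 : u (t₀, x₀) = extChartAt 𝓘(ℝ, E) q₀ (φ (t₀, p)) := by simp only [hu, hsymm]
  have hφ1 := contMDiffAt_iff_contMDiffAt_nhds (n := 1) (by simp) |>.1 (hφ.of_le (by simp))
  have hsrc : ∀ᶠ x in 𝓝 (t₀, p), φ x ∈ (extChartAt 𝓘(ℝ, E) q₀).source :=
    hφ.continuousAt.eventually ((isOpen_extChartAt_source (I := 𝓘(ℝ, E)) q₀).mem_nhds hq)
  have hu1 : ∀ᶠ x in 𝓝 (t₀, x₀), DifferentiableAt ℝ u x := by
    have := (huC.of_le (m := 1) (by simp)).eventually (by simp)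
    filter_upwards [this] with x hx using hx.differentiableAt (by simp)
  have htend : Tendsto (fun x : ℝ × E => (x.1, (extChartAt 𝓘(ℝ, E) p).symm x.2)) (𝓝 (t₀, x₀))
      (𝓝 (t₀, p)) := by
    have := hin.continuousAt.tendsto
    simpa only [hsymm] using this
  have hut : ∀ᶠ x in 𝓝 (t₀, x₀), fderiv ℝ u x (1, 0) = chartField V q₀ (u x) := by
    filter_upwards [htend.eventually hflow, htend.eventually hsrc, hu1] with x h1 h2 h3
    have h4 := HasMFDerivAt.hasDerivAt_extChartAt (V := V) (q₀ := q₀) h2 h1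
    have h6 : HasDerivAt (fun t : ℝ => (t, x.2)) ((1 : ℝ), (0 : E)) x.1 :=
      (hasDerivAt_id x.1).prodMk (hasDerivAt_const x.1 x.2)
    have h5 : HasDerivAt (fun t => u (t, x.2)) (fderiv ℝ u x (1, 0)) x.1 :=
      HasFDerivAt.comp_hasDerivAt (l := u) (f := fun t : ℝ => (t, x.2)) x.1 h3.hasFDerivAt h6
    exact h5.unique h4
  have hmain := hasDerivAt_fderiv_flow (f := chartField V q₀) (huC.of_le (m := 2) (WithTop.coe_le_coe.2 (le_top : (2 : ℕ∞) ≤ ⊤)))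
    (hu0 ▸ hV) hut (mfderiv 𝓘(ℝ, E) 𝓘(ℝ, E) (extChartAt 𝓘(ℝ, E) p) p v)
  have hline : Tendsto (fun t : ℝ => (t, x₀)) (𝓝 t₀) (𝓝 (t₀, x₀)) :=
    (continuous_id.prodMk continuous_const).continuousAt
  have hline' : Tendsto (fun t : ℝ => (t, p)) (𝓝 t₀) (𝓝 (t₀, p)) :=
    (continuous_id.prodMk continuous_const).continuousAt
  have hvel : ∀ᶠ t in 𝓝 t₀, fderiv ℝ u (t, x₀)
      (0, mfderiv 𝓘(ℝ, E) 𝓘(ℝ, E) (extChartAt 𝓘(ℝ, E) p) p v) =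
      mfderiv 𝓘(ℝ, E) 𝓘(ℝ, E) (extChartAt 𝓘(ℝ, E) q₀) (φ (t, p))
        (mfderiv 𝓘(ℝ, E) 𝓘(ℝ, E) (fun q => φ (t, q)) p v) := by
    filter_upwards [hline.eventually hu1, hline'.eventually hsrc, hline'.eventually hφ1]
      with t h1 h2 h3
    have h4 : HasFDerivAt (fun x => u (t, x)) ((fderiv ℝ u (t, x₀)).comp (.inr ℝ ℝ E)) x₀ :=
      h1.hasFDerivAt.comp x₀ (hasFDerivAt_prodMk_right t x₀)
    have h2' : φ (t, p) ∈ (chartAt E q₀).source := by rwa [← extChartAt_source (I := 𝓘(ℝ, E))]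
    have h5 : MDifferentiableAt 𝓘(ℝ, E) 𝓘(ℝ, E) (fun q => φ (t, q)) p :=
      (ContMDiffAt.comp p h3 (contMDiffAt_const.prodMk contMDiffAt_id)).mdifferentiableAt (by simp)
    have h6 : HasMFDerivAt 𝓘(ℝ, E) 𝓘(ℝ, E) (extChartAt 𝓘(ℝ, E) p).symm x₀ _ :=
      (mdifferentiableAt_extChartAt_symm' hpt).hasMFDerivAt
    have h7 : HasMFDerivAt 𝓘(ℝ, E) 𝓘(ℝ, E) (fun q => φ (t, q))
        ((extChartAt 𝓘(ℝ, E) p).symm x₀) (mfderiv 𝓘(ℝ, E) 𝓘(ℝ, E) (fun q => φ (t, q)) p) := by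
      rw [hsymm]; exact h5.hasMFDerivAt
    have h8 : HasMFDerivAt 𝓘(ℝ, E) 𝓘(ℝ, E) (extChartAt 𝓘(ℝ, E) q₀)
        (φ (t, (extChartAt 𝓘(ℝ, E) p).symm x₀))
        (mfderiv 𝓘(ℝ, E) 𝓘(ℝ, E) (extChartAt 𝓘(ℝ, E) q₀) (φ (t, p))) := by
      rw [hsymm]; exact (mdifferentiableAt_extChartAt (I := 𝓘(ℝ, E)) h2').hasMFDerivAt
    have h9 := (h8.comp x₀ (h7.comp x₀ h6)).hasFDerivAt
    have h10 := congrArg (fun A : E →L[ℝ] E =>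
      A (mfderiv 𝓘(ℝ, E) 𝓘(ℝ, E) (extChartAt 𝓘(ℝ, E) p) p v)) (h4.unique h9)
    refine Eq.trans h10 ?_
    have h11 := mfderiv_extChartAt_symm_apply_mfderiv hps v
    exact congrArg (fun w => mfderiv 𝓘(ℝ, E) 𝓘(ℝ, E) (extChartAt 𝓘(ℝ, E) q₀) (φ (t, p))
      (mfderiv 𝓘(ℝ, E) 𝓘(ℝ, E) (fun q => φ (t, q)) p w)) h11
  have hfin := hmain.congr_of_eventuallyEq (hvel.mono fun t ht => ht.symm)
  refine hfin.congr_deriv ?_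
  rw [hu0, hvel.self_of_nhds]

end Variation

/-! ### Forms and vector fields in charts -/

namespace MForm

variable {n k : ℕ} {M : Type u} [TopologicalSpace M] [ChartedSpace (Model n) M]

theorem mem_chartDomain {A : Set M} {p₀ q : M} (hq : q ∈ (extChartAt 𝓘(ℝ, Model n) p₀).source)
    (hA : q ∈ A) : extChartAt 𝓘(ℝ, Model n) p₀ q ∈ chartDomain n A p₀ :=
  ⟨(extChartAt 𝓘(ℝ, Model n) p₀).map_source hq, by
    rwa [mem_preimage, (extChartAt 𝓘(ℝ, Model n) p₀).left_inv hq]⟩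

theorem isOpen_chartDomain {A : Set M} (hA : IsOpen A) (p₀ : M) : IsOpen (chartDomain n A p₀) :=
  (continuousOn_extChartAt_symm p₀).isOpen_inter_preimage (isOpen_extChartAt_target p₀) hA

theorem SmoothOn.contDiffAt {β : MForm n k M} {A : Set M} (h : β.SmoothOn A) (hA : IsOpen A)
    {p₀ q : M} (hq : q ∈ (extChartAt 𝓘(ℝ, Model n) p₀).source) (hqA : q ∈ A) :
    ContDiffAt ℝ ∞ (β.inChart p₀) (extChartAt 𝓘(ℝ, Model n) p₀ q) :=
  (h p₀).contDiffAt ((isOpen_chartDomain hA p₀).mem_nhds (mem_chartDomain hq hqA))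

variable [IsManifold 𝓘(ℝ, Model n) ∞ M]

/-- The value of a form in terms of its expression in a chart. -/
theorem inChart_apply_mfderiv (β : MForm n k M) {p₀ q : M}
    (hq : q ∈ (extChartAt 𝓘(ℝ, Model n) p₀).source) (v : Fin k → TangentSpace 𝓘(ℝ, Model n) q) :
    β.inChart p₀ (extChartAt 𝓘(ℝ, Model n) p₀ q)
      (fun i => mfderiv 𝓘(ℝ, Model n) 𝓘(ℝ, Model n) (extChartAt 𝓘(ℝ, Model n) p₀) q (v i)) =
      β q v := by
  unfold inChart
  have h : (extChartAt 𝓘(ℝ, Model n) p₀).symm (extChartAt 𝓘(ℝ, Model n) p₀ q) = q :=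
    (extChartAt 𝓘(ℝ, Model n) p₀).left_inv hq
  have key : ∀ q' : M, q' = q → ∀ v' : Fin k → Model n, v' = v →
      (β q') v' = β q v := by
    rintro q' rfl v' rfl; rfl
  refine key _ h _ (funext fun i => ?_)
  exact mfderiv_extChartAt_symm_apply_mfderiv hq (v i)

theorem inChart_apply_one (β : MForm n 1 M) {p₀ q : M}
    (hq : q ∈ (extChartAt 𝓘(ℝ, Model n) p₀).source) (a : TangentSpace 𝓘(ℝ, Model n) q) :
    β.inChart p₀ (extChartAt 𝓘(ℝ, Model n) p₀ q)
      ![mfderiv 𝓘(ℝ, Model n) 𝓘(ℝ, Model n) (extChartAt 𝓘(ℝ, Model n) p₀) q a] = β q ![a] := by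
  rw [← inChart_apply_mfderiv β hq]
  congr 1; ext1 i; fin_cases i; rfl

theorem inChart_apply_two (β : MForm n 2 M) {p₀ q : M}
    (hq : q ∈ (extChartAt 𝓘(ℝ, Model n) p₀).source) (a b : TangentSpace 𝓘(ℝ, Model n) q) :
    β.inChart p₀ (extChartAt 𝓘(ℝ, Model n) p₀ q)
      ![mfderiv 𝓘(ℝ, Model n) 𝓘(ℝ, Model n) (extChartAt 𝓘(ℝ, Model n) p₀) q a,
        mfderiv 𝓘(ℝ, Model n) 𝓘(ℝ, Model n) (extChartAt 𝓘(ℝ, Model n) p₀) q b] =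
      β q ![a, b] := by
  rw [← inChart_apply_mfderiv β hq]
  congr 1; ext1 i; fin_cases i <;> rfl

omit [IsManifold 𝓘(ℝ, Model n) ∞ M] in
theorem inChart_two_apply (β : MForm n 2 M) (p₀ : M) (e a b : Model n) :
    β.inChart p₀ e ![a, b] = β ((extChartAt 𝓘(ℝ, Model n) p₀).symm e)
      ![mfderiv 𝓘(ℝ, Model n) 𝓘(ℝ, Model n) (extChartAt 𝓘(ℝ, Model n) p₀).symm e a,
        mfderiv 𝓘(ℝ, Model n) 𝓘(ℝ, Model n) (extChartAt 𝓘(ℝ, Model n) p₀).symm e b] := by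
  unfold inChart
  refine congrArg (β ((extChartAt 𝓘(ℝ, Model n) p₀).symm e)) ?_
  ext1 i; fin_cases i <;> rfl

omit [IsManifold 𝓘(ℝ, Model n) ∞ M] in
theorem inChart_one_apply (β : MForm n 1 M) (p₀ : M) (e a : Model n) :
    β.inChart p₀ e ![a] = β ((extChartAt 𝓘(ℝ, Model n) p₀).symm e)
      ![mfderiv 𝓘(ℝ, Model n) 𝓘(ℝ, Model n) (extChartAt 𝓘(ℝ, Model n) p₀).symm e a] := by
  unfold inChart
  refine congrArg (β ((extChartAt 𝓘(ℝ, Model n) p₀).symm e)) ?_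
  ext1 i; fin_cases i; rfl

/-- The differential of a function as a 1-form. -/
noncomputable def ofFunction (f : M → ℝ) : MForm n 1 M :=
  fun p => (oneFormEquiv (Model n)).symm (differential f p)

omit [IsManifold 𝓘(ℝ, Model n) ∞ M] in
theorem ofFunction_apply (f : M → ℝ) (p : M) (a : TangentSpace 𝓘(ℝ, Model n) p) :
    (ofFunction f : MForm n 1 M) p ![a] = differential f p a := by
  have := oneFormEquiv_apply (E := Model n) ((ofFunction f : MForm n 1 M) p) a
  refine this.symm.trans ?_
  exact congrArg (fun A : Model n →L[ℝ] ℝ => A a)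
    ((oneFormEquiv (Model n)).apply_symm_apply (differential f p))

theorem contDiffAt_comp_symm {f : M → ℝ} {A : Set M} (hA : IsOpen A)
    (hf : ContMDiffOn 𝓘(ℝ, Model n) 𝓘(ℝ, ℝ) ∞ f A) {p₀ : M} {e : Model n}
    (he : e ∈ chartDomain n A p₀) :
    ContDiffAt ℝ ∞ (fun x => f ((extChartAt 𝓘(ℝ, Model n) p₀).symm x)) e := by
  rw [← contMDiffAt_iff_contDiffAt]
  exact ContMDiffAt.comp e (hf.contMDiffAt (hA.mem_nhds he.2)) (contMDiffAt_extChartAt_symm he.1)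

theorem oneFormEquiv_ofFunction_inChart {f : M → ℝ} {A : Set M} (hA : IsOpen A)
    (hf : ContMDiffOn 𝓘(ℝ, Model n) 𝓘(ℝ, ℝ) ∞ f A) {p₀ : M} {e : Model n}
    (he : e ∈ chartDomain n A p₀) :
    oneFormEquiv (Model n) ((ofFunction f : MForm n 1 M).inChart p₀ e) =
      fderiv ℝ (fun x => f ((extChartAt 𝓘(ℝ, Model n) p₀).symm x)) e := by
  ext a
  rw [oneFormEquiv_apply, inChart_one_apply, ofFunction_apply]
  have h1 := ((hf.contMDiffAt (hA.mem_nhds he.2)).mdifferentiableAt (by simp)).hasMFDerivAt.comp e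
    (mdifferentiableAt_extChartAt_symm' he.1).hasMFDerivAt
  have h2 := h1.mfderiv
  rw [mfderiv_eq_fderiv] at h2
  exact (congrArg (fun A => A a) h2).symm

theorem smoothOn_ofFunction {f : M → ℝ} {A : Set M} (hA : IsOpen A)
    (hf : ContMDiffOn 𝓘(ℝ, Model n) 𝓘(ℝ, ℝ) ∞ f A) : (ofFunction f : MForm n 1 M).SmoothOn A := by
  intro p₀ e he
  have h1 : ContDiffAt ℝ ∞ (fderiv ℝ (fun x => f ((extChartAt 𝓘(ℝ, Model n) p₀).symm x))) e :=
    (contDiffAt_comp_symm hA hf he).fderiv_right (m := ∞) (by simp)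
  have h2 := (oneFormEquiv (Model n)).symm.contDiff.contDiffAt.comp e h1
  refine (h2.congr_of_eventuallyEq ?_).contDiffWithinAt
  filter_upwards [(isOpen_chartDomain hA p₀).mem_nhds he] with x hx
  rw [Function.comp, ← oneFormEquiv_ofFunction_inChart hA hf hx,
    LinearIsometryEquiv.symm_apply_apply]

theorem closedOn_ofFunction {f : M → ℝ} {A : Set M} (hA : IsOpen A)
    (hf : ContMDiffOn 𝓘(ℝ, Model n) 𝓘(ℝ, ℝ) ∞ f A) : (ofFunction f : MForm n 1 M).ClosedOn A := by
  intro p₀ e he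
  have hd : DifferentiableAt ℝ ((ofFunction f : MForm n 1 M).inChart p₀) e :=
    ((smoothOn_ofFunction hA hf p₀).contDiffAt
      ((isOpen_chartDomain hA p₀).mem_nhds he)).differentiableAt (by simp)
  rw [extDeriv_oneForm_eq_zero_iff hd]
  have h1 : (fun x => oneFormEquiv (Model n) ((ofFunction f : MForm n 1 M).inChart p₀ x)) =ᶠ[𝓝 e]
      fderiv ℝ (fun x => f ((extChartAt 𝓘(ℝ, Model n) p₀).symm x)) := by
    filter_upwards [(isOpen_chartDomain hA p₀).mem_nhds he] with x hx using
      oneFormEquiv_ofFunction_inChart hA hf hx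
  intro a b
  rw [h1.fderiv_eq]
  exact (contDiffAt_comp_symm hA hf he).isSymmSndFDerivAt
    (by simpa using WithTop.coe_le_coe.2 (le_top : (2 : ℕ∞) ≤ ⊤)) a b

end MForm

/-! ### Duality between vector fields and 1-forms -/

namespace IntegrableSystem

variable {n : ℕ} {M : Type u} {O : Type v}
  [TopologicalSpace M] [ChartedSpace (Model n) M] [TopologicalSpace O]
  (S : IntegrableSystem n M O)

theorem form_swap (p : M) (a b : TangentSpace 𝓘(ℝ, Model n) p) :
    S.form p ![a, b] = -S.form p ![b, a] :=
  twoForm_swap (E := Model n) (S.form p) a b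

theorem form_add_left (p : M) (a a' b : TangentSpace 𝓘(ℝ, Model n) p) :
    S.form p ![a + a', b] = S.form p ![a, b] + S.form p ![a', b] := by
  have h := twoFormCurry_apply (E := Model n) (S.form p)
  have h1 := congrArg (fun A : Model n →L[ℝ] ℝ => A b)
    ((twoFormCurry (Model n) (S.form p)).map_add a a')
  exact (h _ _).symm.trans (h1.trans (congrArg₂ (· + ·) (h _ _) (h _ _)))

theorem form_smul_left (p : M) (c : ℝ) (a b : TangentSpace 𝓘(ℝ, Model n) p) :
    S.form p ![c • a, b] = c * S.form p ![a, b] := by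
  have h := twoFormCurry_apply (E := Model n) (S.form p)
  have h1 := congrArg (fun A : Model n →L[ℝ] ℝ => A b)
    ((twoFormCurry (Model n) (S.form p)).map_smul c a)
  exact (h _ _).symm.trans (h1.trans (congrArg (c * ·) (h _ _)))

theorem form_zero_left (p : M) (b : TangentSpace 𝓘(ℝ, Model n) p) : S.form p ![0, b] = 0 := by
  have := S.form_smul_left p 0 0 b
  rwa [zero_smul, zero_mul] at this

theorem form_add_right (p : M) (a b b' : TangentSpace 𝓘(ℝ, Model n) p) :
    S.form p ![a, b + b'] = S.form p ![a, b] + S.form p ![a, b'] := by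
  rw [S.form_swap p a, S.form_swap p a b, S.form_swap p a b', S.form_add_left]; ring

theorem form_smul_right (p : M) (c : ℝ) (a b : TangentSpace 𝓘(ℝ, Model n) p) :
    S.form p ![a, c • b] = c * S.form p ![a, b] := by
  rw [S.form_swap p a, S.form_swap p a b, S.form_smul_left]; ring

theorem eq_of_form_eq {p : M} {a a' : TangentSpace 𝓘(ℝ, Model n) p}
    (h : ∀ b, S.form p ![a, b] = S.form p ![a', b]) : a = a' := by
  have := S.nondegenerate p (a + (-1 : ℝ) • a') fun b => by
    rw [S.form_add_left, S.form_smul_left, h b]; ring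
  rw [neg_one_smul] at this
  exact add_neg_eq_zero.1 this

theorem twoFormCurry_form_injective (p : M) :
    Function.Injective (twoFormCurry (Model n) (S.form p)) := by
  intro a a' h
  refine S.eq_of_form_eq (p := p) fun b => ?_
  have h1 := congrArg (fun A : Model n →L[ℝ] ℝ => A b) h
  exact (twoFormCurry_apply _ _ _).symm.trans (h1.trans (twoFormCurry_apply _ _ _))

end IntegrableSystem

theorem ContinuousLinearMap.isInvertible_of_injective_dual {E : Type*} [NormedAddCommGroup E]
    [NormedSpace ℝ E] [FiniteDimensional ℝ E] (A : E →L[ℝ] E →L[ℝ] ℝ)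
    (h : Function.Injective A) : A.IsInvertible := by
  have hfin : Module.finrank ℝ E = Module.finrank ℝ (E →L[ℝ] ℝ) := by
    rw [← LinearEquiv.finrank_eq (LinearMap.toContinuousLinearMap (𝕜 := ℝ) (E := E) (F' := ℝ))]
    exact (Subspace.dual_finrank_eq (K := ℝ) (V := E)).symm
  let L : E ≃ₗ[ℝ] (E →L[ℝ] ℝ) := LinearEquiv.ofInjectiveOfFinrankEq A.toLinearMap h hfin
  refine ⟨L.toContinuousLinearEquiv, ?_⟩
  ext a b
  rfl

namespace IntegrableSystem

variable {n : ℕ} {M : Type u} {O : Type v}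
  [TopologicalSpace M] [ChartedSpace (Model n) M] [TopologicalSpace O]
  (S : IntegrableSystem n M O)

theorem exists_dual (p : M) (β : Model n [⋀^Fin 1]→L[ℝ] ℝ) :
    ∃ a : TangentSpace 𝓘(ℝ, Model n) p, ∀ b : Model n, S.form p ![a, b] = β ![b] := by
  obtain ⟨L, hL⟩ := ContinuousLinearMap.isInvertible_of_injective_dual _
    (S.twoFormCurry_form_injective p)
  refine ⟨L.symm (oneFormEquiv (Model n) β), fun b => ?_⟩
  have h1 := twoFormCurry_apply (E := Model n) (S.form p) (L.symm (oneFormEquiv (Model n) β)) b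
  refine h1.symm.trans ?_
  rw [← hL, ← oneFormEquiv_apply]
  exact congrArg (fun A : Model n →L[ℝ] ℝ => A b) (L.apply_symm_apply _)

/-- The vector field `Y` with `i_Y ω = β`. -/
noncomputable def dual (β : MForm n 1 M) (p : M) : TangentSpace 𝓘(ℝ, Model n) p :=
  (S.exists_dual p (β p)).choose

theorem isDual_dual (β : MForm n 1 M) : S.IsDual (S.dual β) β :=
  fun p => (S.exists_dual p (β p)).choose_spec

theorem form_dual (β : MForm n 1 M) (p : M) (b : TangentSpace 𝓘(ℝ, Model n) p) :
    S.form p ![S.dual β p, b] = β p ![b] := S.isDual_dual β p b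

theorem eq_dual {β : MForm n 1 M} {p : M} {a : TangentSpace 𝓘(ℝ, Model n) p}
    (h : ∀ b, S.form p ![a, b] = β p ![b]) : a = S.dual β p :=
  S.eq_of_form_eq fun b => (h b).trans (S.form_dual β p b).symm

variable {S} in
theorem IsDual.eq_dual {β : MForm n 1 M} {Y : ∀ p : M, TangentSpace 𝓘(ℝ, Model n) p}
    (h : S.IsDual Y β) : Y = S.dual β :=
  funext fun p => S.eq_dual (h p)

theorem dual_congr {β β' : MForm n 1 M} {p : M} (h : β p = β' p) : S.dual β p = S.dual β' p :=
  S.eq_dual fun b => by rw [S.form_dual, h]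

theorem dual_add (β β' : MForm n 1 M) (p : M) :
    S.dual (β + β') p = S.dual β p + S.dual β' p := by
  refine (S.eq_dual fun b => ?_).symm
  rw [form_add_left, form_dual, form_dual]; rfl

theorem dual_smul (c : ℝ) (β : MForm n 1 M) (p : M) :
    S.dual (c • β) p = c • S.dual β p := by
  refine (S.eq_dual fun b => ?_).symm
  rw [form_smul_left, form_dual]; rfl

theorem isHamiltonianAt_iff {f : M → ℝ} {p : M} {a : TangentSpace 𝓘(ℝ, Model n) p} :
    S.IsHamiltonianAt f p a ↔ a = S.dual (MForm.ofFunction f) p := by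
  constructor
  · exact fun h => S.eq_dual fun b => (h b).trans (MForm.ofFunction_apply f p b).symm
  · rintro rfl b
    rw [form_dual, MForm.ofFunction_apply]

variable [IsManifold 𝓘(ℝ, Model n) ∞ M]

/-- In a chart the dual vector field is `W⁻¹ B`, where `W` and `B` are the expressions of `ω` and
`β`, and the inversion of operators is smooth. -/
theorem contDiffAt_chartField_dual {β : MForm n 1 M} {A : Set M} (hA : IsOpen A)
    (hβ : β.SmoothOn A) {p₀ q : M} (hq : q ∈ (extChartAt 𝓘(ℝ, Model n) p₀).source) (hqA : q ∈ A) :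
    ContDiffAt ℝ ∞ (chartField (S.dual β) p₀) (extChartAt 𝓘(ℝ, Model n) p₀ q) := by
  set e := extChartAt 𝓘(ℝ, Model n) p₀ q with he
  set W : Model n → Model n →L[ℝ] Model n →L[ℝ] ℝ :=
    fun x => twoFormCurry (Model n) (S.form.inChart p₀ x) with hW
  have hWC : ContDiffAt ℝ ∞ W e :=
    ContDiffAt.comp (E := Model n) (F := Model n [⋀^Fin 2]→L[ℝ] ℝ)
      (G := Model n →L[ℝ] Model n →L[ℝ] ℝ) e (contDiff_twoFormCurry.contDiffAt)
      (S.smooth.contDiffAt isOpen_univ hq (mem_univ q))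
  have hBC : ContDiffAt ℝ ∞ (fun x => oneFormEquiv (Model n) (β.inChart p₀ x)) e :=
    (oneFormEquiv (Model n)).contDiff.contDiffAt.comp e (hβ.contDiffAt hA hq hqA)
  have hWeq : ∀ x ∈ MForm.chartDomain n A p₀,
      W x (chartField (S.dual β) p₀ x) = oneFormEquiv (Model n) (β.inChart p₀ x) := by
    intro x hx
    ext b
    rw [hW, twoFormCurry_apply, oneFormEquiv_apply, MForm.inChart_two_apply,
      mfderiv_extChartAt_symm_chartField hx.1, form_dual, MForm.inChart_one_apply]
  have hinv : ∀ x ∈ (extChartAt 𝓘(ℝ, Model n) p₀).target, (W x).IsInvertible := by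
    intro x hx
    refine ContinuousLinearMap.isInvertible_of_injective_dual _ fun a a' haa => ?_
    have h1 : ∀ b, S.form.inChart p₀ x ![a, b] = S.form.inChart p₀ x ![a', b] := by
      intro b
      have := congrArg (fun A : Model n →L[ℝ] ℝ => A b) haa
      simpa only [hW, twoFormCurry_apply] using this
    set x' := (extChartAt 𝓘(ℝ, Model n) p₀).symm x with hx'
    have h2 : mfderiv 𝓘(ℝ, Model n) 𝓘(ℝ, Model n) (extChartAt 𝓘(ℝ, Model n) p₀).symm x a =
        mfderiv 𝓘(ℝ, Model n) 𝓘(ℝ, Model n) (extChartAt 𝓘(ℝ, Model n) p₀).symm x a' := by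
      refine S.eq_of_form_eq (p := x') fun b => ?_
      have hx's : x' ∈ (extChartAt 𝓘(ℝ, Model n) p₀).source :=
        (extChartAt 𝓘(ℝ, Model n) p₀).map_target hx
      have h3 := mfderiv_extChartAt_symm_apply_mfderiv hx's b
      rw [(extChartAt 𝓘(ℝ, Model n) p₀).right_inv hx] at h3
      let c : Model n := mfderiv 𝓘(ℝ, Model n) 𝓘(ℝ, Model n) (extChartAt 𝓘(ℝ, Model n) p₀) x' b
      have h4 := h1 c
      rw [MForm.inChart_two_apply, MForm.inChart_two_apply] at h4
      rw [← h3]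
      exact h4
    have h5 := congrArg (mfderiv 𝓘(ℝ, Model n) 𝓘(ℝ, Model n) (extChartAt 𝓘(ℝ, Model n) p₀) x') h2
    have h6 := mfderiv_extChartAt_apply_mfderiv_symm hx a
    have h7 := mfderiv_extChartAt_apply_mfderiv_symm hx a'
    exact h6.symm.trans (h5.trans h7)
  have hee : e ∈ (extChartAt 𝓘(ℝ, Model n) p₀).target := (extChartAt 𝓘(ℝ, Model n) p₀).map_source hq
  have hI : ContDiffAt ℝ ∞ (fun x => (W x).inverse) e :=
    ((hinv e hee).contDiffAt_map_inverse).comp e hWC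
  refine (hI.clm_apply hBC).congr_of_eventuallyEq ?_
  filter_upwards [(MForm.isOpen_chartDomain hA p₀).mem_nhds (MForm.mem_chartDomain hq hqA)]
    with x hx
  rw [← hWeq x hx]
  obtain ⟨L, hL⟩ := hinv x hx.1
  rw [← hL, ContinuousLinearMap.inverse_equiv]
  exact (L.symm_apply_apply _).symm

theorem contMDiffAt_dual {β : MForm n 1 M} {A : Set M} (hA : IsOpen A)
    (hβ : β.SmoothOn A) {q : M} (hqA : q ∈ A) :
    ContMDiffAt 𝓘(ℝ, Model n) 𝓘(ℝ, Model n).tangent ∞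
      (fun x => (⟨x, S.dual β x⟩ : TangentBundle 𝓘(ℝ, Model n) M)) q :=
  (contMDiffAt_section_iff_chartField (mem_extChartAt_source q)).2
    (S.contDiffAt_chartField_dual hA hβ (mem_extChartAt_source q) hqA)

end IntegrableSystem

/-! ### Moment maps and the fibration -/

/-- Two vectors that are orthogonal to a Lagrangian family are orthogonal to each other. -/
theorem LinearMap.eq_zero_of_lagrangian {V : Type*} [AddCommGroup V] [Module ℝ V]
    [FiniteDimensional ℝ V] {n : ℕ} (hn : Module.finrank ℝ V = 2 * n) (B : V →ₗ[ℝ] V →ₗ[ℝ] ℝ)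
    {x : Fin n → V} (hx : LinearIndependent ℝ fun i => B (x i))
    (hxx : ∀ i j, B (x i) (x j) = 0) {a b : V} (ha : ∀ i, B (x i) a = 0) (hb : ∀ i, B (x i) b = 0) :
    B a b = 0 := by
  set W : Submodule ℝ (Module.Dual ℝ V) := Submodule.span ℝ (Set.range fun i => B (x i)) with hW
  have hmem : ∀ c, (∀ i, B (x i) c = 0) → c ∈ W.dualCoannihilator := by
    intro c hc
    rw [Submodule.mem_dualCoannihilator]
    intro φ hφ
    induction hφ using Submodule.span_induction with
    | mem y hy => obtain ⟨i, rfl⟩ := hy; exact hc i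
    | zero => rfl
    | add y z _ _ hy hz => simp [hy, hz]
    | smul r y _ hy => simp [hy]
  have hWr : Module.finrank ℝ W = n := by
    rw [hW, finrank_span_eq_card hx, Fintype.card_fin]
  have hK : Module.finrank ℝ W.dualCoannihilator = n := by
    have := Subspace.finrank_add_finrank_dualCoannihilator_eq W
    omega
  have hxi : LinearIndependent ℝ x := LinearIndependent.of_comp B hx
  have hle : Submodule.span ℝ (Set.range x) ≤ W.dualCoannihilator := by
    rw [Submodule.span_le]
    rintro _ ⟨j, rfl⟩
    exact hmem _ fun i => hxx i j
  have heq := Submodule.eq_of_le_of_finrank_eq hle (by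
    rw [hK, finrank_span_eq_card hxi, Fintype.card_fin])
  have ha' : a ∈ Submodule.span ℝ (Set.range x) := heq ▸ hmem a ha
  clear ha
  induction ha' using Submodule.span_induction with
  | mem y hy => obtain ⟨i, rfl⟩ := hy; exact hb i
  | zero => simp
  | add y z _ _ hy hz => simp [hy, hz]
  | smul r y _ hy => simp [hy]

theorem hasDerivAt_comp_curve {n : ℕ} {M : Type u} [TopologicalSpace M] [ChartedSpace (Model n) M]
    {f : M → ℝ} {γ : ℝ → M} {t : ℝ} {a : TangentSpace 𝓘(ℝ, Model n) (γ t)}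
    (hf : MDifferentiableAt 𝓘(ℝ, Model n) 𝓘(ℝ, ℝ) f (γ t))
    (hγ : HasMFDerivAt 𝓘(ℝ, ℝ) 𝓘(ℝ, Model n) γ t ((1 : ℝ →L[ℝ] ℝ).smulRight a)) :
    HasDerivAt (fun s => f (γ s)) (differential f (γ t) a) t := by
  have h := hf.hasMFDerivAt.comp t hγ
  let A : ℝ →L[ℝ] ℝ := (mfderiv 𝓘(ℝ, Model n) 𝓘(ℝ, ℝ) f (γ t)).comp
    ((1 : ℝ →L[ℝ] ℝ).smulRight a)
  have h2 : HasFDerivAt (fun s => f (γ s)) A t := h.hasFDerivAt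
  refine h2.hasDerivAt.congr_deriv ?_
  exact congrArg (mfderiv 𝓘(ℝ, Model n) 𝓘(ℝ, ℝ) f (γ t)) (one_smul ℝ a)

namespace SymplecticFibration.IsMomentMap

variable {n : ℕ} {M : Type u} {O : Type v}
  [TopologicalSpace M] [ChartedSpace (Model n) M] [TopologicalSpace O]
  {S : SymplecticFibration n M O} {U : Opens O} {F : Fin n → M → ℝ}

theorem apply_eq (hF : S.IsMomentMap U F) {p q : M} (hp : p ∈ S.π ⁻¹' U) (h : S.π q = S.π p)
    (i : Fin n) : F i q = F i p := by
  have hq : q ∈ S.π ⁻¹' {S.π p} := h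
  rw [hF.fiber_eq p hp] at hq
  exact (connectedComponentIn_subset _ _ hq).2 i

theorem isPreconnected_fiber (hF : S.IsMomentMap U F) {p : M} (hp : p ∈ S.π ⁻¹' U) :
    _root_.IsPreconnected (S.π ⁻¹' {S.π p}) := by
  rw [hF.fiber_eq p hp]
  exact isPreconnected_connectedComponentIn

theorem mdifferentiableAt (hF : S.IsMomentMap U F) {p : M} (hp : p ∈ S.π ⁻¹' U) (i : Fin n) :
    MDifferentiableAt 𝓘(ℝ, Model n) 𝓘(ℝ, ℝ) (F i) p :=
  ((hF.smooth i).contMDiffAt ((U.isOpen.preimage S.isProperMap.continuous).mem_nhds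
    hp)).mdifferentiableAt (by simp)

/-- A curve whose velocity is annihilated by the differentials of a moment map stays in a fiber. -/
theorem π_eq_of_curve [T2Space O] (hF : S.IsMomentMap U F) {J : Set ℝ} (hJo : IsOpen J)
    (hJ : _root_.IsPreconnected J) {γ : ℝ → M} {γ' : ∀ t, TangentSpace 𝓘(ℝ, Model n) (γ t)}
    (hγ : ∀ t ∈ J, HasMFDerivAt 𝓘(ℝ, ℝ) 𝓘(ℝ, Model n) γ t ((1 : ℝ →L[ℝ] ℝ).smulRight (γ' t)))
    (h0 : ∀ t ∈ J, γ t ∈ S.π ⁻¹' U → ∀ i, differential (F i) (γ t) (γ' t) = 0)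
    {s t : ℝ} (hs : s ∈ J) (hsU : γ s ∈ S.π ⁻¹' U) (ht : t ∈ J) : S.π (γ t) = S.π (γ s) := by
  have hc : ContinuousOn γ J := fun t ht => (hγ t ht).continuousAt.continuousWithinAt
  have hπ := S.isProperMap.continuous
  have hcπ : ContinuousOn (fun t => S.π (γ t)) J := hπ.comp_continuousOn hc
  set A : Set ℝ := {t | t ∈ J ∧ S.π (γ t) = S.π (γ s)} with hA
  -- Near a time in `A` the moment map is constant along the curve, which therefore stays in one
  -- connected component of a level set, i.e. in a fiber.
  have hAo : IsOpen A := by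
    rw [isOpen_iff_mem_nhds]
    rintro t₀ ⟨ht₀, ht₀s⟩
    have hU₀ : γ t₀ ∈ S.π ⁻¹' U := by
      rw [mem_preimage, ht₀s]; exact hsU
    have hN : J ∩ γ ⁻¹' (S.π ⁻¹' U) ∈ 𝓝 t₀ :=
      inter_mem (hJo.mem_nhds ht₀)
        ((hγ t₀ ht₀).continuousAt.preimage_mem_nhds ((U.isOpen.preimage hπ).mem_nhds hU₀))
    obtain ⟨ε, hε, hball⟩ := Metric.mem_nhds_iff.1 hN
    have hpre : _root_.IsPreconnected (Metric.ball t₀ ε) := (convex_ball t₀ ε).isPreconnected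
    have hd : ∀ i, ∀ t ∈ Metric.ball t₀ ε, HasDerivAt (fun s => F i (γ s)) 0 t := by
      intro i t ht
      have := hasDerivAt_comp_curve (hF.mdifferentiableAt (hball ht).2 i) (hγ t (hball ht).1)
      rwa [h0 t (hball ht).1 (hball ht).2 i] at this
    have hcst : ∀ t ∈ Metric.ball t₀ ε, ∀ i, F i (γ t) = F i (γ t₀) := by
      intro t ht i
      exact Metric.isOpen_ball.is_const_of_deriv_eq_zero hpre
        (fun s hs => (hd i s hs).differentiableAt.differentiableWithinAt)
        (fun s hs => (hd i s hs).deriv) ht (Metric.mem_ball_self hε)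
    filter_upwards [Metric.ball_mem_nhds t₀ hε] with t ht
    refine ⟨(hball ht).1, ?_⟩
    have hsub : γ '' Metric.ball t₀ ε ⊆ S.π ⁻¹' {S.π (γ t₀)} := by
      rw [hF.fiber_eq _ hU₀]
      refine (hpre.image γ (hc.mono fun t ht => (hball ht).1)).subset_connectedComponentIn
        ⟨t₀, Metric.mem_ball_self hε, rfl⟩ ?_
      rintro _ ⟨t, ht, rfl⟩
      exact ⟨(hball ht).2, hcst t ht⟩
    have h := hsub ⟨t, ht, rfl⟩
    exact Eq.trans h ht₀s
  have hBo : IsOpen (J ∩ (fun t => S.π (γ t)) ⁻¹' {S.π (γ s)}ᶜ) :=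
    hcπ.isOpen_inter_preimage hJo isOpen_compl_singleton
  have := hJ.subset_left_of_subset_union hAo hBo
    (disjoint_left.2 fun t h1 h2 => h2.2 h1.2)
    (fun t ht => by
      by_cases h : S.π (γ t) = S.π (γ s)
      · exact Or.inl ⟨ht, h⟩
      · exact Or.inr ⟨ht, h⟩) ⟨s, hs, hs, rfl⟩
  exact (this ht).2

theorem mono (hF : S.IsMomentMap U F) {V : Opens O} (h : V ≤ U) : S.IsMomentMap V F := by
  have hsub : S.π ⁻¹' V ⊆ S.π ⁻¹' U := preimage_mono h
  refine ⟨fun i => (hF.smooth i).mono hsub, fun i j p hp => hF.commute i j p (hsub hp), ?_, ?_⟩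
  · intro p hp
    have hV : S.π ⁻¹' V ∈ 𝓝 p := (V.isOpen.preimage S.isProperMap.continuous).mem_nhds hp
    rw [mem_closure_iff_nhds]
    intro t ht
    obtain ⟨q, hq1, hq2⟩ := mem_closure_iff_nhds.1 (hF.independent (hsub hp)) _ (inter_mem ht hV)
    exact ⟨q, hq1.1, hq1.2, hq2.2⟩
  · intro p hp
    refine subset_antisymm ?_ ?_
    · refine (hF.isPreconnected_fiber (hsub hp)).subset_connectedComponentIn rfl ?_
      intro q hq
      have hq' : S.π q = S.π p := hq
      exact ⟨by rw [mem_preimage, hq']; exact hp, hF.apply_eq (hsub hp) hq'⟩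
    · rw [hF.fiber_eq p (hsub hp)]
      exact connectedComponentIn_mono _ fun q hq => ⟨hsub hq.1, hq.2⟩

end SymplecticFibration.IsMomentMap

namespace IntegrableSystem

variable {n : ℕ} {M : Type u} {O : Type v}
  [TopologicalSpace M] [ChartedSpace (Model n) M] [TopologicalSpace O]
  {S : IntegrableSystem n M O}

theorem isOpen_preimage (S : IntegrableSystem n M O) (U : Opens O) : IsOpen (S.π ⁻¹' U) :=
  U.isOpen.preimage S.isProperMap.continuous

variable [IsManifold 𝓘(ℝ, Model n) ∞ M]

theorem smoothOn_ofFunction {U : Opens O} {F : Fin n → M → ℝ} (hF : S.IsMomentMap U F) (i : Fin n) :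
    (MForm.ofFunction (F i) : MForm n 1 M).SmoothOn (S.π ⁻¹' U) :=
  MForm.smoothOn_ofFunction (S.isOpen_preimage U) (hF.smooth i)

variable [T2Space O]

/-- The components of any two moment maps Poisson-commute: the Hamiltonian flows of the one
preserve the fibers, on which the other is constant. -/
theorem differential_dual_ofFunction {U V : Opens O} {F G : Fin n → M → ℝ} (hF : S.IsMomentMap U F)
    (hG : S.IsMomentMap V G) {p : M} (hpU : p ∈ S.π ⁻¹' U) (hpV : p ∈ S.π ⁻¹' V) (i j : Fin n) :
    differential (F i) p (S.dual (MForm.ofFunction (G j)) p) = 0 := by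
  have hVo := S.isOpen_preimage V
  obtain ⟨α, hα, hev⟩ := exists_contMDiffAt_localFlow
    (V := S.dual (MForm.ofFunction (G j))) (p := p) (by
      filter_upwards [hVo.mem_nhds hpV] with q hq
      exact S.contMDiffAt_dual hVo (smoothOn_ofFunction hG j) hq)
  have hα0 : α (0, p) = p := hev.self_of_nhds.1
  have hline : Tendsto (fun t : ℝ => (t, p)) (𝓝 0) (𝓝 (0, p)) :=
    (continuous_id.prodMk continuous_const).continuousAt
  obtain ⟨ε, hε, hball⟩ := Metric.mem_nhds_iff.1 (hline.eventually hev)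
  set γ : ℝ → M := fun t => α (t, p) with hγ
  have hγd : ∀ t ∈ Metric.ball (0 : ℝ) ε, HasMFDerivAt 𝓘(ℝ, ℝ) 𝓘(ℝ, Model n) γ t
      ((1 : ℝ →L[ℝ] ℝ).smulRight (S.dual (MForm.ofFunction (G j)) (γ t))) :=
    fun t ht => (hball ht).2
  have h0 : (0 : ℝ) ∈ Metric.ball (0 : ℝ) ε := Metric.mem_ball_self hε
  have hπ : ∀ t ∈ Metric.ball (0 : ℝ) ε, S.π (γ t) = S.π p := by
    intro t ht
    have := hG.π_eq_of_curve Metric.isOpen_ball (convex_ball (0 : ℝ) ε).isPreconnected hγd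
      (fun t ht htV k => ?_) h0 (by rw [hγ]; simpa only [hα0] using hpV) ht
    · simpa only [hγ, hα0] using this
    · rw [← MForm.ofFunction_apply, ← S.form_dual]
      exact hG.commute k j _ htV _ _ (S.isHamiltonianAt_iff.2 rfl) (S.isHamiltonianAt_iff.2 rfl)
  have hd := hasDerivAt_comp_curve (f := F i) (γ := γ) (t := 0)
    (by simpa only [hγ, hα0] using hF.mdifferentiableAt hpU i) (hγd 0 h0)
  have hc : (fun t => F i (γ t)) =ᶠ[𝓝 0] fun _ => F i p := by
    filter_upwards [Metric.ball_mem_nhds (0 : ℝ) hε] with t ht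
    exact hF.apply_eq hpU (hπ t ht) i
  have h1 := (hd.congr_of_eventuallyEq hc.symm).unique (hasDerivAt_const (0 : ℝ) (F i p))
  have h2 : ∀ q, q = p → differential (F i) q (S.dual (MForm.ofFunction (G j)) q) = 0 →
      differential (F i) p (S.dual (MForm.ofFunction (G j)) p) = 0 := by
    rintro q rfl h; exact h
  exact h2 _ hα0 h1

theorem differential_eq_zero_of_mem_tangent {U : Opens O} {F : Fin n → M → ℝ}
    (hF : S.IsMomentMap U F) {p : M} (hp : p ∈ S.π ⁻¹' U) (i : Fin n)
    {a : TangentSpace 𝓘(ℝ, Model n) p} (ha : a ∈ S.tangent p) : differential (F i) p a = 0 := by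
  unfold tangent at ha
  induction ha using Submodule.span_induction with
  | mem y hy =>
    obtain ⟨V, hV, G, hG, j, hj⟩ := hy
    rw [S.isHamiltonianAt_iff.1 hj]
    exact differential_dual_ofFunction hF hG hp hV i j
  | zero => exact map_zero _
  | add y z _ _ hy hz => rw [map_add, hy, hz, add_zero]
  | smul r y _ hy => rw [map_smul, hy, smul_zero]

/-- The differentials of the components of a moment map are sections of `𝒵¹`. -/
theorem ofFunction_mem_closedForms {U : Opens O} {F : Fin n → M → ℝ} (hF : S.IsMomentMap U F)
    (i : Fin n) : (MForm.ofFunction (F i) : MForm n 1 M) ∈ S.closedForms U :=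
  ⟨smoothOn_ofFunction hF i,
    MForm.closedOn_ofFunction (S.isOpen_preimage U) (hF.smooth i),
    fun p hp a ha => by
      rw [MForm.ofFunction_apply]; exact differential_eq_zero_of_mem_tangent hF hp i ha⟩

omit [IsManifold 𝓘(ℝ, Model n) ∞ M] [T2Space O] in
theorem dual_ofFunction_mem_tangent {U : Opens O} {F : Fin n → M → ℝ} (hF : S.IsMomentMap U F)
    {p : M} (hp : p ∈ S.π ⁻¹' U) (i : Fin n) :
    S.dual (MForm.ofFunction (F i)) p ∈ S.tangent p :=
  Submodule.subset_span ⟨U, hp, F, hF, i, S.isHamiltonianAt_iff.2 rfl⟩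

/-- The tangent spaces of the fibration are isotropic. -/
theorem form_eq_zero_of_mem_tangent {p : M} {a b : TangentSpace 𝓘(ℝ, Model n) p}
    (ha : a ∈ S.tangent p) (hb : b ∈ S.tangent p) : S.form p ![a, b] = 0 := by
  unfold tangent at ha
  induction ha using Submodule.span_induction with
  | mem y hy =>
    obtain ⟨V, hV, G, hG, j, hj⟩ := hy
    rw [hj b]
    exact differential_eq_zero_of_mem_tangent hG hV j hb
  | zero => exact S.form_zero_left p b
  | add y z _ _ hy hz => rw [S.form_add_left, hy, hz, add_zero]
  | smul r y _ hy => rw [S.form_smul_left, hy, mul_zero]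

omit [IsManifold 𝓘(ℝ, Model n) ∞ M] [T2Space O] in
/-- The vector field dual to a section of `𝒵¹` is annihilated by the differentials of the moment
maps. -/
theorem differential_dual_eq_zero {U V : Opens O} {F : Fin n → M → ℝ} (hF : S.IsMomentMap U F)
    {β : MForm n 1 M} (hβ : β ∈ S.closedForms V) {p : M} (hpU : p ∈ S.π ⁻¹' U)
    (hpV : p ∈ S.π ⁻¹' V) (i : Fin n) : differential (F i) p (S.dual β p) = 0 := by
  rw [← MForm.ofFunction_apply, ← S.form_dual, S.form_swap, S.form_dual,
    hβ.2.2 p hpV _ (dual_ofFunction_mem_tangent hF hpU i), neg_zero]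

/-- The vector fields dual to sections of `𝒵¹` are pairwise orthogonal: this holds where a
moment map is regular, since there the fibers are Lagrangian, and hence everywhere. -/
theorem form_dual_dual_eq_zero {U : Opens O} {β β' : MForm n 1 M} (hβ : β ∈ S.closedForms U)
    (hβ' : β' ∈ S.closedForms U) {p : M} (hp : p ∈ S.π ⁻¹' U) :
    S.form p ![S.dual β p, S.dual β' p] = 0 := by
  obtain ⟨V, hV, F, hF⟩ := S.exists_momentMap (S.π p)
  have hpV : p ∈ S.π ⁻¹' V := hV
  have hUo := S.isOpen_preimage U
  -- Near `p`, the function `g` is `ω(X_β, X_β')`, written in a chart to see that it is continuous.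
  set g : M → ℝ := fun q => oneFormEquiv (Model n) (β.inChart p (extChartAt 𝓘(ℝ, Model n) p q))
    (chartField (S.dual β') p (extChartAt 𝓘(ℝ, Model n) p q)) with hg
  have hps := mem_extChartAt_source (I := 𝓘(ℝ, Model n)) p
  have hgc : ContinuousAt g p := by
    have h1 : ContinuousAt (fun e => oneFormEquiv (Model n) (β.inChart p e)
        (chartField (S.dual β') p e)) (extChartAt 𝓘(ℝ, Model n) p p) :=
      ((oneFormEquiv (Model n)).continuous.continuousAt.comp
        (hβ.1.contDiffAt hUo hps hp).continuousAt).clm_apply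
        (S.contDiffAt_chartField_dual hUo hβ'.1 hps hp).continuousAt
    exact ContinuousAt.comp (f := extChartAt 𝓘(ℝ, Model n) p) h1 (continuousAt_extChartAt p)
  have hgeq : ∀ q ∈ (extChartAt 𝓘(ℝ, Model n) p).source,
      g q = S.form q ![S.dual β q, S.dual β' q] := by
    intro q hq
    rw [S.form_dual, ← MForm.inChart_apply_one β hq]
    have hl := (extChartAt 𝓘(ℝ, Model n) p).left_inv hq
    have : chartField (S.dual β') p (extChartAt 𝓘(ℝ, Model n) p q) =
        mfderiv 𝓘(ℝ, Model n) 𝓘(ℝ, Model n) (extChartAt 𝓘(ℝ, Model n) p) q (S.dual β' q) := by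
      unfold chartField; rw [hl]
    rw [hg]
    dsimp only
    rw [oneFormEquiv_apply, this]
  rw [← hgeq p hps]
  -- It vanishes at the regular points of `F`, which are dense.
  have hfreq : ∃ᶠ q in 𝓝 p, g q = 0 := by
    have h1 := mem_closure_iff_frequently.1 (hF.independent hpV)
    refine (h1.and_eventually (inter_mem (hUo.mem_nhds hp)
      ((isOpen_extChartAt_source (I := 𝓘(ℝ, Model n)) p).mem_nhds hps))).mono ?_
    rintro q ⟨⟨hqV, hind⟩, hqU, hqs⟩
    rw [hgeq q hqs]
    have : FiniteDimensional ℝ (TangentSpace 𝓘(ℝ, Model n) q) :=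
      inferInstanceAs (FiniteDimensional ℝ (Model n))
    have key := LinearMap.eq_zero_of_lagrangian (V := TangentSpace 𝓘(ℝ, Model n) q) (n := n)
      (by change Module.finrank ℝ (Model n) = 2 * n; simp)
      (LinearMap.mk₂ ℝ (fun a b => S.form q ![a, b]) (fun a a' b => S.form_add_left q a a' b)
        (fun c a b => S.form_smul_left q c a b) (fun a b b' => S.form_add_right q a b b')
        (fun c a b => S.form_smul_right q c a b))
      (x := fun i => S.dual (MForm.ofFunction (F i)) q) ?_ ?_
      (a := S.dual β q) (b := S.dual β' q) ?_ ?_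
    · exact key
    · have h2 : (fun i => LinearMap.mk₂ ℝ (fun a b => S.form q ![a, b])
          (fun a a' b => S.form_add_left q a a' b)
          (fun c a b => S.form_smul_left q c a b) (fun a b b' => S.form_add_right q a b b')
          (fun c a b => S.form_smul_right q c a b) (S.dual (MForm.ofFunction (F i)) q)) =
          fun i => (differential (F i) q).toLinearMap := by
        funext i
        ext b
        change S.form q ![_, b] = _
        rw [S.form_dual, MForm.ofFunction_apply]; rfl
      rw [h2]
      exact hind.map' (ContinuousLinearMap.coeLM ℝ) (by
        rw [LinearMap.ker_eq_bot]; exact ContinuousLinearMap.coe_injective)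
    · intro i j
      change S.form q ![_, _] = _
      rw [S.form_dual, MForm.ofFunction_apply]
      exact differential_dual_ofFunction hF hF hqV hqV i j
    · intro i
      change S.form q ![_, _] = _
      rw [S.form_dual, MForm.ofFunction_apply]
      exact differential_dual_eq_zero hF hβ hqV hqU i
    · intro i
      change S.form q ![_, _] = _
      rw [S.form_dual, MForm.ofFunction_apply]
      exact differential_dual_eq_zero hF hβ' hqV hqU i
  by_contra hne
  exact hfreq ((hgc.eventually_ne hne).mono fun q hq => hq)

omit [IsManifold 𝓘(ℝ, Model n) ∞ M] [T2Space O] in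
theorem smul_mem_closedForms {U : Opens O} {β : MForm n 1 M} (c : ℝ) (hβ : β ∈ S.closedForms U) :
    c • β ∈ S.closedForms U := by
  have h : ∀ p₀, (c • β).inChart p₀ = c • β.inChart p₀ := fun p₀ => by funext e; ext v; rfl
  refine ⟨fun p₀ => ?_, fun p₀ e he => ?_, fun p hp a ha => ?_⟩
  · rw [h]; exact (hβ.1 p₀).const_smul c
  · rw [h, extDeriv_smul, hβ.2.1 p₀ e he, smul_zero]
  · have := hβ.2.2 p hp a ha
    simp [this]

/-- A smooth closed form is a section of `𝒵¹` if the dual vector field is tangent to the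
fibration. -/
theorem mem_closedForms_of_dual_mem_tangent {U : Opens O} {β : MForm n 1 M}
    (h1 : β.SmoothOn (S.π ⁻¹' U)) (h2 : β.ClosedOn (S.π ⁻¹' U))
    (h3 : ∀ p ∈ S.π ⁻¹' U, S.dual β p ∈ S.tangent p) : β ∈ S.closedForms U :=
  ⟨h1, h2, fun p hp a ha => by
    rw [← S.form_dual]; exact form_eq_zero_of_mem_tangent (h3 p hp) ha⟩

end IntegrableSystem

/-! ### The flow of a closed 1-form -/

section ChainRule

variable {E₁ E₂ E₃ E₄ : Type*} [NormedAddCommGroup E₁] [NormedSpace ℝ E₁] [NormedAddCommGroup E₂]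
  [NormedSpace ℝ E₂] [NormedAddCommGroup E₃] [NormedSpace ℝ E₃] [NormedAddCommGroup E₄]
  [NormedSpace ℝ E₄]
  {N₁ N₂ N₃ N₄ : Type*} [TopologicalSpace N₁] [ChartedSpace E₁ N₁] [TopologicalSpace N₂]
  [ChartedSpace E₂ N₂] [TopologicalSpace N₃] [ChartedSpace E₃ N₃] [TopologicalSpace N₄]
  [ChartedSpace E₄ N₄]

theorem MDifferentiableAt.hasMFDerivAt_comp₂ {Φ : N₁ × N₂ → N₃} {a : N₄ → N₁} {b : N₄ → N₂} {z : N₄}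
    (hΦ : MDifferentiableAt (𝓘(ℝ, E₁).prod 𝓘(ℝ, E₂)) 𝓘(ℝ, E₃) Φ (a z, b z))
    {A : TangentSpace 𝓘(ℝ, E₄) z →L[ℝ] TangentSpace 𝓘(ℝ, E₁) (a z)}
    {B : TangentSpace 𝓘(ℝ, E₄) z →L[ℝ] TangentSpace 𝓘(ℝ, E₂) (b z)}
    (ha : HasMFDerivAt 𝓘(ℝ, E₄) 𝓘(ℝ, E₁) a z A) (hb : HasMFDerivAt 𝓘(ℝ, E₄) 𝓘(ℝ, E₂) b z B) :
    HasMFDerivAt 𝓘(ℝ, E₄) 𝓘(ℝ, E₃) (fun y => Φ (a y, b y)) z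
      ((mfderiv 𝓘(ℝ, E₁) 𝓘(ℝ, E₃) (fun y => Φ (y, b z)) (a z)).comp A +
        (mfderiv 𝓘(ℝ, E₂) 𝓘(ℝ, E₃) (fun y => Φ (a z, y)) (b z)).comp B) := by
  refine (hΦ.hasMFDerivAt.comp z (ha.prodMk hb)).congr_mfderiv ?_
  rw [mfderiv_prod_eq_add_comp hΦ]
  rfl

end ChainRule

namespace IntegrableSystem

variable {n : ℕ} {M : Type u} {O : Type v}
  [TopologicalSpace M] [ChartedSpace (Model n) M] [TopologicalSpace O]
  {S : IntegrableSystem n M O}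

/-- Neighborhoods of a fiber contain saturated ones, since the fibration is proper. -/
theorem exists_preimage_subset (S : IntegrableSystem n M O) {x : O} {N : Set M} (hN : IsOpen N)
    (h : S.π ⁻¹' {x} ⊆ N) : ∃ V : Opens O, x ∈ V ∧ S.π ⁻¹' V ⊆ N := by
  refine ⟨⟨(S.π '' Nᶜ)ᶜ, (S.isProperMap.isClosedMap _ hN.isClosed_compl).isOpen_compl⟩, ?_, ?_⟩
  · rintro ⟨p, hp, rfl⟩
    exact hp (h rfl)
  · intro p hp
    by_contra hpN
    exact hp ⟨p, hpN, rfl⟩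

open Classical in
/-- The flow of the vector field dual to `β`, at the points whose integral curve exists for all
times and stays in a fiber (and the identity elsewhere). -/
noncomputable def flow (S : IntegrableSystem n M O) (β : MForm n 1 M) (t : ℝ) (p : M) : M :=
  if h : ∃ γ : ℝ → M, IsMIntegralCurve (I := 𝓘(ℝ, Model n)) γ (S.dual β) ∧ γ 0 = p ∧
      ∀ t, S.π (γ t) = S.π p
    then h.choose t else p

variable [IsManifold 𝓘(ℝ, Model n) ∞ M] [T2Space O]

section

variable [T2Space M] [SecondCountableTopology M]

/-- Near each fiber, the vector field dual to a section of `𝒵¹` coincides with one of compact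
support; as the former is tangent to the compact fibers, its flow exists. -/
theorem exists_localFlow {U : Opens O} {β : MForm n 1 M} (hβ : β ∈ S.closedForms U) {x : O}
    (hx : x ∈ U) : ∃ V : Opens O, x ∈ V ∧ V ≤ U ∧ ∃ Φ : ℝ × M → M,
      ContMDiff (𝓘(ℝ, ℝ).prod 𝓘(ℝ, Model n)) 𝓘(ℝ, Model n) ∞ Φ ∧
      ∀ p ∈ S.π ⁻¹' V, Φ (0, p) = p ∧ (∀ t, S.π (Φ (t, p)) = S.π p) ∧
        IsMIntegralCurve (I := 𝓘(ℝ, Model n)) (fun t => Φ (t, p)) (S.dual β) := by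
  have : LocallyCompactSpace M := Manifold.locallyCompact_of_finiteDimensional 𝓘(ℝ, Model n)
  obtain ⟨U', hxU', F, hF⟩ := S.exists_momentMap x
  have hUo := S.isOpen_preimage U
  have hK₀ : IsCompact (S.π ⁻¹' {x}) := S.isProperMap.isCompact_preimage isCompact_singleton
  obtain ⟨K, hK, hK₀K, hKU⟩ := exists_compact_between hK₀ hUo (fun p hp => by
    have : S.π p = x := hp
    rw [mem_preimage, this]; exact hx)
  obtain ⟨χ, hχ1, hχ0, -⟩ := exists_contMDiffMap_one_nhds_of_subset_interior 𝓘(ℝ, Model n)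
    (n := ⊤) hK₀.isClosed hK₀K
  -- The flow of `Y = χ X_β` preserves the fibers, so on the fibers where `χ = 1` it is that of `X_β`.
  set Y : ∀ p : M, TangentSpace 𝓘(ℝ, Model n) p := fun p => χ p • S.dual β p with hY
  have hYs : ∀ q, ContMDiffAt 𝓘(ℝ, Model n) 𝓘(ℝ, Model n).tangent ∞
      (fun x => (⟨x, Y x⟩ : TangentBundle 𝓘(ℝ, Model n) M)) q := by
    intro q
    by_cases hq : q ∈ S.π ⁻¹' U
    · exact (χ.contMDiff.contMDiffAt).smul_section (S.contMDiffAt_dual hUo hβ.1 hq)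
    · have h0 : ContMDiffAt 𝓘(ℝ, Model n) 𝓘(ℝ, Model n).tangent ∞
          (fun x => (⟨x, 0⟩ : TangentBundle 𝓘(ℝ, Model n) M)) q :=
        (Bundle.contMDiff_zeroSection ℝ (TangentSpace 𝓘(ℝ, Model n) (M := M))).contMDiffAt
      refine h0.congr_of_eventuallyEq ?_
      filter_upwards [hK.isClosed.isOpen_compl.mem_nhds fun h => hq (hKU h)] with p hp
      rw [hY]
      simp only [hχ0 p hp, zero_smul]
  obtain ⟨Φ, hΦ0, hΦi, hΦs⟩ := exists_flow_of_compact_support hYs hK fun p hp => by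
    rw [hY]; simp only [hχ0 p hp, zero_smul]
  obtain ⟨N, hN, hK₀N, hNχ⟩ := mem_nhdsSet_iff_exists.1 hχ1
  obtain ⟨V, hxV, hVN⟩ := S.exists_preimage_subset hN hK₀N
  refine ⟨V ⊓ U ⊓ U', ⟨⟨hxV, hx⟩, hxU'⟩, inf_le_left.trans inf_le_right,
    fun x => Φ x.1 x.2, hΦs, fun p hp => ⟨hΦ0 p, ?_⟩⟩
  have hF' := hF.mono (inf_le_right : V ⊓ U ⊓ U' ≤ U')
  have hπ : ∀ t, S.π (Φ t p) = S.π p := by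
    intro t
    have h := hF'.π_eq_of_curve isOpen_univ isPreconnected_univ (γ := (Φ · p))
      (fun t _ => hΦi p t) (fun t _ ht i => ?_) (mem_univ 0)
      (by simp only [hΦ0]; exact hp) (mem_univ t)
    · simpa only [hΦ0] using h
    · rw [hY]
      dsimp only
      rw [map_smul, differential_dual_eq_zero hF hβ ht.2 ht.1.2 i, smul_zero]
  refine ⟨hπ, fun t => ?_⟩
  have h1 : χ (Φ t p) = 1 := by
    refine hNχ (hVN ?_)
    rw [mem_preimage, hπ t]
    exact hp.1.1
  have h2 := hΦi p t
  rw [hY] at h2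
  simp only [h1, one_smul] at h2
  exact h2

variable {U : Opens O} {β β' : MForm n 1 M}

omit [T2Space M] [SecondCountableTopology M] [T2Space O] in
theorem contMDiffAt_dual_of_mem (hβ : β ∈ S.closedForms U) {p : M} (hp : S.π p ∈ U) :
    ContMDiffAt 𝓘(ℝ, Model n) 𝓘(ℝ, Model n).tangent ∞
      (fun x => (⟨x, S.dual β x⟩ : TangentBundle 𝓘(ℝ, Model n) M)) p :=
  S.contMDiffAt_dual (S.isOpen_preimage U) hβ.1 hp

theorem flow_spec (hβ : β ∈ S.closedForms U) {p : M} (hp : S.π p ∈ U) :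
    IsMIntegralCurve (I := 𝓘(ℝ, Model n)) (fun t => S.flow β t p) (S.dual β) ∧
      S.flow β 0 p = p ∧ ∀ t, S.π (S.flow β t p) = S.π p := by
  obtain ⟨V, hxV, -, Φ, -, hΦ⟩ := exists_localFlow hβ hp
  obtain ⟨h1, h2, h3⟩ := hΦ p hxV
  have h : ∃ γ : ℝ → M, IsMIntegralCurve (I := 𝓘(ℝ, Model n)) γ (S.dual β) ∧ γ 0 = p ∧
      ∀ t, S.π (γ t) = S.π p := ⟨_, h3, h1, h2⟩
  have h4 : (fun t => S.flow β t p) = h.choose := by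
    funext t; unfold flow; rw [dif_pos h]
  refine ⟨h4 ▸ h.choose_spec.1, (congrFun h4 0).trans h.choose_spec.2.1, fun t => ?_⟩
  rw [show S.flow β t p = h.choose t from congrFun h4 t]
  exact h.choose_spec.2.2 t

theorem isMIntegralCurve_flow (hβ : β ∈ S.closedForms U) {p : M} (hp : S.π p ∈ U) :
    IsMIntegralCurve (I := 𝓘(ℝ, Model n)) (fun t => S.flow β t p) (S.dual β) :=
  (flow_spec hβ hp).1

theorem flow_zero (hβ : β ∈ S.closedForms U) {p : M} (hp : S.π p ∈ U) : S.flow β 0 p = p :=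
  (flow_spec hβ hp).2.1

theorem π_flow (hβ : β ∈ S.closedForms U) {p : M} (hp : S.π p ∈ U) (t : ℝ) :
    S.π (S.flow β t p) = S.π p :=
  (flow_spec hβ hp).2.2 t

theorem π_flow_mem (hβ : β ∈ S.closedForms U) {p : M} (hp : S.π p ∈ U) (t : ℝ) :
    S.π (S.flow β t p) ∈ U := by rw [π_flow hβ hp]; exact hp

theorem eq_flow (hβ : β ∈ S.closedForms U) {p : M} {γ : ℝ → M}
    (hγ : IsMIntegralCurve (I := 𝓘(ℝ, Model n)) γ (S.dual β)) (hU : ∀ t, S.π (γ t) ∈ U)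
    (h0 : γ 0 = p) (t : ℝ) : γ t = S.flow β t p := by
  have hp : S.π p ∈ U := h0 ▸ hU 0
  exact congrFun (IsMIntegralCurve.eq_of_contMDiffAt (t₀ := 0)
    (fun t => contMDiffAt_dual_of_mem hβ (hU t)) hγ (isMIntegralCurve_flow hβ hp)
    (h0.trans (flow_zero hβ hp).symm)) t

theorem contMDiffAt_flow (hβ : β ∈ S.closedForms U) {p : M} (hp : S.π p ∈ U) (t : ℝ) :
    ContMDiffAt (𝓘(ℝ, ℝ).prod 𝓘(ℝ, Model n)) 𝓘(ℝ, Model n) ∞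
      (fun x : ℝ × M => S.flow β x.1 x.2) (t, p) := by
  obtain ⟨V, hxV, hVU, Φ, hΦs, hΦ⟩ := exists_localFlow hβ hp
  refine hΦs.contMDiffAt.congr_of_eventuallyEq ?_
  have h : ∀ᶠ x : ℝ × M in 𝓝 (t, p), x.2 ∈ S.π ⁻¹' V :=
    continuous_snd.continuousAt.eventually ((S.isOpen_preimage V).mem_nhds hxV)
  filter_upwards [h] with x hx
  obtain ⟨h1, h2, h3⟩ := hΦ x.2 hx
  exact (eq_flow hβ h3 (fun s => by rw [h2]; exact hVU hx) h1 x.1).symm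

theorem contMDiffAt_flow_right (hβ : β ∈ S.closedForms U) {p : M} (hp : S.π p ∈ U) (t : ℝ) :
    ContMDiffAt 𝓘(ℝ, Model n) 𝓘(ℝ, Model n) ∞ (S.flow β t) p :=
  ContMDiffAt.comp (g := fun x : ℝ × M => S.flow β x.1 x.2) p (contMDiffAt_flow hβ hp t)
    (contMDiffAt_const.prodMk contMDiffAt_id)

theorem flow_add (hβ : β ∈ S.closedForms U) {p : M} (hp : S.π p ∈ U) (s t : ℝ) :
    S.flow β (s + t) p = S.flow β s (S.flow β t p) :=
  eq_flow hβ ((isMIntegralCurve_flow hβ hp).comp_add t)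
    (fun s => π_flow_mem hβ hp _) (by simp) s

/-- The flow only depends on the restriction of the form to the fiber. -/
theorem flow_congr {V : Opens O} (hβ : β ∈ S.closedForms U) (hβ' : β' ∈ S.closedForms V) {p : M}
    (hpU : S.π p ∈ U) (hpV : S.π p ∈ V) (h : ∀ q, S.π q = S.π p → β q = β' q) (t : ℝ) :
    S.flow β t p = S.flow β' t p := by
  refine eq_flow (γ := fun s => S.flow β s p) hβ' (fun s => ?_) (fun s => by rw [π_flow hβ hpU]; exact hpV)
    (flow_zero hβ hpU) t
  rw [← S.dual_congr (h _ (π_flow hβ hpU s))]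
  exact isMIntegralCurve_flow hβ hpU s

theorem flow_smul (hβ : β ∈ S.closedForms U) {p : M} (hp : S.π p ∈ U) (c t : ℝ) :
    S.flow (c • β) t p = S.flow β (t * c) p := by
  refine (eq_flow (γ := fun t => S.flow β (t * c) p) (smul_mem_closedForms c hβ) ?_ (fun s => π_flow_mem hβ hp _)
    (by rw [zero_mul, flow_zero hβ hp]) t).symm
  have h := (isMIntegralCurve_flow hβ hp).comp_mul c
  intro s
  have h1 := h s
  simp only [Pi.smul_apply] at h1
  rw [S.dual_smul]
  exact h1

theorem flow_zero_form (p : M) (t : ℝ) : S.flow 0 t p = p := by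
  have h0 : (0 : MForm n 1 M) ∈ S.closedForms ⊤ := zero_mem _
  have h1 := flow_smul h0 (p := p) trivial 0 t
  rw [zero_smul, mul_zero, flow_zero h0 trivial] at h1
  exact h1

end

end IntegrableSystem

/-! ### Invariance under the flows -/

section VectorSpace

variable {E : Type*} [NormedAddCommGroup E] [NormedSpace ℝ E]

/-- The derivative of a closed 2-form along the flow of a vector field dual to a closed 1-form
vanishes. -/
theorem hasDerivAt_twoForm_flow {Ω : E → E [⋀^Fin 2]→L[ℝ] ℝ} {β : E → E [⋀^Fin 1]→L[ℝ] ℝ}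
    {f : E → E} {c A B : ℝ → E} {t : ℝ} (hc : HasDerivAt c (f (c t)) t)
    (hA : HasDerivAt A (fderiv ℝ f (c t) (A t)) t) (hB : HasDerivAt B (fderiv ℝ f (c t) (B t)) t)
    (hΩ : DifferentiableAt ℝ Ω (c t)) (hf : DifferentiableAt ℝ f (c t))
    (hdΩ : extDeriv Ω (c t) = 0) (hβ : DifferentiableAt ℝ β (c t)) (hdβ : extDeriv β (c t) = 0)
    (h : ∀ᶠ x in 𝓝 (c t), ∀ w, Ω x ![f x, w] = β x ![w]) :
    HasDerivAt (fun s => Ω (c s) ![A s, B s]) 0 t := by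
  set W : E → E →L[ℝ] E →L[ℝ] ℝ := fun x => twoFormCurry E (Ω x) with hWdef
  have hWd : DifferentiableAt ℝ W (c t) :=
    (HasFDerivAt.comp (E := E) (F := E [⋀^Fin 2]→L[ℝ] ℝ) (G := E →L[ℝ] E →L[ℝ] ℝ) (c t)
      (hasFDerivAt_twoFormCurry (Ω (c t))) hΩ.hasFDerivAt).differentiableAt
  have hWc : HasDerivAt (fun s => W (c s)) (fderiv ℝ W (c t) (f (c t))) t :=
    HasFDerivAt.comp_hasDerivAt (F := E) (E := E →L[ℝ] E →L[ℝ] ℝ) (l := W) (f := c) t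
      hWd.hasFDerivAt hc
  have h1 : HasDerivAt (fun s => W (c s) (A s) (B s))
      ((fderiv ℝ W (c t) (f (c t)) (A t) + W (c t) (fderiv ℝ f (c t) (A t))) (B t) +
        W (c t) (A t) (fderiv ℝ f (c t) (B t))) t := (hWc.clm_apply hA).clm_apply hB
  have h2 : fderiv ℝ W (c t) (f (c t)) (A t) (B t) + Ω (c t) ![fderiv ℝ f (c t) (A t), B t] +
      Ω (c t) ![A t, fderiv ℝ f (c t) (B t)] = 0 :=
    lieDeriv_twoForm_eq_zero hΩ hf hdΩ hβ hdβ h (A t) (B t)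
  have h3 : ∀ x a b, W x a b = Ω x ![a, b] := fun x a b => twoFormCurry_apply _ _ _
  have h4 : (fun s => Ω (c s) ![A s, B s]) = fun s => W (c s) (A s) (B s) :=
    funext fun s => (h3 _ _ _).symm
  rw [h4]
  refine h1.congr_deriv ?_
  rw [_root_.add_apply, h3, h3]
  exact h2

/-- The derivative of a closed 1-form along the flow of a vector field that it annihilates
vanishes. -/
theorem hasDerivAt_oneForm_flow {β : E → E [⋀^Fin 1]→L[ℝ] ℝ}
    {f : E → E} {c A : ℝ → E} {t : ℝ} (hc : HasDerivAt c (f (c t)) t)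
    (hA : HasDerivAt A (fderiv ℝ f (c t) (A t)) t) (hf : DifferentiableAt ℝ f (c t))
    (hβ : DifferentiableAt ℝ β (c t)) (hdβ : extDeriv β (c t) = 0)
    (h : ∀ᶠ x in 𝓝 (c t), β x ![f x] = 0) :
    HasDerivAt (fun s => β (c s) ![A s]) 0 t := by
  have hW : HasFDerivAt (fun x => oneFormEquiv E (β x))
      (fderiv ℝ (fun x => oneFormEquiv E (β x)) (c t)) (c t) :=
    ((oneFormEquiv E).toContinuousLinearEquiv.toContinuousLinearMap.differentiableAt.comp (c t)
      hβ).hasFDerivAt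
  have h1 := (hW.comp_hasDerivAt t hc).clm_apply hA
  simp only [Function.comp_apply, oneFormEquiv_apply] at h1
  refine h1.congr_deriv ?_
  exact lieDeriv_oneForm_eq_zero hf hβ hdβ h (A t)

end VectorSpace

namespace IntegrableSystem

variable {n : ℕ} {M : Type u} {O : Type v}
  [TopologicalSpace M] [ChartedSpace (Model n) M] [TopologicalSpace O]
  {S : IntegrableSystem n M O}
variable [IsManifold 𝓘(ℝ, Model n) ∞ M] [T2Space O] [T2Space M] [SecondCountableTopology M]
variable {U : Opens O} {β β' : MForm n 1 M}

theorem eventually_hasMFDerivAt_flow (hβ : β ∈ S.closedForms U) {p : M} (hp : S.π p ∈ U) (t : ℝ) :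
    ∀ᶠ x in 𝓝 (t, p), HasMFDerivAt 𝓘(ℝ, ℝ) 𝓘(ℝ, Model n) (fun t => S.flow β t x.2) x.1
      ((1 : ℝ →L[ℝ] ℝ).smulRight (S.dual β (S.flow β x.1 x.2))) := by
  have h : ∀ᶠ x : ℝ × M in 𝓝 (t, p), x.2 ∈ S.π ⁻¹' U :=
    continuous_snd.continuousAt.eventually ((S.isOpen_preimage U).mem_nhds hp)
  filter_upwards [h] with x hx using isMIntegralCurve_flow hβ hx x.1

omit [T2Space O] [T2Space M] [SecondCountableTopology M] in
theorem eventually_form_chartField (β : MForm n 1 M) (q : M) :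
    ∀ᶠ x in 𝓝 (extChartAt 𝓘(ℝ, Model n) q q), ∀ w, S.form.inChart q x
      ![chartField (S.dual β) q x, w] = β.inChart q x ![w] := by
  filter_upwards [extChartAt_target_mem_nhds (I := 𝓘(ℝ, Model n)) q] with x hx w
  rw [MForm.inChart_two_apply, mfderiv_extChartAt_symm_chartField hx, form_dual,
    MForm.inChart_one_apply]

omit [T2Space M] [SecondCountableTopology M] in
theorem eventually_inChart_chartField (hβ : β ∈ S.closedForms U) (hβ' : β' ∈ S.closedForms U)
    {q : M} (hq : S.π q ∈ U) :
    ∀ᶠ x in 𝓝 (extChartAt 𝓘(ℝ, Model n) q q),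
      β'.inChart q x ![chartField (S.dual β) q x] = 0 := by
  filter_upwards [(MForm.isOpen_chartDomain (S.isOpen_preimage U) q).mem_nhds
    (MForm.mem_chartDomain (mem_extChartAt_source q) hq)] with x hx
  rw [MForm.inChart_one_apply, mfderiv_extChartAt_symm_chartField hx.1, ← S.form_dual]
  exact form_dual_dual_eq_zero hβ' hβ hx.2

/-- The position and the image of a tangent vector under the flow, read in a chart. -/
theorem hasDerivAt_flow_chart (hβ : β ∈ S.closedForms U) {p : M} (hp : S.π p ∈ U) (t₀ : ℝ) :
    HasDerivAt (fun t => extChartAt 𝓘(ℝ, Model n) (S.flow β t₀ p) (S.flow β t p))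
      (chartField (S.dual β) (S.flow β t₀ p)
        (extChartAt 𝓘(ℝ, Model n) (S.flow β t₀ p) (S.flow β t₀ p))) t₀ ∧
    ∀ a : TangentSpace 𝓘(ℝ, Model n) p,
      HasDerivAt (fun t => (mfderiv 𝓘(ℝ, Model n) 𝓘(ℝ, Model n)
          (extChartAt 𝓘(ℝ, Model n) (S.flow β t₀ p)) (S.flow β t p)
          (mfderiv 𝓘(ℝ, Model n) 𝓘(ℝ, Model n) (S.flow β t) p a) : Model n))
        (fderiv ℝ (chartField (S.dual β) (S.flow β t₀ p))
          (extChartAt 𝓘(ℝ, Model n) (S.flow β t₀ p) (S.flow β t₀ p))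
          (mfderiv 𝓘(ℝ, Model n) 𝓘(ℝ, Model n)
            (extChartAt 𝓘(ℝ, Model n) (S.flow β t₀ p)) (S.flow β t₀ p)
            (mfderiv 𝓘(ℝ, Model n) 𝓘(ℝ, Model n) (S.flow β t₀) p a))) t₀ := by
  have hqs := mem_extChartAt_source (I := 𝓘(ℝ, Model n)) (S.flow β t₀ p)
  refine ⟨HasMFDerivAt.hasDerivAt_extChartAt (γ := fun t => S.flow β t p) hqs
    (isMIntegralCurve_flow hβ hp t₀), fun a => ?_⟩
  exact hasDerivAt_mfderiv_flow (φ := fun x : ℝ × M => S.flow β x.1 x.2)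
    (contMDiffAt_flow hβ hp t₀) hqs
    ((S.contDiffAt_chartField_dual (S.isOpen_preimage U) hβ.1 hqs
      (π_flow_mem hβ hp t₀)).differentiableAt (by simp))
    (eventually_hasMFDerivAt_flow hβ hp t₀) a

theorem eventually_flow_mem_source (hβ : β ∈ S.closedForms U) {p : M} (hp : S.π p ∈ U) (t₀ : ℝ) :
    ∀ᶠ t in 𝓝 t₀, S.flow β t p ∈ (extChartAt 𝓘(ℝ, Model n) (S.flow β t₀ p)).source :=
  ((isMIntegralCurve_flow hβ hp t₀).continuousAt).eventually
    (extChartAt_source_mem_nhds (I := 𝓘(ℝ, Model n)) (S.flow β t₀ p))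

theorem mfderiv_flow_zero (hβ : β ∈ S.closedForms U) {p : M} (hp : S.π p ∈ U) :
    HasMFDerivAt 𝓘(ℝ, Model n) 𝓘(ℝ, Model n) (S.flow β 0) p
      (ContinuousLinearMap.id ℝ (Model n)) := by
  refine (hasMFDerivAt_id p).congr_of_eventuallyEq ?_
  filter_upwards [(S.isOpen_preimage U).mem_nhds hp] with q hq using flow_zero hβ hq

/-- Cartan's formula: the Lie derivative of the symplectic form is `d (i_X ω) = dβ = 0`. -/
theorem form_mfderiv_flow (hβ : β ∈ S.closedForms U) {p : M} (hp : S.π p ∈ U) (t : ℝ)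
    (a b : TangentSpace 𝓘(ℝ, Model n) p) :
    S.form (S.flow β t p) ![mfderiv 𝓘(ℝ, Model n) 𝓘(ℝ, Model n) (S.flow β t) p a,
      mfderiv 𝓘(ℝ, Model n) 𝓘(ℝ, Model n) (S.flow β t) p b] = S.form p ![a, b] := by
  set g : ℝ → ℝ := fun t => S.form (S.flow β t p)
    ![mfderiv 𝓘(ℝ, Model n) 𝓘(ℝ, Model n) (S.flow β t) p a,
      mfderiv 𝓘(ℝ, Model n) 𝓘(ℝ, Model n) (S.flow β t) p b] with hg
  have hd : ∀ t, HasDerivAt g 0 t := by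
    intro t₀
    have hqU := π_flow_mem hβ hp t₀
    obtain ⟨hc, hA⟩ := hasDerivAt_flow_chart hβ hp t₀
    set q := S.flow β t₀ p with hq
    have hqs := mem_extChartAt_source (I := 𝓘(ℝ, Model n)) q
    have hqt : extChartAt 𝓘(ℝ, Model n) q q ∈ MForm.chartDomain n (S.π ⁻¹' U) q :=
      MForm.mem_chartDomain hqs hqU
    have hmain := hasDerivAt_twoForm_flow (Ω := S.form.inChart q) (β := β.inChart q) hc (hA a) (hA b)
      ((S.smooth.contDiffAt isOpen_univ hqs (mem_univ _)).differentiableAt (by simp))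
      ((S.contDiffAt_chartField_dual (S.isOpen_preimage U) hβ.1 hqs hqU).differentiableAt (by simp))
      (S.closed q _ ⟨hqt.1, mem_univ _⟩)
      ((hβ.1.contDiffAt (S.isOpen_preimage U) hqs hqU).differentiableAt (by simp))
      (hβ.2.1 q _ hqt) (eventually_form_chartField β q)
    refine hmain.congr_of_eventuallyEq ?_
    filter_upwards [eventually_flow_mem_source hβ hp t₀] with t ht
    exact (MForm.inChart_apply_two S.form ht _ _).symm
  have h := is_const_of_deriv_eq_zero (fun t => (hd t).differentiableAt) (fun t => (hd t).deriv) t 0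
  have h0 : g 0 = S.form p ![a, b] := by
    rw [hg]
    dsimp only
    rw [(mfderiv_flow_zero hβ hp).mfderiv]
    have : ∀ q, q = p → S.form q ![(a : Model n), b] = S.form p ![a, b] := by rintro q rfl; rfl
    exact this _ (flow_zero hβ hp)
  exact h.trans h0

/-- The flow preserves the sections of `𝒵¹`. -/
theorem oneForm_mfderiv_flow (hβ : β ∈ S.closedForms U) (hβ' : β' ∈ S.closedForms U) {p : M}
    (hp : S.π p ∈ U) (t : ℝ) (a : TangentSpace 𝓘(ℝ, Model n) p) :
    β' (S.flow β t p) ![mfderiv 𝓘(ℝ, Model n) 𝓘(ℝ, Model n) (S.flow β t) p a] = β' p ![a] := by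
  set g : ℝ → ℝ := fun t => β' (S.flow β t p)
    ![mfderiv 𝓘(ℝ, Model n) 𝓘(ℝ, Model n) (S.flow β t) p a] with hg
  have hd : ∀ t, HasDerivAt g 0 t := by
    intro t₀
    have hqU := π_flow_mem hβ hp t₀
    obtain ⟨hc, hA⟩ := hasDerivAt_flow_chart hβ hp t₀
    set q := S.flow β t₀ p with hq
    have hqs := mem_extChartAt_source (I := 𝓘(ℝ, Model n)) q
    have hqt : extChartAt 𝓘(ℝ, Model n) q q ∈ MForm.chartDomain n (S.π ⁻¹' U) q :=
      MForm.mem_chartDomain hqs hqU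
    have hmain := hasDerivAt_oneForm_flow (β := β'.inChart q) hc (hA a)
      ((S.contDiffAt_chartField_dual (S.isOpen_preimage U) hβ.1 hqs hqU).differentiableAt (by simp))
      ((hβ'.1.contDiffAt (S.isOpen_preimage U) hqs hqU).differentiableAt (by simp))
      (hβ'.2.1 q _ hqt) (eventually_inChart_chartField hβ hβ' hqU)
    refine hmain.congr_of_eventuallyEq ?_
    filter_upwards [eventually_flow_mem_source hβ hp t₀] with t ht
    exact (MForm.inChart_apply_one β' ht _).symm
  have h := is_const_of_deriv_eq_zero (fun t => (hd t).differentiableAt) (fun t => (hd t).deriv) t 0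
  have h0 : g 0 = β' p ![a] := by
    rw [hg]
    dsimp only
    rw [(mfderiv_flow_zero hβ hp).mfderiv]
    have : ∀ q, q = p → β' q ![(a : Model n)] = β' p ![a] := by rintro q rfl; rfl
    exact this _ (flow_zero hβ hp)
  exact h.trans h0

omit [IsManifold 𝓘(ℝ, Model n) ∞ M] [T2Space O] [T2Space M] [SecondCountableTopology M] in
theorem surjective_of_form_eq {p q : M}
    (A : TangentSpace 𝓘(ℝ, Model n) p →L[ℝ] TangentSpace 𝓘(ℝ, Model n) q)
    (h : ∀ a b, S.form q ![A a, A b] = S.form p ![a, b]) : Function.Surjective A := by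
  have hinj : Function.Injective A := by
    intro a a' haa
    refine S.eq_of_form_eq fun b => ?_
    rw [← h, ← h, haa]
  have : FiniteDimensional ℝ (TangentSpace 𝓘(ℝ, Model n) p) :=
    inferInstanceAs (FiniteDimensional ℝ (Model n))
  have : FiniteDimensional ℝ (TangentSpace 𝓘(ℝ, Model n) q) :=
    inferInstanceAs (FiniteDimensional ℝ (Model n))
  exact (LinearMap.injective_iff_surjective_of_finrank_eq_finrank (f := A.toLinearMap) rfl).1 hinj

theorem mfderiv_flow_surjective (hβ : β ∈ S.closedForms U) {p : M} (hp : S.π p ∈ U) (t : ℝ) :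
    Function.Surjective (mfderiv 𝓘(ℝ, Model n) 𝓘(ℝ, Model n) (S.flow β t) p) :=
  surjective_of_form_eq _ (form_mfderiv_flow hβ hp t)

/-- The flow preserves the vector fields dual to sections of `𝒵¹`. -/
theorem mfderiv_flow_dual (hβ : β ∈ S.closedForms U) (hβ' : β' ∈ S.closedForms U) {p : M}
    (hp : S.π p ∈ U) (t : ℝ) :
    mfderiv 𝓘(ℝ, Model n) 𝓘(ℝ, Model n) (S.flow β t) p (S.dual β' p) =
      S.dual β' (S.flow β t p) := by
  refine S.eq_dual fun b => ?_
  obtain ⟨b, rfl⟩ := mfderiv_flow_surjective hβ hp t b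
  rw [form_mfderiv_flow hβ hp, S.form_dual, oneForm_mfderiv_flow hβ hβ' hp]

omit [IsManifold 𝓘(ℝ, Model n) ∞ M] [T2Space O] [T2Space M] [SecondCountableTopology M] in
theorem _root_.HasMFDerivAt.comp_curve {g : M → M} {γ : ℝ → M} {t : ℝ}
    {a : TangentSpace 𝓘(ℝ, Model n) (γ t)}
    (hg : MDifferentiableAt 𝓘(ℝ, Model n) 𝓘(ℝ, Model n) g (γ t))
    (hγ : HasMFDerivAt 𝓘(ℝ, ℝ) 𝓘(ℝ, Model n) γ t ((1 : ℝ →L[ℝ] ℝ).smulRight a)) :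
    HasMFDerivAt 𝓘(ℝ, ℝ) 𝓘(ℝ, Model n) (fun s => g (γ s)) t
      ((1 : ℝ →L[ℝ] ℝ).smulRight (mfderiv 𝓘(ℝ, Model n) 𝓘(ℝ, Model n) g (γ t) a)) := by
  refine (hg.hasMFDerivAt.comp t hγ).congr_mfderiv ?_
  refine ContinuousLinearMap.ext fun s => ?_
  exact map_smul (mfderiv 𝓘(ℝ, Model n) 𝓘(ℝ, Model n) g (γ t)) _ a

/-- Each flow preserves the vector field of the other, since it preserves both the form and `ω`. -/
theorem flow_comm (hβ : β ∈ S.closedForms U) (hβ' : β' ∈ S.closedForms U) {p : M}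
    (hp : S.π p ∈ U) (s t : ℝ) :
    S.flow β s (S.flow β' t p) = S.flow β' t (S.flow β s p) := by
  refine eq_flow (γ := fun t => S.flow β s (S.flow β' t p)) hβ' (fun t => ?_) (fun t => ?_) ?_ t
  · have := HasMFDerivAt.comp_curve (g := S.flow β s) (γ := fun t => S.flow β' t p)
      ((contMDiffAt_flow_right hβ (π_flow_mem hβ' hp t) s).mdifferentiableAt (by simp))
      (isMIntegralCurve_flow hβ' hp t)
    rw [mfderiv_flow_dual hβ hβ' (π_flow_mem hβ' hp t)] at this
    exact this
  · exact π_flow_mem hβ (π_flow_mem hβ' hp t) s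
  · simp only [flow_zero hβ' hp]

theorem flow_add_form (hβ : β ∈ S.closedForms U) (hβ' : β' ∈ S.closedForms U) {p : M}
    (hp : S.π p ∈ U) (t : ℝ) :
    S.flow (β + β') t p = S.flow β t (S.flow β' t p) := by
  refine (eq_flow (γ := fun t => S.flow β t (S.flow β' t p)) (add_mem hβ hβ')
    (fun t => ?_) (fun t => ?_) ?_ t).symm
  · have hp' := π_flow_mem hβ' hp t
    have h := MDifferentiableAt.hasMFDerivAt_comp₂ (Φ := fun x : ℝ × M => S.flow β x.1 x.2)
      (a := fun t : ℝ => t) (b := fun t => S.flow β' t p) (z := t)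
      ((contMDiffAt_flow hβ hp' t).mdifferentiableAt (by simp)) (hasMFDerivAt_id t)
      (isMIntegralCurve_flow hβ' hp t)
    refine h.congr_mfderiv ?_
    rw [(isMIntegralCurve_flow hβ hp' t).mfderiv]
    refine ContinuousLinearMap.ext fun (s : ℝ) => ?_
    rw [S.dual_add, ← mfderiv_flow_dual hβ hβ' hp' t]
    refine Eq.trans ?_ (smul_add (s : ℝ) (S.dual β (S.flow β t (S.flow β' t p))) _).symm
    exact congrArg ((s : ℝ) • S.dual β (S.flow β t (S.flow β' t p)) + ·)
      (map_smul (mfderiv 𝓘(ℝ, Model n) 𝓘(ℝ, Model n) (S.flow β t) (S.flow β' t p)) (s : ℝ) _)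
  · exact π_flow_mem hβ (π_flow_mem hβ' hp t) t
  · simp only [flow_zero hβ' hp, flow_zero hβ hp]

theorem flow_neg_form (hβ : β ∈ S.closedForms U) {p : M} (hp : S.π p ∈ U) (t : ℝ) :
    S.flow (-β) t p = S.flow β (-t) p := by
  have h : (-1 : ℝ) • β = -β := funext fun p => neg_one_smul ℝ (β p)
  have := flow_smul hβ hp (-1) t
  rwa [h, mul_neg_one] at this

end IntegrableSystem

/-! ### Strata, and the admissibility of time-one maps -/

/-- A Baire space covered by finitely many locally closed sets has a nonempty open subset in one
of them. -/
theorem exists_nonempty_interior_of_isLocallyClosed {X ι : Type*} [TopologicalSpace X] [BaireSpace X]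
    [Nonempty X] [Countable ι] {A : ι → Set X} (hA : ∀ i, IsLocallyClosed (A i))
    (hU : ⋃ i, A i = univ) : ∃ i, (interior (A i)).Nonempty := by
  obtain ⟨i, x, hx⟩ := nonempty_interior_of_iUnion_of_closed (f := fun i => closure (A i))
    (fun i => isClosed_closure) (eq_univ_of_univ_subset (hU ▸ iUnion_mono fun i => subset_closure))
  obtain ⟨W, Z, hW, hZ, hWZ⟩ := hA i
  have hcl : closure (A i) ⊆ Z := closure_minimal (hWZ ▸ inter_subset_right) hZ
  obtain ⟨y, hy1, hy2⟩ := mem_closure_iff.1 (interior_subset hx) _ isOpen_interior hx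
  refine ⟨i, y, ?_⟩
  refine mem_interior.2 ⟨W ∩ interior (closure (A i)), ?_, hW.inter isOpen_interior, ?_, hy1⟩
  · rintro z ⟨hz1, hz2⟩
    rw [hWZ]
    exact ⟨hz1, hcl (interior_subset hz2)⟩
  · exact (hWZ ▸ hy2 : y ∈ W ∩ Z).1

theorem IsEmbeddedSubmanifold.isLocallyClosed {n : ℕ} {M : Type u} [TopologicalSpace M]
    [ChartedSpace (Model n) M] {N : Set M} {d : ℕ} (h : IsEmbeddedSubmanifold (n := n) N d) :
    IsLocallyClosed N := by
  choose χ hχ hps himg using h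
  set L : Set (Model n) := {e | ∀ i : Fin (2 * n), d ≤ i.1 → e i = 0} with hL
  have hLc : IsClosed L := by
    have : L = ⋂ i : Fin (2 * n), ⋂ _ : d ≤ i.1, {e : Model n | e i = 0} := by
      ext e; simp [hL]
    rw [this]
    refine isClosed_iInter fun i => isClosed_iInter fun _ => isClosed_eq ?_ continuous_const
    fun_prop
  refine ⟨⋃ p : N, (χ p p.2).source, closure N, isOpen_iUnion fun p => (χ p p.2).open_source,
    isClosed_closure, subset_antisymm (fun p hp => ⟨mem_iUnion.2 ⟨⟨p, hp⟩, hps p hp⟩,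
      subset_closure hp⟩) ?_⟩
  rintro q ⟨hq, hqN⟩
  obtain ⟨⟨p, hp⟩, hqs⟩ := mem_iUnion.1 hq
  have hqL : χ p hp q ∈ L := by
    by_contra hne
    have h1 : ∀ᶠ q' in 𝓝 q, χ p hp q' ∉ L :=
      ((χ p hp).continuousAt hqs).eventually (hLc.isOpen_compl.mem_nhds hne)
    obtain ⟨q', hq'N, hq'L, hq's⟩ := ((mem_closure_iff_frequently.1 hqN).and_eventually
      (h1.and ((χ p hp).open_source.mem_nhds hqs))).exists
    have : χ p hp q' ∈ χ p hp '' (N ∩ (χ p hp).source) := ⟨q', ⟨hq'N, hq's⟩, rfl⟩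
    rw [himg p hp] at this
    exact hq'L this.2
  have h2 : χ p hp q ∈ χ p hp '' (N ∩ (χ p hp).source) := by
    rw [himg p hp]; exact ⟨(χ p hp).map_source hqs, hqL⟩
  obtain ⟨q', ⟨hq'N, hq's⟩, hqq⟩ := h2
  rwa [← (χ p hp).injOn hq's hqs hqq]

namespace IntegrableSystem

variable {n : ℕ} {M : Type u} {O : Type v}
  [TopologicalSpace M] [ChartedSpace (Model n) M] [TopologicalSpace O]
  {S : IntegrableSystem n M O}

theorem mem_stratum_self (p : M) : p ∈ S.stratum p := Relation.EqvGen.refl p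

theorem stratum_symm {p q : M} (h : q ∈ S.stratum p) : p ∈ S.stratum q := h.symm

theorem stratum_trans {p q r : M} (h : q ∈ S.stratum p) (h' : r ∈ S.stratum q) :
    r ∈ S.stratum p := Relation.EqvGen.trans _ _ _ h h'

variable [IsManifold 𝓘(ℝ, Model n) ∞ M] [T2Space O] [T2Space M] [SecondCountableTopology M]
variable {U : Opens O} {β β' : MForm n 1 M}

theorem flowRel_iff {p q : M} : S.FlowRel p q ↔ ∃ U : Opens O, S.π p ∈ U ∧ ∃ F : Fin n → M → ℝ,
    S.IsMomentMap U F ∧ ∃ (i : Fin n) (t : ℝ), S.flow (MForm.ofFunction (F i)) t p = q := by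
  constructor
  · rintro ⟨U, hp, F, hF, i, Y, hY, γ, hγ, hγU, h0, t, ht⟩
    refine ⟨U, hp, F, hF, i, t, ?_⟩
    rw [← ht]
    refine (eq_flow (ofFunction_mem_closedForms hF i) (fun t => ?_) hγU h0 t).symm
    rw [← S.isHamiltonianAt_iff.1 (hY _ (hγU t))]
    exact hγ t
  · rintro ⟨U, hp, F, hF, i, t, ht⟩
    have hβ := ofFunction_mem_closedForms hF i
    exact ⟨U, hp, F, hF, i, S.dual (MForm.ofFunction (F i)),
      fun q _ => S.isHamiltonianAt_iff.2 rfl, fun t => S.flow (MForm.ofFunction (F i)) t p,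
      isMIntegralCurve_flow hβ hp, fun t => π_flow_mem hβ hp t, flow_zero hβ hp, t, ht⟩

theorem FlowRel.π_eq {p q : M} (h : S.FlowRel p q) : S.π q = S.π p := by
  obtain ⟨U, hp, F, hF, i, t, rfl⟩ := flowRel_iff.1 h
  exact π_flow (ofFunction_mem_closedForms hF i) hp t

theorem π_eq_of_mem_stratum {p q : M} (h : q ∈ S.stratum p) : S.π q = S.π p := by
  induction h with
  | rel _ _ h => exact h.π_eq
  | refl => rfl
  | symm _ _ _ ih => exact ih.symm
  | trans _ _ _ _ _ ih1 ih2 => exact ih2.trans ih1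

/-- The flows commute with the flows of the moment maps, so they permute the strata. -/
theorem flow_mem_stratum_flow (hβ : β ∈ S.closedForms U) {p q : M} (hp : S.π p ∈ U)
    (h : q ∈ S.stratum p) (t : ℝ) : S.flow β t q ∈ S.stratum (S.flow β t p) := by
  induction h with
  | rel p q h =>
    obtain ⟨V, hpV, F, hF, i, s, rfl⟩ := flowRel_iff.1 h
    refine Relation.EqvGen.rel _ _ (flowRel_iff.2 ⟨V, ?_, F, hF, i, s, ?_⟩)
    · rw [π_flow hβ hp]; exact hpV
    · exact (flow_comm (S.closedForms_mono inf_le_left hβ)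
        (S.closedForms_mono inf_le_right (ofFunction_mem_closedForms hF i))
        (U := U ⊓ V) ⟨hp, hpV⟩ t s).symm
  | refl => exact mem_stratum_self _
  | symm p q h ih =>
    exact stratum_symm (ih (by rw [← π_eq_of_mem_stratum h]; exact hp))
  | trans p q r h1 h2 ih1 ih2 =>
    exact stratum_trans (ih1 hp) (ih2 (by rw [π_eq_of_mem_stratum h1]; exact hp))

/-- The flows of sections of `𝒵¹` preserve each stratum: an integral curve is in finitely many
strata, so it is in a single one during some interval of time; as the flow permutes the strata, the
same holds near each time. -/
theorem flow_mem_stratum (h₁ : S.FiniteStrata) (hβ : β ∈ S.closedForms U) {p : M}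
    (hp : S.π p ∈ U) (t : ℝ) : S.flow β t p ∈ S.stratum p := by
  obtain ⟨k, N, d, -, hN, hNs⟩ := h₁ (S.π p)
  have hγ : Continuous fun t => S.flow β t p :=
    continuous_iff_continuousAt.2 fun t => (isMIntegralCurve_flow hβ hp t).continuousAt
  obtain ⟨i, t₀, ht₀⟩ := exists_nonempty_interior_of_isLocallyClosed
    (A := fun i => (fun t => S.flow β t p) ⁻¹' N i)
    (fun i => ((hNs i).1.isLocallyClosed).preimage hγ) (by
      rw [← preimage_iUnion, hN]
      exact eq_univ_of_forall fun t => π_flow hβ hp t)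
  have hst : ∀ᶠ s in 𝓝 t₀, S.flow β s p ∈ S.stratum (S.flow β t₀ p) := by
    have h0 : S.flow β t₀ p ∈ N i :=
      interior_subset (s := (fun t => S.flow β t p) ⁻¹' N i) ht₀
    filter_upwards [isOpen_interior.mem_nhds ht₀] with s hs
    rw [← ((hNs i).2 _ h0).1]
    exact interior_subset (s := (fun t => S.flow β t p) ⁻¹' N i) hs
  -- The flow at time `t - t₀` moves the interval around `t₀` to one around `t`.
  have hall : ∀ t : ℝ, ∀ᶠ s in 𝓝 t, S.flow β s p ∈ S.stratum (S.flow β t p) := by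
    intro t
    have htend : Tendsto (fun s => s + (t₀ - t)) (𝓝 t) (𝓝 t₀) := by
      have : Continuous fun s : ℝ => s + (t₀ - t) := by fun_prop
      simpa using this.tendsto t
    filter_upwards [htend.eventually hst] with s hs
    have := flow_mem_stratum_flow hβ (π_flow_mem hβ hp t₀) hs (t - t₀)
    rw [← flow_add hβ hp, ← flow_add hβ hp, sub_add_cancel,
      show t - t₀ + (s + (t₀ - t)) = s by ring] at this
    exact this
  have := PreconnectedSpace.induction₂'
    (fun s t : ℝ => S.flow β t p ∈ S.stratum (S.flow β s p))
    (fun t => (hall t).mono fun s hs => ⟨hs, stratum_symm hs⟩)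
    ⟨fun a b c hab hbc => stratum_trans hab hbc⟩ 0 t
  rwa [flow_zero hβ hp] at this

/-- The time-`t` flow on a flow-invariant subset of `π⁻¹(U)`. -/
noncomputable def flowOn (hβ : β ∈ S.closedForms U) {N : Set M} (hNU : N ⊆ S.π ⁻¹' U)
    (hN : ∀ p ∈ N, ∀ t, S.flow β t p ∈ N) : C(ℝ × N, N) where
  toFun x := ⟨S.flow β x.1 x.2, hN x.2 x.2.2 x.1⟩
  continuous_toFun := by
    refine Continuous.subtype_mk (continuous_iff_continuousAt.2 fun x => ?_) _
    have h1 : ContinuousAt (fun y : ℝ × M => S.flow β y.1 y.2) (x.1, (x.2 : M)) :=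
      (contMDiffAt_flow hβ (hNU x.2.2) x.1).continuousAt
    exact ContinuousAt.comp (f := fun x : ℝ × N => (x.1, (x.2 : M))) h1
      (by fun_prop)

/-- The time-one map is homotopic to the identity on invariant subsets. -/
theorem exists_homotopy_flow (hβ : β ∈ S.closedForms U) {N : Set M} (hNU : N ⊆ S.π ⁻¹' U)
    (hN : ∀ p ∈ N, ∀ t, S.flow β t p ∈ N) :
    ∃ f : C(N, N), (∀ p, (f p : M) = S.flow β 1 p) ∧ f.Homotopic (ContinuousMap.id N) := by
  set f : C(N, N) := ⟨fun p => flowOn hβ hNU hN (1, p), by fun_prop⟩ with hf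
  refine ⟨f, fun p => rfl, ContinuousMap.Homotopic.symm ⟨⟨⟨fun x => flowOn hβ hNU hN (x.1, x.2),
    by fun_prop⟩, fun p => ?_, fun p => ?_⟩⟩⟩
  · exact Subtype.ext (flow_zero hβ (hNU p.2))
  · rfl

omit [IsManifold 𝓘(ℝ, Model n) ∞ M] [T2Space O] [T2Space M] [SecondCountableTopology M]
  [ChartedSpace (Model n) M] in
theorem actsTriviallyOnLoops_of_homotopic {P : Set M} {g : M → M} {f : C(P, P)}
    (hf : ∀ p, (f p : M) = g p) (h : f.Homotopic (ContinuousMap.id P)) :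
    ActsTriviallyOnLoops P g :=
  ⟨f, hf, fun γ => h.comp (ContinuousMap.Homotopic.refl γ)⟩

omit [IsManifold 𝓘(ℝ, Model n) ∞ M] [T2Space O] [T2Space M] [SecondCountableTopology M]
  [ChartedSpace (Model n) M] in
theorem actsTriviallyOnH1_of_homotopic {N : Set M} {g : M → M} {f : C(N, N)}
    (hf : ∀ p, (f p : M) = g p) (h : f.Homotopic (ContinuousMap.id N)) :
    ActsTriviallyOnH1 N g := by
  obtain ⟨H⟩ := h
  refine ⟨f, hf, ?_⟩
  have h1 := TopCat.Homotopy.congr_homologyMap_singularChainComplexFunctor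
    (f := TopCat.ofHom f) (g := TopCat.ofHom (ContinuousMap.id N)) H
    (ModuleCat.of ℤ (ULift.{u} ℤ)) 1
  have h2 := ((AlgebraicTopology.singularHomologyFunctor (ModuleCat.{u} ℤ) 1).obj
      (ModuleCat.of ℤ (ULift.{u} ℤ))).map_id (TopCat.of N)
  exact h1.trans h2

/-- Automorphisms that are locally time-one maps of closed forms are admissible. -/
theorem isAdmissible_of_flow (h₁ : S.FiniteStrata) {g : M → M}
    (h : ∀ x ∈ U, ∃ V : Opens O, x ∈ V ∧ ∃ β ∈ S.closedForms V, ∀ p ∈ S.π ⁻¹' V,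
      g p = S.flow β 1 p) : S.IsAdmissible U g := by
  refine ⟨fun p hp => ?_, fun p hp => ?_, fun x hx => ?_⟩
  · obtain ⟨V, hxV, β, hβ, hg⟩ := h _ hp
    rw [hg p hxV]
    exact flow_mem_stratum h₁ hβ hxV 1
  · obtain ⟨V, hxV, β, hβ, hg⟩ := h _ hp
    have hsub : S.stratum p ⊆ S.π ⁻¹' V := fun q hq => by
      rw [mem_preimage, π_eq_of_mem_stratum hq]; exact hxV
    obtain ⟨f, hf, hom⟩ := exists_homotopy_flow hβ hsub
      (fun q hq t => stratum_trans hq (flow_mem_stratum h₁ hβ (hsub hq) t))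
    exact actsTriviallyOnLoops_of_homotopic (fun q => (hf q).trans (hg q (hsub q.2)).symm) hom
  · obtain ⟨V, hxV, β, hβ, hg⟩ := h x hx
    have hsub : S.π ⁻¹' {x} ⊆ S.π ⁻¹' V := fun q hq => by
      have hq' : S.π q = x := hq
      rw [mem_preimage, hq']; exact hxV
    obtain ⟨f, hf, hom⟩ := exists_homotopy_flow hβ hsub
      (fun q hq t => (π_flow hβ (hsub hq) t).trans hq)
    exact actsTriviallyOnH1_of_homotopic (fun q => (hf q).trans (hg q (hsub q.2)).symm) hom

/-! ### The sheaf `𝒵¹/ℛ` and time-one maps -/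

/-- The germs in `ℛ` are those of the closed forms whose time-one map is the identity. -/
theorem mem_circleGerms_iff {x : O} : β ∈ S.circleGerms x ↔
    ∃ U : Opens O, x ∈ U ∧ β ∈ S.closedForms U ∧ ∀ p ∈ S.π ⁻¹' U, S.flow β 1 p = p := by
  constructor
  · intro h
    induction h using AddSubgroup.closure_induction with
    | mem β hβ =>
      obtain ⟨U, hx, hβU, Y, hY, hp⟩ := hβ
      refine ⟨U, hx, hβU, fun p hpU => ?_⟩
      obtain ⟨γ, hγ, hγU, h0, hper⟩ := hp p hpU
      rw [hY.eq_dual] at hγ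
      rw [← eq_flow hβU hγ hγU h0 1, ← zero_add (1 : ℝ), hper 0, h0]
    | zero => exact ⟨⊤, trivial, zero_mem _, fun p _ => flow_zero_form p 1⟩
    | add β β' _ _ h h' =>
      obtain ⟨U, hx, hβ, hp⟩ := h
      obtain ⟨U', hx', hβ', hp'⟩ := h'
      have h1 := S.closedForms_mono (inf_le_left : U ⊓ U' ≤ U) hβ
      have h2 := S.closedForms_mono (inf_le_right : U ⊓ U' ≤ U') hβ'
      refine ⟨U ⊓ U', ⟨hx, hx'⟩, add_mem h1 h2, fun p hpU => ?_⟩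
      rw [flow_add_form h1 h2 hpU, hp' p hpU.2, hp p hpU.1]
    | neg β _ h =>
      obtain ⟨U, hx, hβ, hp⟩ := h
      refine ⟨U, hx, neg_mem hβ, fun p hpU => ?_⟩
      have h1 := flow_add hβ (p := p) hpU (-1) 1
      rw [neg_add_cancel, flow_zero hβ hpU, hp p hpU] at h1
      rw [flow_neg_form hβ hpU, ← h1]
  · rintro ⟨U, hx, hβ, hp⟩
    refine AddSubgroup.subset_closure ⟨U, hx, hβ, S.dual β, S.isDual_dual β, fun p hpU =>
      ⟨fun t => S.flow β t p, isMIntegralCurve_flow hβ hpU, fun t => π_flow_mem hβ hpU t,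
        flow_zero hβ hpU, fun t => ?_⟩⟩
    dsimp only
    rw [flow_add hβ hpU, hp p hpU]

/-- Two closed forms define the same germ of `𝒵¹/ℛ` exactly when their time-one maps agree. -/
theorem mk_eq_mk_iff {U' : Opens O} (hβ : β ∈ S.closedForms U) (hβ' : β' ∈ S.closedForms U') {x : O}
    (hx : x ∈ U) (hx' : x ∈ U') :
    (QuotientAddGroup.mk β : MForm n 1 M ⧸ S.circleGerms x) = QuotientAddGroup.mk β' ↔
      ∃ V : Opens O, x ∈ V ∧ V ≤ U ⊓ U' ∧ ∀ p ∈ S.π ⁻¹' V, S.flow β 1 p = S.flow β' 1 p := by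
  rw [QuotientAddGroup.eq, mem_circleGerms_iff]
  constructor
  · rintro ⟨W, hxW, hW, hid⟩
    refine ⟨W ⊓ (U ⊓ U'), ⟨hxW, hx, hx'⟩, inf_le_right, fun p hp => ?_⟩
    have h1 := S.closedForms_mono (show W ⊓ (U ⊓ U') ≤ U from inf_le_right.trans inf_le_left) hβ
    have h2 := S.closedForms_mono (inf_le_left : W ⊓ (U ⊓ U') ≤ W) hW
    have h3 := flow_add_form h1 h2 hp 1
    rw [add_neg_cancel_left, hid p hp.1] at h3
    exact h3.symm
  · rintro ⟨V, hxV, hV, heq⟩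
    have h1 := S.closedForms_mono (hV.trans inf_le_left) hβ
    have h2 := S.closedForms_mono (hV.trans inf_le_right) hβ'
    refine ⟨V, hxV, add_mem (neg_mem h1) h2, fun p hp => ?_⟩
    rw [flow_add_form (neg_mem h1) h2 hp, ← heq p hp, ← flow_add_form (neg_mem h1) h1 hp,
      neg_add_cancel, flow_zero_form]

end IntegrableSystem

/-! ### Local inverses and local sections -/

section Inverse

variable {E F : Type*} [NormedAddCommGroup E] [NormedSpace ℝ E] [NormedAddCommGroup F]
  [NormedSpace ℝ F]

/-- The inverse function theorem, with smoothness of the inverse on a neighborhood. -/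
theorem exists_smooth_localInverse [CompleteSpace E] {f : E → F} {x₀ : E}
    (hf : ∀ᶠ x in 𝓝 x₀, ContDiffAt ℝ ∞ f x) (L : E ≃L[ℝ] F)
    (hL : HasFDerivAt f (L : E →L[ℝ] F) x₀) :
    ∃ g : F → E, g (f x₀) = x₀ ∧ ∀ᶠ y in 𝓝 (f x₀), ContDiffAt ℝ ∞ g y ∧ f (g y) = y := by
  set P := hf.self_of_nhds.toOpenPartialHomeomorph f hL (by simp) with hP
  have hs : x₀ ∈ P.source := hf.self_of_nhds.mem_toOpenPartialHomeomorph_source hL (by simp)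
  have ht : f x₀ ∈ P.target := hf.self_of_nhds.image_mem_toOpenPartialHomeomorph_target hL (by simp)
  have hinv : P.symm (f x₀) = x₀ := P.left_inv hs
  have htend : Tendsto P.symm (𝓝 (f x₀)) (𝓝 x₀) := by
    have := P.continuousAt_symm ht
    rwa [ContinuousAt, hinv] at this
  have hder : ∀ᶠ x in 𝓝 x₀, ∃ A : E ≃L[ℝ] F, (A : E →L[ℝ] F) = fderiv ℝ f x := by
    have h1 : ContinuousAt (fderiv ℝ f) x₀ :=
      (hf.self_of_nhds.fderiv_right (m := 0) (by simp)).continuousAt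
    have h2 := ContinuousLinearEquiv.nhds L
    rw [← hL.fderiv] at h2
    exact h1 h2
  refine ⟨P.symm, hinv, ?_⟩
  filter_upwards [P.open_target.mem_nhds ht, htend.eventually hf, htend.eventually hder]
    with y hy h1 h2
  obtain ⟨A, hA⟩ := h2
  refine ⟨P.contDiffAt_symm hy (f₀' := A) ?_ h1, P.right_inv hy⟩
  rw [hA]
  exact (h1.differentiableAt (by simp)).hasFDerivAt

theorem exists_smooth_localInverse_of_injective [FiniteDimensional ℝ E] [FiniteDimensional ℝ F]
    {f : E → F} {x₀ : E} (hf : ∀ᶠ x in 𝓝 x₀, ContDiffAt ℝ ∞ f x)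
    (hdim : Module.finrank ℝ E = Module.finrank ℝ F)
    (hinj : ∀ v, fderiv ℝ f x₀ v = 0 → v = 0) :
    ∃ g : F → E, g (f x₀) = x₀ ∧ ∀ᶠ y in 𝓝 (f x₀), ContDiffAt ℝ ∞ g y ∧ f (g y) = y := by
  have : CompleteSpace E := FiniteDimensional.complete ℝ E
  let L : E ≃ₗ[ℝ] F := LinearEquiv.ofInjectiveOfFinrankEq (fderiv ℝ f x₀).toLinearMap
    ((injective_iff_map_eq_zero _).2 hinj) hdim
  refine exists_smooth_localInverse hf L.toContinuousLinearEquiv ?_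
  exact (hf.self_of_nhds.differentiableAt (by simp)).hasFDerivAt

/-- A submersion has a local section through each point. -/
theorem exists_smooth_localSection [FiniteDimensional ℝ E] [FiniteDimensional ℝ F]
    {f : E → F} {x₀ : E} (hf : ∀ᶠ x in 𝓝 x₀, ContDiffAt ℝ ∞ f x)
    (hsurj : Function.Surjective (fderiv ℝ f x₀)) :
    ∃ σ : F → E, σ (f x₀) = x₀ ∧ ∀ᶠ y in 𝓝 (f x₀), ContDiffAt ℝ ∞ σ y ∧ f (σ y) = y := by
  have : CompleteSpace F := FiniteDimensional.complete ℝ F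
  obtain ⟨A, hA⟩ := ContinuousLinearMap.exists_rightInverse_of_surjective (fderiv ℝ f x₀)
    (LinearMap.range_eq_top.2 hsurj)
  set κ : F → F := fun y => f (x₀ + A y) with hκ
  have hκ0 : κ 0 = f x₀ := by simp [hκ]
  have hin : ContDiff ℝ ∞ fun y : F => x₀ + A y := contDiff_const.add A.contDiff
  have htend : Tendsto (fun y : F => x₀ + A y) (𝓝 0) (𝓝 x₀) := by
    simpa using hin.continuous.tendsto 0
  have hκC : ∀ᶠ y in 𝓝 (0 : F), ContDiffAt ℝ ∞ κ y :=
    (htend.eventually hf).mono fun y hy => ContDiffAt.comp y hy hin.contDiffAt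
  have hκd : HasFDerivAt κ ((ContinuousLinearEquiv.refl ℝ F : F ≃L[ℝ] F) : F →L[ℝ] F) 0 := by
    have h1 : HasFDerivAt f (fderiv ℝ f x₀) (x₀ + A 0) := by
      rw [map_zero, add_zero]
      exact (hf.self_of_nhds.differentiableAt (by simp)).hasFDerivAt
    have h2 := h1.comp (0 : F) ((A.hasFDerivAt (x := (0 : F))).const_add x₀)
    rw [hA] at h2
    exact h2
  obtain ⟨g, hg0, hg⟩ := exists_smooth_localInverse hκC _ hκd
  rw [hκ0] at hg0 hg
  refine ⟨fun y => x₀ + A (g y), by simp [hg0], hg.mono fun y hy => ⟨?_, hy.2⟩⟩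
  exact hin.contDiffAt.comp y hy.1

/-- Linearly independent functionals are the components of a surjective map. -/
theorem surjective_of_linearIndependent {V ι : Type*} [AddCommGroup V] [Module ℝ V] [Fintype ι]
    {φ : ι → V →ₗ[ℝ] ℝ} (h : LinearIndependent ℝ φ) :
    Function.Surjective (LinearMap.pi φ : V →ₗ[ℝ] ι → ℝ) := by
  classical
  rw [← LinearMap.range_eq_top]
  by_contra hne
  obtain ⟨f, hf, hle⟩ := Submodule.exists_le_ker_of_lt_top _ (lt_top_iff_ne_top.2 hne)
  refine hf ?_
  have h1 : ∑ i, f (Pi.single i 1) • φ i = 0 := by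
    ext v
    have h2 : f (LinearMap.pi φ v) = 0 := hle ⟨v, rfl⟩
    have h3 : ∀ i : ι, (fun j => if i = j then (1 : ℝ) else 0) = Pi.single i 1 := fun i => by
      ext j; simp [Pi.single_apply, eq_comm]
    rw [LinearMap.pi_apply_eq_sum_univ] at h2
    simp only [h3] at h2
    simpa [mul_comm] using h2
  have h3 := Fintype.linearIndependent_iff.1 h _ h1
  ext i
  simpa using h3 i

end Inverse

namespace IntegrableSystem

variable {n : ℕ} {M : Type u} {O : Type v}
  [TopologicalSpace M] [ChartedSpace (Model n) M] [TopologicalSpace O]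
  {S : IntegrableSystem n M O}

/-! ### The joint flow of a moment map -/

/-- The combination `∑ τᵢ dFᵢ` of the differentials of the components of a moment map. -/
noncomputable def jointForm (F : Fin n → M → ℝ) (τ : Fin n → ℝ) : MForm n 1 M :=
  ∑ i, τ i • (MForm.ofFunction (F i) : MForm n 1 M)

theorem jointForm_apply (F : Fin n → M → ℝ) (τ : Fin n → ℝ) (p : M)
    (a : TangentSpace 𝓘(ℝ, Model n) p) :
    jointForm F τ p ![a] = ∑ i, τ i * differential (F i) p a := by
  have h : jointForm F τ p = ∑ i, τ i • (MForm.ofFunction (F i) : MForm n 1 M) p := by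
    unfold jointForm; rw [Finset.sum_apply]; rfl
  rw [h, ContinuousAlternatingMap.sum_apply]
  refine Finset.sum_congr rfl fun i _ => ?_
  rw [← MForm.ofFunction_apply]; rfl

theorem jointForm_add (F : Fin n → M → ℝ) (τ τ' : Fin n → ℝ) :
    jointForm F (τ + τ') = jointForm F τ + jointForm F τ' := by
  unfold jointForm
  rw [← Finset.sum_add_distrib]
  exact Finset.sum_congr rfl fun i _ => funext fun p => add_smul (τ i) (τ' i) _

theorem jointForm_smul (F : Fin n → M → ℝ) (s : ℝ) (τ : Fin n → ℝ) :
    jointForm F (s • τ) = s • jointForm F τ := by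
  unfold jointForm
  rw [Finset.smul_sum]
  exact Finset.sum_congr rfl fun i _ => funext fun p => mul_smul s (τ i) _

/-- The time-one flow of `∑ τᵢ dFᵢ`: the action of `τ ∈ ℝⁿ` by the commuting Hamiltonian flows of
the components of the moment map `F`. -/
noncomputable def jointFlow (S : IntegrableSystem n M O) (F : Fin n → M → ℝ) (τ : Fin n → ℝ)
    (p : M) : M := S.flow (jointForm F τ) 1 p

variable [IsManifold 𝓘(ℝ, Model n) ∞ M] [T2Space O]
variable {U : Opens O} {F : Fin n → M → ℝ}

theorem jointForm_mem_closedForms (hF : S.IsMomentMap U F) (τ : Fin n → ℝ) :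
    jointForm F τ ∈ S.closedForms U :=
  sum_mem fun i _ => smul_mem_closedForms _ (ofFunction_mem_closedForms hF i)

variable [T2Space M] [SecondCountableTopology M]

theorem π_jointFlow (hF : S.IsMomentMap U F) {p : M} (hp : S.π p ∈ U) (τ : Fin n → ℝ) :
    S.π (S.jointFlow F τ p) = S.π p :=
  π_flow (jointForm_mem_closedForms hF τ) hp 1

theorem π_jointFlow_mem (hF : S.IsMomentMap U F) {p : M} (hp : S.π p ∈ U) (τ : Fin n → ℝ) :
    S.π (S.jointFlow F τ p) ∈ U := by rw [π_jointFlow hF hp]; exact hp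

theorem jointFlow_add (hF : S.IsMomentMap U F) {p : M} (hp : S.π p ∈ U) (τ τ' : Fin n → ℝ) :
    S.jointFlow F (τ + τ') p = S.jointFlow F τ (S.jointFlow F τ' p) := by
  unfold jointFlow
  rw [jointForm_add, flow_add_form (jointForm_mem_closedForms hF τ)
    (jointForm_mem_closedForms hF τ') hp]

theorem jointFlow_smul (hF : S.IsMomentMap U F) {p : M} (hp : S.π p ∈ U) (s : ℝ) (τ : Fin n → ℝ) :
    S.jointFlow F (s • τ) p = S.flow (jointForm F τ) s p := by
  unfold jointFlow
  rw [jointForm_smul, flow_smul (jointForm_mem_closedForms hF τ) hp, one_mul]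

theorem jointFlow_zero (hF : S.IsMomentMap U F) {p : M} (hp : S.π p ∈ U) :
    S.jointFlow F 0 p = p := by
  have h := jointFlow_smul hF hp 0 0
  rwa [zero_smul, flow_zero (jointForm_mem_closedForms hF 0) hp] at h

theorem jointFlow_neg (hF : S.IsMomentMap U F) {p : M} (hp : S.π p ∈ U) (τ : Fin n → ℝ) :
    S.jointFlow F τ (S.jointFlow F (-τ) p) = p := by
  rw [← jointFlow_add hF hp, add_neg_cancel, jointFlow_zero hF hp]

theorem apply_jointFlow (hF : S.IsMomentMap U F) {p : M} (hp : S.π p ∈ U) (τ : Fin n → ℝ)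
    (i : Fin n) : F i (S.jointFlow F τ p) = F i p :=
  hF.apply_eq hp (π_jointFlow hF hp τ) i

theorem contMDiffAt_jointFlow (hF : S.IsMomentMap U F) {p : M} (hp : S.π p ∈ U) (τ : Fin n → ℝ) :
    ContMDiffAt (𝓘(ℝ, Fin n → ℝ).prod 𝓘(ℝ, Model n)) 𝓘(ℝ, Model n) ∞
      (fun x : (Fin n → ℝ) × M => S.jointFlow F x.1 x.2) (τ, p) := by
  have hmem : ∀ (s : Finset (Fin n)) (τ : Fin n → ℝ),
      ∑ i ∈ s, τ i • (MForm.ofFunction (F i) : MForm n 1 M) ∈ S.closedForms U :=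
    fun s τ => sum_mem fun i _ => smul_mem_closedForms _ (ofFunction_mem_closedForms hF i)
  have key : ∀ s : Finset (Fin n), ContMDiffAt (𝓘(ℝ, Fin n → ℝ).prod 𝓘(ℝ, Model n)) 𝓘(ℝ, Model n) ∞
      (fun x : (Fin n → ℝ) × M =>
        S.flow (∑ i ∈ s, x.1 i • (MForm.ofFunction (F i) : MForm n 1 M)) 1 x.2) (τ, p) := by
    intro s
    induction s using Finset.induction_on with
    | empty => simpa only [Finset.sum_empty, flow_zero_form] using contMDiffAt_snd
    | insert a s ha ih =>
      have hev : ∀ᶠ x : (Fin n → ℝ) × M in 𝓝 (τ, p), x.2 ∈ S.π ⁻¹' U :=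
        continuous_snd.continuousAt.eventually ((S.isOpen_preimage U).mem_nhds hp)
      have h1 : ContMDiffAt (𝓘(ℝ, Fin n → ℝ).prod 𝓘(ℝ, Model n)) 𝓘(ℝ, ℝ) ∞
          (fun x : (Fin n → ℝ) × M => x.1 a) (τ, p) :=
        ContMDiffAt.comp (g := fun y : Fin n → ℝ => y a) (τ, p)
          (contDiff_apply ℝ ℝ a).contMDiff.contMDiffAt contMDiffAt_fst
      have h2 := ContMDiffAt.comp (τ, p) (g := fun x : ℝ × M =>
          S.flow (MForm.ofFunction (F a) : MForm n 1 M) x.1 x.2)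
        (contMDiffAt_flow (ofFunction_mem_closedForms hF a) (π_flow_mem (hmem s τ) hp 1) (τ a))
        (h1.prodMk ih)
      refine h2.congr_of_eventuallyEq ?_
      filter_upwards [hev] with x hx
      rw [Finset.sum_insert ha, flow_add_form (smul_mem_closedForms _
        (ofFunction_mem_closedForms hF a)) (hmem s x.1) hx,
        flow_smul (ofFunction_mem_closedForms hF a) (π_flow_mem (hmem s x.1) hx 1), one_mul]
      rfl
  exact key Finset.univ

theorem contMDiffAt_jointFlow_right (hF : S.IsMomentMap U F) {p : M} (hp : S.π p ∈ U)
    (τ : Fin n → ℝ) : ContMDiffAt 𝓘(ℝ, Model n) 𝓘(ℝ, Model n) ∞ (S.jointFlow F τ) p :=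
  contMDiffAt_flow_right (jointForm_mem_closedForms hF τ) hp 1

end IntegrableSystem

/-! ### Flow coordinates at regular points -/

section ManifoldInverse

variable {R E : Type*} [NormedAddCommGroup R] [NormedSpace ℝ R] [NormedAddCommGroup E]
  [NormedSpace ℝ E] {M : Type*} [TopologicalSpace M] [ChartedSpace E M] [IsManifold 𝓘(ℝ, E) ∞ M]

omit [IsManifold 𝓘(ℝ, E) ∞ M] in
theorem ContMDiffAt.comp_section {Φ : R × M → M} {σ : R → M} {z : R × R}
    (hΦ : ContMDiffAt (𝓘(ℝ, R).prod 𝓘(ℝ, E)) 𝓘(ℝ, E) ∞ Φ (z.1, σ z.2))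
    (hσ : ContMDiffAt 𝓘(ℝ, R) 𝓘(ℝ, E) ∞ σ z.2) :
    ContMDiffAt 𝓘(ℝ, R × R) 𝓘(ℝ, E) ∞ (fun z : R × R => Φ (z.1, σ z.2)) z := by
  have h1 : ContMDiffAt 𝓘(ℝ, R × R) 𝓘(ℝ, R) ∞ (fun z : R × R => z.1) z :=
    contDiffAt_fst.contMDiffAt
  have h2 : ContMDiffAt 𝓘(ℝ, R × R) 𝓘(ℝ, R) ∞ (fun z : R × R => z.2) z :=
    contDiffAt_snd.contMDiffAt
  exact ContMDiffAt.comp (g := Φ) z hΦ (h1.prodMk (ContMDiffAt.comp z hσ h2))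

theorem ContMDiffAt.contDiffAt_extChartAt_comp {J : R → M} {z : R} {q : M}
    (hJ : ContMDiffAt 𝓘(ℝ, R) 𝓘(ℝ, E) ∞ J z) (hz : J z ∈ (extChartAt 𝓘(ℝ, E) q).source) :
    ContDiffAt ℝ ∞ (fun z => extChartAt 𝓘(ℝ, E) q (J z)) z := by
  rw [← contMDiffAt_iff_contDiffAt]
  exact ContMDiffAt.comp z (contMDiffAt_extChartAt' (by
    rwa [← extChartAt_source (I := 𝓘(ℝ, E))])) hJ

theorem exists_smooth_localInverse_manifold [FiniteDimensional ℝ R] [FiniteDimensional ℝ E]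
    {J : R → M} {z₀ : R} (hJ : ∀ᶠ z in 𝓝 z₀, ContMDiffAt 𝓘(ℝ, R) 𝓘(ℝ, E) ∞ J z)
    (hdim : Module.finrank ℝ R = Module.finrank ℝ E)
    (hinj : ∀ v, fderiv ℝ (fun z => extChartAt 𝓘(ℝ, E) (J z₀) (J z)) z₀ v = 0 → v = 0) :
    ∃ g : M → R, g (J z₀) = z₀ ∧ ∀ᶠ r in 𝓝 (J z₀), ContMDiffAt 𝓘(ℝ, E) 𝓘(ℝ, R) ∞ g r ∧
      J (g r) = r := by
  set q := J z₀ with hq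
  have hJs : ∀ᶠ z in 𝓝 z₀, J z ∈ (extChartAt 𝓘(ℝ, E) q).source :=
    hJ.self_of_nhds.continuousAt.eventually (extChartAt_source_mem_nhds (I := 𝓘(ℝ, E)) q)
  have hΘC : ∀ᶠ z in 𝓝 z₀, ContDiffAt ℝ ∞ (fun z => extChartAt 𝓘(ℝ, E) q (J z)) z := by
    filter_upwards [hJ, hJs] with z h1 h2 using h1.contDiffAt_extChartAt_comp h2
  obtain ⟨g, hg0, hg⟩ := exists_smooth_localInverse_of_injective hΘC hdim hinj
  have hgtend : Tendsto g (𝓝 (extChartAt 𝓘(ℝ, E) q q)) (𝓝 z₀) := by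
    have := hg.self_of_nhds.1.continuousAt
    rwa [ContinuousAt, hg0] at this
  have hχtend : Tendsto (extChartAt 𝓘(ℝ, E) q) (𝓝 q) (𝓝 (extChartAt 𝓘(ℝ, E) q q)) :=
    continuousAt_extChartAt q
  refine ⟨fun r => g (extChartAt 𝓘(ℝ, E) q r), hg0, ?_⟩
  filter_upwards [hχtend.eventually hg, (hgtend.comp hχtend).eventually hJs,
    extChartAt_source_mem_nhds (I := 𝓘(ℝ, E)) q] with r h1 h2 h4
  refine ⟨?_, (extChartAt 𝓘(ℝ, E) q).injOn h2 h4 h1.2⟩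
  exact ContMDiffAt.comp r h1.1.contMDiffAt (contMDiffAt_extChartAt' (by
    rwa [← extChartAt_source (I := 𝓘(ℝ, E))]))

end ManifoldInverse

namespace IntegrableSystem

variable {n : ℕ} {M : Type u} {O : Type v}
  [TopologicalSpace M] [ChartedSpace (Model n) M] [TopologicalSpace O]
  {S : IntegrableSystem n M O}
variable [IsManifold 𝓘(ℝ, Model n) ∞ M] [T2Space O]
variable {U : Opens O} {F : Fin n → M → ℝ}
variable [T2Space M] [SecondCountableTopology M]

omit [T2Space O] [T2Space M] [SecondCountableTopology M] in
theorem surjective_fderiv_momentMap (hF : S.IsMomentMap U F) {q : M} (hq : S.π q ∈ U)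
    (hind : LinearIndependent ℝ fun i : Fin n => differential (n := n) (F i) q) :
    Function.Surjective (fderiv ℝ (fun e i => F i ((extChartAt 𝓘(ℝ, Model n) q).symm e))
      (extChartAt 𝓘(ℝ, Model n) q q)) := by
  have hqs := mem_extChartAt_source (I := 𝓘(ℝ, Model n)) q
  have hmem := MForm.mem_chartDomain (A := S.π ⁻¹' U) hqs hq
  intro y
  obtain ⟨v, hv⟩ := surjective_of_linearIndependent
    (φ := fun i : Fin n => (differential (n := n) (F i) q).toLinearMap)
    (hind.map' (ContinuousLinearMap.coeLM ℝ) (by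
      rw [LinearMap.ker_eq_bot]; exact ContinuousLinearMap.coe_injective)) y
  let a : Model n := mfderiv 𝓘(ℝ, Model n) 𝓘(ℝ, Model n) (extChartAt 𝓘(ℝ, Model n) q) q v
  refine ⟨a, ?_⟩
  rw [fderiv_pi fun i => (MForm.contDiffAt_comp_symm (S.isOpen_preimage U) (hF.smooth i)
    hmem).differentiableAt (by simp)]
  ext i
  rw [ContinuousLinearMap.pi_apply, ← MForm.oneFormEquiv_ofFunction_inChart (S.isOpen_preimage U)
    (hF.smooth i) hmem, oneFormEquiv_apply]
  rw [← hv]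
  refine (MForm.inChart_apply_one _ hqs v).trans ?_
  rw [MForm.ofFunction_apply]
  rfl

omit [T2Space O] [T2Space M] [SecondCountableTopology M] in
/-- A moment map has a local section through each regular point. -/
theorem exists_momentMap_section (hF : S.IsMomentMap U F) {q : M} (hq : S.π q ∈ U)
    (hind : LinearIndependent ℝ fun i : Fin n => differential (n := n) (F i) q) :
    ∃ σ : (Fin n → ℝ) → M, σ (fun i => F i q) = q ∧
      ∀ᶠ c in 𝓝 (fun i => F i q), ContMDiffAt 𝓘(ℝ, Fin n → ℝ) 𝓘(ℝ, Model n) ∞ σ c ∧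
        S.π (σ c) ∈ U ∧ (fun i => F i (σ c)) = c := by
  have hqs := mem_extChartAt_source (I := 𝓘(ℝ, Model n)) q
  have hmem := MForm.mem_chartDomain (A := S.π ⁻¹' U) hqs hq
  have hUo := S.isOpen_preimage U
  have hqsym : (extChartAt 𝓘(ℝ, Model n) q).symm (extChartAt 𝓘(ℝ, Model n) q q) = q :=
    (extChartAt 𝓘(ℝ, Model n) q).left_inv hqs
  have hfC : ∀ᶠ e in 𝓝 (extChartAt 𝓘(ℝ, Model n) q q), ContDiffAt ℝ ∞
      (fun e i => F i ((extChartAt 𝓘(ℝ, Model n) q).symm e)) e := by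
    filter_upwards [(MForm.isOpen_chartDomain hUo q).mem_nhds hmem] with e he
    exact contDiffAt_pi.2 fun i => MForm.contDiffAt_comp_symm hUo (hF.smooth i) he
  obtain ⟨s, hs0, hs⟩ := exists_smooth_localSection hfC (surjective_fderiv_momentMap hF hq hind)
  rw [hqsym] at hs0 hs
  have hstend : Tendsto s (𝓝 fun i => F i q) (𝓝 (extChartAt 𝓘(ℝ, Model n) q q)) := by
    have := hs.self_of_nhds.1.continuousAt
    rwa [ContinuousAt, hs0] at this
  refine ⟨fun c => (extChartAt 𝓘(ℝ, Model n) q).symm (s c), by simp only [hs0, hqsym], ?_⟩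
  filter_upwards [hs, hstend.eventually ((MForm.isOpen_chartDomain hUo q).mem_nhds hmem)]
    with c hc hc'
  exact ⟨ContMDiffAt.comp c (contMDiffAt_extChartAt_symm hc'.1) hc.1.contMDiffAt, hc'.2, hc.2⟩

/-- The infinitesimal action of the joint flow at a regular point is injective. -/
theorem eq_zero_of_hasDerivAt_jointFlow (hF : S.IsMomentMap U F) {q : M} (hq : S.π q ∈ U)
    (hind : LinearIndependent ℝ fun i : Fin n => differential (n := n) (F i) q) {τ : Fin n → ℝ}
    (h : HasDerivAt (fun t : ℝ => extChartAt 𝓘(ℝ, Model n) q (S.jointFlow F (t • τ) q)) 0 0) :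
    τ = 0 := by
  have hqs := mem_extChartAt_source (I := 𝓘(ℝ, Model n)) q
  have hβ := jointForm_mem_closedForms hF τ
  have hflow0 : S.flow (jointForm F τ) 0 q = q := flow_zero hβ hq
  have hcurve' := HasMFDerivAt.hasDerivAt_extChartAt (V := S.dual (jointForm F τ)) (q₀ := q)
    (γ := fun t => S.flow (jointForm F τ) t q) (t := 0) (by rw [hflow0]; exact hqs)
    (isMIntegralCurve_flow hβ hq 0)
  simp only [jointFlow_smul hF hq] at h
  have h0 := hcurve'.unique h
  simp only [hflow0] at h0
  have hd : S.dual (jointForm F τ) q = 0 := by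
    have h1 := mfderiv_extChartAt_symm_chartField (V := S.dual (jointForm F τ))
      ((extChartAt 𝓘(ℝ, Model n) q).map_source hqs)
    let A : Model n →L[ℝ] Model n := mfderiv 𝓘(ℝ, Model n) 𝓘(ℝ, Model n)
      (extChartAt 𝓘(ℝ, Model n) q).symm (extChartAt 𝓘(ℝ, Model n) q q)
    have h3 := ((congrArg A h0).trans (map_zero A)).symm.trans h1
    have h2 : ∀ q', q' = q → (0 : Model n) = S.dual (jointForm F τ) q' →
        S.dual (jointForm F τ) q = 0 := by
      rintro q' rfl h; exact h.symm
    exact h2 _ ((extChartAt 𝓘(ℝ, Model n) q).left_inv hqs) h3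
  have hsum : ∑ i, τ i • differential (n := n) (F i) q = 0 := by
    refine ContinuousLinearMap.ext fun a => ?_
    have h1 := S.form_dual (jointForm F τ) q a
    rw [hd, form_zero_left, jointForm_apply] at h1
    rw [_root_.sum_apply]
    exact h1.symm
  exact funext (Fintype.linearIndependent_iff.1 hind τ hsum)

/-- Coordinates adapted to the joint flow at a regular point `q` of a moment map: a local section
`σ` of the moment map and a function `τ` such that `r` is obtained from the point of the section
with the same values of the moment map by the joint flow at time `τ r`. -/
theorem exists_flowCoordinates (hF : S.IsMomentMap U F) {q : M} (hq : S.π q ∈ U)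
    (hind : LinearIndependent ℝ fun i : Fin n => differential (n := n) (F i) q) :
    ∃ (σ : (Fin n → ℝ) → M) (τ : M → Fin n → ℝ), σ (fun i => F i q) = q ∧ τ q = 0 ∧
      (∀ᶠ c in 𝓝 (fun i => F i q), ContMDiffAt 𝓘(ℝ, Fin n → ℝ) 𝓘(ℝ, Model n) ∞ σ c ∧
        S.π (σ c) ∈ U ∧ (fun i => F i (σ c)) = c) ∧
      ∀ᶠ r in 𝓝 q, ContMDiffAt 𝓘(ℝ, Model n) 𝓘(ℝ, Fin n → ℝ) ∞ τ r ∧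
        S.jointFlow F (τ r) (σ fun i => F i r) = r := by
  have hqs := mem_extChartAt_source (I := 𝓘(ℝ, Model n)) q
  have hmem := MForm.mem_chartDomain (A := S.π ⁻¹' U) hqs hq
  have hUo := S.isOpen_preimage U
  obtain ⟨σ, hσ0, hσ⟩ := exists_momentMap_section hF hq hind
  obtain ⟨c₀, hc₀⟩ : ∃ c₀ : Fin n → ℝ, c₀ = fun i => F i q := ⟨_, rfl⟩
  rw [← hc₀] at hσ0 hσ ⊢
  obtain ⟨z₀, hz₀⟩ : ∃ z₀ : (Fin n → ℝ) × (Fin n → ℝ), z₀ = (0, c₀) := ⟨_, rfl⟩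
  obtain ⟨J, hJ⟩ : ∃ J : (Fin n → ℝ) × (Fin n → ℝ) → M, J = fun z => S.jointFlow F z.1 (σ z.2) :=
    ⟨_, rfl⟩
  have hJ0 : J z₀ = q := by simp only [hJ, hz₀, hσ0, jointFlow_zero hF hq]
  have hsnd : Tendsto (fun z : (Fin n → ℝ) × (Fin n → ℝ) => z.2) (𝓝 z₀) (𝓝 c₀) := by
    rw [hz₀]; exact continuous_snd.continuousAt
  have hJC : ∀ᶠ z in 𝓝 z₀, ContMDiffAt 𝓘(ℝ, (Fin n → ℝ) × (Fin n → ℝ)) 𝓘(ℝ, Model n) ∞ J z := by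
    filter_upwards [hsnd.eventually hσ] with z hz
    rw [hJ]
    exact ContMDiffAt.comp_section (Φ := fun x : (Fin n → ℝ) × M => S.jointFlow F x.1 x.2)
      (contMDiffAt_jointFlow hF hz.2.1 z.1) hz.1
  have hFJ : ∀ᶠ z in 𝓝 z₀, (fun i => F i (J z)) = z.2 := by
    filter_upwards [hsnd.eventually hσ] with z hz
    conv_rhs => rw [← hz.2.2]
    funext i
    rw [hJ]
    exact apply_jointFlow hF hz.2.1 z.1 i
  have hJs : ∀ᶠ z in 𝓝 z₀, J z ∈ (extChartAt 𝓘(ℝ, Model n) q).source := by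
    refine hJC.self_of_nhds.continuousAt.eventually ?_
    rw [hJ0]
    exact extChartAt_source_mem_nhds (I := 𝓘(ℝ, Model n)) q
  obtain ⟨Θ, hΘ⟩ : ∃ Θ : (Fin n → ℝ) × (Fin n → ℝ) → Model n,
    Θ = fun z => extChartAt 𝓘(ℝ, Model n) q (J z) := ⟨_, rfl⟩
  have hΘd : HasFDerivAt Θ (fderiv ℝ Θ z₀) z₀ := by
    have h1 : ContDiffAt ℝ ∞ Θ z₀ := by
      rw [hΘ]; exact hJC.self_of_nhds.contDiffAt_extChartAt_comp hJs.self_of_nhds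
    exact (h1.differentiableAt (by simp)).hasFDerivAt
  -- In the kernel of the differential of `(τ, c) ↦ Φ^τ(σ(c))`, the component `y` vanishes because
  -- the moment map recovers `c`, and then `τ` because the infinitesimal action is injective.
  have hinj : ∀ v, fderiv ℝ Θ z₀ v = 0 → v = 0 := by
    rintro ⟨τ, y⟩ hv
    have hy : y = 0 := by
      obtain ⟨f, hf⟩ : ∃ f : Model n → Fin n → ℝ,
        f = fun e i => F i ((extChartAt 𝓘(ℝ, Model n) q).symm e) := ⟨_, rfl⟩
      have h1 : (fun z => f (Θ z)) =ᶠ[𝓝 z₀] fun z => z.2 := by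
        filter_upwards [hJs, hFJ] with z h1 h2
        rw [← h2]
        simp only [hf, hΘ, (extChartAt 𝓘(ℝ, Model n) q).left_inv h1]
      have h2 : HasFDerivAt f (fderiv ℝ f (Θ z₀)) (Θ z₀) := by
        have h3 : ContDiffAt ℝ ∞ f (Θ z₀) := by
          rw [hf, hΘ]
          simp only [hJ0]
          exact contDiffAt_pi.2 fun i => MForm.contDiffAt_comp_symm hUo (hF.smooth i) hmem
        exact (h3.differentiableAt (by simp)).hasFDerivAt
      have h3 := (h2.comp z₀ hΘd).congr_of_eventuallyEq h1.symm
      have h4 := congrArg (fun A => A (τ, y)) (h3.unique hasFDerivAt_snd)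
      simp only [ContinuousLinearMap.comp_apply, hv, map_zero] at h4
      exact h4.symm
    subst hy
    have hτ : τ = 0 := by
      refine eq_zero_of_hasDerivAt_jointFlow hF hq hind ?_
      have h1 : HasDerivAt (fun t : ℝ => (t • τ, c₀)) ((1 : ℝ) • τ, (0 : Fin n → ℝ)) 0 :=
        ((hasDerivAt_id (0 : ℝ)).smul_const τ).prodMk (hasDerivAt_const _ _)
      have h2 : HasFDerivAt Θ (fderiv ℝ Θ z₀) ((0 : ℝ) • τ, c₀) := by
        rw [zero_smul, ← hz₀]; exact hΘd
      have h3 := HasFDerivAt.comp_hasDerivAt (l := Θ) (f := fun t : ℝ => (t • τ, c₀)) (0 : ℝ) h2 h1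
      rw [one_smul, hv] at h3
      have heq : (Θ ∘ fun t : ℝ => (t • τ, c₀)) =
          fun t : ℝ => extChartAt 𝓘(ℝ, Model n) q (S.jointFlow F (t • τ) q) := by
        funext t
        simp only [hΘ, hJ, Function.comp_apply, hσ0]
      rwa [heq] at h3
    rw [hτ]
    rfl
  obtain ⟨g, hg0, hg⟩ := exists_smooth_localInverse_manifold hJC (by simp [two_mul]) (by
    rw [hJ0, ← hΘ]; exact hinj)
  rw [hJ0] at hg0 hg
  have hgtend : Tendsto g (𝓝 q) (𝓝 z₀) := by
    have := hg.self_of_nhds.1.continuousAt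
    rwa [ContinuousAt, hg0] at this
  refine ⟨σ, fun r => (g r).1, hσ0, by simp only [hg0, hz₀], hσ, ?_⟩
  filter_upwards [hg, hgtend.eventually hFJ] with r h1 h3
  refine ⟨?_, ?_⟩
  · have h5 : ContMDiffAt 𝓘(ℝ, (Fin n → ℝ) × (Fin n → ℝ)) 𝓘(ℝ, Fin n → ℝ) ∞
        (fun z : (Fin n → ℝ) × (Fin n → ℝ) => z.1) (g r) := contDiffAt_fst.contMDiffAt
    exact ContMDiffAt.comp r h5 h1.1
  · rw [h1.2] at h3
    rw [h3]
    have h4 := h1.2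
    rw [hJ] at h4
    exact h4

end IntegrableSystem

namespace IntegrableSystem

/-! ### Regular fibers -/

variable {n : ℕ} {M : Type u} {O : Type v}
  [TopologicalSpace M] [ChartedSpace (Model n) M] [TopologicalSpace O]
  {S : IntegrableSystem n M O}

theorem exists_linearIndependent_of_rank {p : M} (h : ¬ S.rank p < n) :
    ∃ U : Opens O, S.π p ∈ U ∧ ∃ F : Fin n → M → ℝ, S.IsMomentMap U F ∧
      LinearIndependent ℝ fun i : Fin n => differential (n := n) (F i) p := by
  unfold rank at h
  set A : Set ℕ := {r | ∃ U : Opens O, S.π p ∈ U ∧ ∃ F : Fin n → M → ℝ, S.IsMomentMap U F ∧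
    r = Module.finrank ℝ (Submodule.span ℝ (range fun i : Fin n =>
      differential (n := n) (F i) p))} with hA
  have hne : A.Nonempty := by
    obtain ⟨U, hU, F, hF⟩ := S.exists_momentMap (S.π p)
    exact ⟨_, U, hU, F, hF, rfl⟩
  have hbdd : BddAbove A := by
    refine ⟨n, ?_⟩
    rintro _ ⟨U, hU, F, hF, rfl⟩
    exact (finrank_range_le_card _).trans (by simp)
  obtain ⟨U, hU, F, hF, hr⟩ := Nat.sSup_mem hne hbdd
  refine ⟨U, hU, F, hF, linearIndependent_iff_card_le_finrank_span.2 ?_⟩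
  rw [Fintype.card_fin]
  exact (not_lt.1 h).trans hr.le

variable [IsManifold 𝓘(ℝ, Model n) ∞ M] [T2Space O] [T2Space M] [SecondCountableTopology M]
variable {U : Opens O} {F : Fin n → M → ℝ}

/-- The flows of sections of `𝒵¹` preserve the rank of a moment map. -/
theorem linearIndependent_flow (hF : S.IsMomentMap U F) {V : Opens O} {β : MForm n 1 M}
    (hβ : β ∈ S.closedForms V) {p : M} (hpU : S.π p ∈ U) (hpV : S.π p ∈ V)
    (h : LinearIndependent ℝ fun i : Fin n => differential (n := n) (F i) p) (t : ℝ) :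
    LinearIndependent ℝ fun i : Fin n => differential (n := n) (F i) (S.flow β t p) := by
  rw [Fintype.linearIndependent_iff] at h ⊢
  intro c hc
  refine h c (ContinuousLinearMap.ext fun a => ?_)
  have h1 := congrArg (fun A => A (mfderiv 𝓘(ℝ, Model n) 𝓘(ℝ, Model n) (S.flow β t) p a)) hc
  simp only [_root_.sum_apply] at h1 ⊢
  refine Eq.trans (Finset.sum_congr rfl fun i _ => ?_) h1
  have h2 := oneForm_mfderiv_flow (S.closedForms_mono (inf_le_right : U ⊓ V ≤ V) hβ)
    (S.closedForms_mono (inf_le_left : U ⊓ V ≤ U) (ofFunction_mem_closedForms hF i))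
    (p := p) ⟨hpU, hpV⟩ t a
  rw [MForm.ofFunction_apply, MForm.ofFunction_apply] at h2
  exact congrArg (c i * ·) h2.symm

/-- Near a regular point of a moment map, the fiber is an orbit of the joint flow. -/
theorem eventually_mem_orbit (hF : S.IsMomentMap U F) {q : M} (hq : S.π q ∈ U)
    (hind : LinearIndependent ℝ fun i : Fin n => differential (n := n) (F i) q) :
    ∀ᶠ r in 𝓝 q, S.π r = S.π q → ∃ τ, S.jointFlow F τ q = r := by
  obtain ⟨σ, τ, hσ, -, -, hτ⟩ := exists_flowCoordinates hF hq hind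
  filter_upwards [hτ] with r hr hπ
  refine ⟨τ r, ?_⟩
  have h1 : (fun i => F i r) = fun i => F i q := funext fun i => hF.apply_eq hq hπ i
  have h2 := hr.2
  rwa [h1, hσ] at h2

/-- If all points of the fiber are regular points of some moment map, then a moment map that is
regular at one point of the fiber is regular at all of them: the orbits of the joint flows are open
in the fiber, which is connected. -/
theorem linearIndependent_of_not_isSingular (hF : S.IsMomentMap U F) {p₀ : M} (hp₀ : S.π p₀ ∈ U)
    (hx : ¬ S.IsSingular (S.π p₀))
    (hind : LinearIndependent ℝ fun i : Fin n => differential (n := n) (F i) p₀) {p : M}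
    (hp : S.π p = S.π p₀) :
    LinearIndependent ℝ fun i : Fin n => differential (n := n) (F i) p := by
  have hpre := hF.isPreconnected_fiber hp₀
  have key := hpre.induction₂' (fun p r : M =>
    (LinearIndependent ℝ fun i : Fin n => differential (n := n) (F i) p) →
      LinearIndependent ℝ fun i : Fin n => differential (n := n) (F i) r)
    (fun q hq => ?_) (fun _ _ _ _ _ _ h1 h2 h => h2 (h1 h)) (x := p₀) (y := p) rfl hp
  · exact key hind
  · have hqπ : S.π q = S.π p₀ := hq
    obtain ⟨V, hV, G, hG, hGi⟩ := exists_linearIndependent_of_rank (S := S) (p := q)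
      (fun h => hx ⟨q, hq, h⟩)
    rw [eventually_nhdsWithin_iff]
    filter_upwards [eventually_mem_orbit hG hV hGi] with r hr hrf
    have hrπ : S.π r = S.π q := Eq.trans hrf hqπ.symm
    obtain ⟨τ, rfl⟩ := hr hrπ
    refine ⟨fun h => linearIndependent_flow hF (jointForm_mem_closedForms hG τ)
      (by rw [hqπ]; exact hp₀) hV h 1, fun h => ?_⟩
    have h1 := linearIndependent_flow hF (jointForm_mem_closedForms hG (-τ))
      (by rw [hrπ, hqπ]; exact hp₀) (by rw [hrπ]; exact hV) h 1
    have h2 : S.flow (jointForm G (-τ)) 1 (S.jointFlow G τ q) = q := by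
      have := jointFlow_neg hG hV (-τ)
      rwa [neg_neg] at this
    rwa [h2] at h1

/-- A regular fiber is a single orbit of the joint flow. -/
theorem exists_jointFlow_eq (hF : S.IsMomentMap U F) {p₀ : M} (hp₀ : S.π p₀ ∈ U)
    (hind : ∀ p, S.π p = S.π p₀ → LinearIndependent ℝ fun i : Fin n =>
      differential (n := n) (F i) p) {p : M} (hp : S.π p = S.π p₀) :
    ∃ τ, S.jointFlow F τ p₀ = p := by
  have hpre := hF.isPreconnected_fiber hp₀
  have hsymm : ∀ q r : M, S.π q ∈ U → (∃ τ, S.jointFlow F τ q = r) →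
      ∃ τ, S.jointFlow F τ r = q := by
    rintro q r hq ⟨τ, rfl⟩
    refine ⟨-τ, ?_⟩
    have := jointFlow_neg hF hq (-τ)
    rwa [neg_neg] at this
  refine hpre.induction₂' (fun p r : M => ∃ τ, S.jointFlow F τ p = r)
    (fun q hq => ?_) (fun p q r hp _ _ h1 h2 => ?_) (x := p₀) (y := p) rfl hp
  · have hqπ : S.π q = S.π p₀ := hq
    have hqU : S.π q ∈ U := by rw [hqπ]; exact hp₀
    rw [eventually_nhdsWithin_iff]
    filter_upwards [eventually_mem_orbit hF hqU (hind q hqπ)] with r hr hrf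
    have hrπ : S.π r = S.π q := Eq.trans hrf hqπ.symm
    exact ⟨hr hrπ, hsymm q r hqU (hr hrπ)⟩
  · obtain ⟨τ, rfl⟩ := h1
    obtain ⟨τ', rfl⟩ := h2
    have hpπ : S.π p = S.π p₀ := hp
    exact ⟨τ' + τ, jointFlow_add hF (by rw [hpπ]; exact hp₀) τ' τ⟩

/-- Symplectic maps that preserve the fibers commute with the flows of the moment maps. -/
theorem comp_jointFlow_eq (hF : S.IsMomentMap U F) {g : M → M}
    (hg : ContMDiffOn 𝓘(ℝ, Model n) 𝓘(ℝ, Model n) ∞ g (S.π ⁻¹' U))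
    (hsymp : ∀ p ∈ S.π ⁻¹' U, ∀ a b : TangentSpace 𝓘(ℝ, Model n) p,
      S.form (g p) ![mfderiv 𝓘(ℝ, Model n) 𝓘(ℝ, Model n) g p a,
        mfderiv 𝓘(ℝ, Model n) 𝓘(ℝ, Model n) g p b] = S.form p ![a, b])
    (hπ : ∀ p ∈ S.π ⁻¹' U, S.π (g p) = S.π p) {p : M} (hp : S.π p ∈ U) (τ : Fin n → ℝ) :
    g (S.jointFlow F τ p) = S.jointFlow F τ (g p) := by
  have hβ := jointForm_mem_closedForms hF τ
  have hgd : ∀ q ∈ S.π ⁻¹' U, MDifferentiableAt 𝓘(ℝ, Model n) 𝓘(ℝ, Model n) g q := fun q hq =>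
    (hg.contMDiffAt ((S.isOpen_preimage U).mem_nhds hq)).mdifferentiableAt (by simp)
  have hgU : ∀ q ∈ S.π ⁻¹' U, S.π (g q) ∈ U := fun q hq => by rw [hπ q hq]; exact hq
  have hFg : ∀ q ∈ S.π ⁻¹' U, ∀ i, ∀ b : TangentSpace 𝓘(ℝ, Model n) q,
      differential (F i) (g q) (mfderiv 𝓘(ℝ, Model n) 𝓘(ℝ, Model n) g q b) =
        differential (F i) q b := by
    intro q hq i b
    have h1 := (hF.mdifferentiableAt (hgU q hq) i).hasMFDerivAt.comp q (hgd q hq).hasMFDerivAt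
    have h2 : (F i ∘ g) =ᶠ[𝓝 q] F i := by
      filter_upwards [(S.isOpen_preimage U).mem_nhds hq] with r hr
      exact hF.apply_eq hr (hπ r hr) i
    have h3 := (h1.congr_of_eventuallyEq h2.symm).mfderiv
    exact (congrArg (fun A => A b) h3).symm
  have hdual : ∀ q ∈ S.π ⁻¹' U, mfderiv 𝓘(ℝ, Model n) 𝓘(ℝ, Model n) g q
      (S.dual (jointForm F τ) q) = S.dual (jointForm F τ) (g q) := by
    intro q hq
    refine S.eq_dual fun b => ?_
    obtain ⟨b, rfl⟩ := surjective_of_form_eq (S := S) _ (hsymp q hq) b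
    rw [hsymp q hq, S.form_dual, jointForm_apply, jointForm_apply]
    exact Finset.sum_congr rfl fun i _ => by rw [hFg q hq]
  refine eq_flow (γ := fun t => g (S.flow (jointForm F τ) t p)) hβ (fun t => ?_) (fun t => ?_) ?_ 1
  · have hq := π_flow_mem hβ hp t
    have := HasMFDerivAt.comp_curve (g := g) (γ := fun t => S.flow (jointForm F τ) t p)
      (hgd _ hq) (isMIntegralCurve_flow hβ hp t)
    rw [hdual _ hq] at this
    exact this
  · exact hgU _ (π_flow_mem hβ hp t)
  · simp only [flow_zero hβ hp]

omit [IsManifold 𝓘(ℝ, Model n) ∞ M] [T2Space M] [SecondCountableTopology M] in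
theorem mfderiv_eq_of_hasMFDerivAt_line {Φ : (Fin n → ℝ) → M} {τ w : Fin n → ℝ}
    (hd : MDifferentiableAt 𝓘(ℝ, Fin n → ℝ) 𝓘(ℝ, Model n) Φ τ) {v : Model n}
    (h : HasMFDerivAt 𝓘(ℝ, ℝ) 𝓘(ℝ, Model n) (fun s : ℝ => Φ (s • w + τ)) 0
      ((1 : ℝ →L[ℝ] ℝ).smulRight v : ℝ →L[ℝ] Model n)) :
    (mfderiv 𝓘(ℝ, Fin n → ℝ) 𝓘(ℝ, Model n) Φ τ : (Fin n → ℝ) →L[ℝ] Model n) w = v := by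
  obtain ⟨c, hc⟩ : ∃ c : ℝ → Fin n → ℝ, c = fun s => s • w + τ := ⟨_, rfl⟩
  have hc0 : c 0 = τ := by simp [hc]
  have hcd : HasMFDerivAt 𝓘(ℝ, ℝ) 𝓘(ℝ, Fin n → ℝ) c 0 ((1 : ℝ →L[ℝ] ℝ).smulRight w) := by
    have h1 : HasDerivAt c ((1 : ℝ) • w) 0 := by
      rw [hc]; exact ((hasDerivAt_id (0 : ℝ)).smul_const w).add_const τ
    rw [one_smul] at h1
    exact h1.hasFDerivAt.hasMFDerivAt
  have h' : HasMFDerivAt 𝓘(ℝ, ℝ) 𝓘(ℝ, Model n) (Φ ∘ c) 0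
      ((1 : ℝ →L[ℝ] ℝ).smulRight v : ℝ →L[ℝ] Model n) := by rw [hc]; exact h
  subst hc0
  have h3 := hasMFDerivAt_unique (hd.hasMFDerivAt.comp 0 hcd) h'
  have h4 := congrArg (fun A : ℝ →L[ℝ] Model n => A 1) h3
  refine Eq.trans ?_ (h4.trans (one_smul ℝ v))
  exact (congrArg (mfderiv 𝓘(ℝ, Fin n → ℝ) 𝓘(ℝ, Model n) Φ (c 0)) (one_smul ℝ w)).symm

/-- The infinitesimal generators of the joint flow. -/
theorem mfderiv_jointFlow_left (hF : S.IsMomentMap U F) {p : M} (hp : S.π p ∈ U)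
    (τ w : Fin n → ℝ) :
    mfderiv 𝓘(ℝ, Fin n → ℝ) 𝓘(ℝ, Model n) (fun τ => S.jointFlow F τ p) τ w =
      S.dual (jointForm F w) (S.jointFlow F τ p) := by
  have hq := π_jointFlow_mem hF hp τ
  have hβ := jointForm_mem_closedForms hF w
  have hd : MDifferentiableAt 𝓘(ℝ, Fin n → ℝ) 𝓘(ℝ, Model n) (fun τ => S.jointFlow F τ p) τ :=
    (ContMDiffAt.comp (g := fun x : (Fin n → ℝ) × M => S.jointFlow F x.1 x.2) τ
      (contMDiffAt_jointFlow hF hp τ) (contMDiffAt_id.prodMk contMDiffAt_const)).mdifferentiableAt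
      (by simp)
  have h2 : (fun s : ℝ => S.jointFlow F (s • w + τ) p) =
      fun s => S.flow (jointForm F w) s (S.jointFlow F τ p) := by
    funext s
    rw [jointFlow_add hF hp, jointFlow_smul hF hq]
  have h3 := isMIntegralCurve_flow hβ hq 0
  rw [← h2] at h3
  have h4 := mfderiv_eq_of_hasMFDerivAt_line hd h3
  have h0 : (fun s : ℝ => S.jointFlow F (s • w + τ) p) 0 = S.jointFlow F τ p := by simp
  exact h4.trans (congrArg (fun q => (S.dual (jointForm F w) q : Model n)) h0)

/-- If `p ↦ Φ^{T(p)}(p)` is symplectic, where `Φ` is the joint flow, then `∑ dTᵢ ∧ dFᵢ = 0`. -/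
theorem jointForm_mfderiv_symm (hF : S.IsMomentMap U F) {p : M} (hp : S.π p ∈ U)
    {T : M → Fin n → ℝ} (hT : MDifferentiableAt 𝓘(ℝ, Model n) 𝓘(ℝ, Fin n → ℝ) T p)
    (hsymp : ∀ a b : TangentSpace 𝓘(ℝ, Model n) p,
      S.form (S.jointFlow F (T p) p)
        ![mfderiv 𝓘(ℝ, Model n) 𝓘(ℝ, Model n) (fun r => S.jointFlow F (T r) r) p a,
        mfderiv 𝓘(ℝ, Model n) 𝓘(ℝ, Model n) (fun r => S.jointFlow F (T r) r) p b] = S.form p ![a, b])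
    (a b : TangentSpace 𝓘(ℝ, Model n) p) :
    jointForm F (mfderiv 𝓘(ℝ, Model n) 𝓘(ℝ, Fin n → ℝ) T p a) p ![b] =
      jointForm F (mfderiv 𝓘(ℝ, Model n) 𝓘(ℝ, Fin n → ℝ) T p b) p ![a] := by
  have hder : ∀ a : TangentSpace 𝓘(ℝ, Model n) p,
      mfderiv 𝓘(ℝ, Model n) 𝓘(ℝ, Model n) (fun r => S.jointFlow F (T r) r) p a =
        S.dual (jointForm F (mfderiv 𝓘(ℝ, Model n) 𝓘(ℝ, Fin n → ℝ) T p a))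
          (S.jointFlow F (T p) p) +
        mfderiv 𝓘(ℝ, Model n) 𝓘(ℝ, Model n) (S.jointFlow F (T p)) p a := by
    intro a
    have h1 := MDifferentiableAt.hasMFDerivAt_comp₂
      (Φ := fun x : (Fin n → ℝ) × M => S.jointFlow F x.1 x.2)
      (a := T) (b := fun r : M => r) (z := p)
      ((contMDiffAt_jointFlow hF hp (T p)).mdifferentiableAt (by simp)) hT.hasMFDerivAt
      (hasMFDerivAt_id p)
    rw [h1.mfderiv]
    refine Eq.trans ?_ (congrArg (· + mfderiv 𝓘(ℝ, Model n) 𝓘(ℝ, Model n) (S.jointFlow F (T p)) p a)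
      (mfderiv_jointFlow_left hF hp (T p) (mfderiv 𝓘(ℝ, Model n) 𝓘(ℝ, Fin n → ℝ) T p a)))
    rfl
  have hq := π_jointFlow_mem hF hp (T p)
  have hmix : ∀ (w : Fin n → ℝ) (b : TangentSpace 𝓘(ℝ, Model n) p),
      S.form (S.jointFlow F (T p) p) ![S.dual (jointForm F w) (S.jointFlow F (T p) p),
        mfderiv 𝓘(ℝ, Model n) 𝓘(ℝ, Model n) (S.jointFlow F (T p)) p b] = jointForm F w p ![b] := by
    intro w b
    rw [S.form_dual]
    exact oneForm_mfderiv_flow (jointForm_mem_closedForms hF (T p))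
      (jointForm_mem_closedForms hF w) hp 1 b
  have hDD : S.form (S.jointFlow F (T p) p)
      ![mfderiv 𝓘(ℝ, Model n) 𝓘(ℝ, Model n) (S.jointFlow F (T p)) p a,
        mfderiv 𝓘(ℝ, Model n) 𝓘(ℝ, Model n) (S.jointFlow F (T p)) p b] = S.form p ![a, b] :=
    form_mfderiv_flow (jointForm_mem_closedForms hF (T p)) hp 1 a b
  obtain ⟨wa, hwa⟩ : ∃ wa : Fin n → ℝ, wa = mfderiv 𝓘(ℝ, Model n) 𝓘(ℝ, Fin n → ℝ) T p a :=
    ⟨_, rfl⟩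
  obtain ⟨wb, hwb⟩ : ∃ wb : Fin n → ℝ, wb = mfderiv 𝓘(ℝ, Model n) 𝓘(ℝ, Fin n → ℝ) T p b :=
    ⟨_, rfl⟩
  have ha := hder a
  have hb := hder b
  refine Eq.trans (b := jointForm F wa p ![b]) (by rw [hwa])
    (Eq.trans (b := jointForm F wb p ![a]) ?_ (by rw [hwb]))
  have h := hsymp a b
  obtain ⟨A, hA⟩ : ∃ A : TangentSpace 𝓘(ℝ, Model n) (S.jointFlow F (T p) p),
    A = mfderiv 𝓘(ℝ, Model n) 𝓘(ℝ, Model n) (S.jointFlow F (T p)) p a := ⟨_, rfl⟩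
  obtain ⟨B, hB⟩ : ∃ B : TangentSpace 𝓘(ℝ, Model n) (S.jointFlow F (T p) p),
    B = mfderiv 𝓘(ℝ, Model n) 𝓘(ℝ, Model n) (S.jointFlow F (T p)) p b := ⟨_, rfl⟩
  have ha' : mfderiv 𝓘(ℝ, Model n) 𝓘(ℝ, Model n) (fun r => S.jointFlow F (T r) r) p a =
      S.dual (jointForm F wa) (S.jointFlow F (T p) p) + A := by rw [hwa, hA]; exact ha
  have hb' : mfderiv 𝓘(ℝ, Model n) 𝓘(ℝ, Model n) (fun r => S.jointFlow F (T r) r) p b =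
      S.dual (jointForm F wb) (S.jointFlow F (T p) p) + B := by rw [hwb, hB]; exact hb
  have m1 := hmix wa b
  have m2 := hmix wb a
  rw [← hB] at m1
  rw [← hA] at m2
  rw [← hA, ← hB] at hDD
  rw [ha', hb', form_add_left, form_add_right, form_add_right, m1, hDD,
    form_dual_dual_eq_zero (jointForm_mem_closedForms hF _) (jointForm_mem_closedForms hF _) hq,
    S.form_swap _ A, m2] at h
  linarith

end IntegrableSystem

/-- The derivative of `∑ tᵢ dfᵢ` is symmetric if `∑ dtᵢ ∧ dfᵢ = 0`. -/
theorem fderiv_sum_smul_fderiv_symm {E : Type*} [NormedAddCommGroup E] [NormedSpace ℝ E] {n : ℕ}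
    {t f : Fin n → E → ℝ} {e : E} (ht : ∀ i, DifferentiableAt ℝ (t i) e)
    (hf : ∀ i, ContDiffAt ℝ ∞ (f i) e) {a b : E}
    (h : ∑ i, fderiv ℝ (t i) e a * fderiv ℝ (f i) e b =
      ∑ i, fderiv ℝ (t i) e b * fderiv ℝ (f i) e a) :
    fderiv ℝ (fun x => ∑ i, t i x • fderiv ℝ (f i) x) e a b =
      fderiv ℝ (fun x => ∑ i, t i x • fderiv ℝ (f i) x) e b a := by
  have hff : ∀ i, DifferentiableAt ℝ (fderiv ℝ (f i)) e := fun i =>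
    ((hf i).fderiv_right (m := ∞) (by simp)).differentiableAt (by simp)
  have hd : HasFDerivAt (fun x => ∑ i, t i x • fderiv ℝ (f i) x)
      (∑ i, (t i e • fderiv ℝ (fderiv ℝ (f i)) e +
        (fderiv ℝ (t i) e).smulRight (fderiv ℝ (f i) e))) e :=
    HasFDerivAt.fun_sum fun i _ => (ht i).hasFDerivAt.smul (hff i).hasFDerivAt
  have hsymm : ∀ i, fderiv ℝ (fderiv ℝ (f i)) e a b = fderiv ℝ (fderiv ℝ (f i)) e b a := fun i =>
    (hf i).isSymmSndFDerivAt (by simpa using WithTop.coe_le_coe.2 (le_top : (2 : ℕ∞) ≤ ⊤)) a b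
  rw [hd.fderiv]
  simp only [_root_.sum_apply, _root_.add_apply, _root_.smul_apply,
    ContinuousLinearMap.smulRight_apply, smul_eq_mul, Finset.sum_add_distrib, h, hsymm]

namespace IntegrableSystem

variable {n : ℕ} {M : Type u} {O : Type v}
  [TopologicalSpace M] [ChartedSpace (Model n) M] [TopologicalSpace O]
  {S : IntegrableSystem n M O} [IsManifold 𝓘(ℝ, Model n) ∞ M]
variable {U : Opens O} {F : Fin n → M → ℝ}

theorem oneFormEquiv_jointForm_inChart {A : Set M} (hA : IsOpen A)
    (hF : ∀ i, ContMDiffOn 𝓘(ℝ, Model n) 𝓘(ℝ, ℝ) ∞ (F i) A) (T : M → Fin n → ℝ) {p₀ : M}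
    {e : Model n} (he : e ∈ MForm.chartDomain n A p₀) :
    oneFormEquiv (Model n) (MForm.inChart (fun p => jointForm F (T p) p) p₀ e) =
      ∑ i, T ((extChartAt 𝓘(ℝ, Model n) p₀).symm e) i •
        fderiv ℝ (fun x => F i ((extChartAt 𝓘(ℝ, Model n) p₀).symm x)) e := by
  ext a
  rw [oneFormEquiv_apply, MForm.inChart_one_apply, jointForm_apply, _root_.sum_apply]
  refine Finset.sum_congr rfl fun i _ => ?_
  rw [_root_.smul_apply, smul_eq_mul, ← MForm.oneFormEquiv_ofFunction_inChart hA (hF i)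
    he, oneFormEquiv_apply, MForm.inChart_one_apply, MForm.ofFunction_apply]

/-- The form `∑ Tᵢ dFᵢ` is closed if `∑ dTᵢ ∧ dFᵢ = 0`. -/
theorem smoothOn_closedOn_jointForm {A : Set M} (hA : IsOpen A)
    (hF : ∀ i, ContMDiffOn 𝓘(ℝ, Model n) 𝓘(ℝ, ℝ) ∞ (F i) A) {T : M → Fin n → ℝ}
    (hT : ContMDiffOn 𝓘(ℝ, Model n) 𝓘(ℝ, Fin n → ℝ) ∞ T A)
    (hsymm : ∀ p ∈ A, ∀ a b : TangentSpace 𝓘(ℝ, Model n) p,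
      jointForm F (mfderiv 𝓘(ℝ, Model n) 𝓘(ℝ, Fin n → ℝ) T p a) p ![b] =
        jointForm F (mfderiv 𝓘(ℝ, Model n) 𝓘(ℝ, Fin n → ℝ) T p b) p ![a]) :
    MForm.SmoothOn (n := n) (k := 1) (fun p => jointForm F (T p) p) A ∧
      MForm.ClosedOn (n := n) (k := 1) (fun p => jointForm F (T p) p) A := by
  have hTc : ∀ (p₀ : M) (e : Model n), e ∈ MForm.chartDomain n A p₀ →
      ContDiffAt ℝ ∞ (fun x => T ((extChartAt 𝓘(ℝ, Model n) p₀).symm x)) e := by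
    intro p₀ e he
    rw [← contMDiffAt_iff_contDiffAt]
    exact ContMDiffAt.comp e (hT.contMDiffAt (hA.mem_nhds he.2)) (contMDiffAt_extChartAt_symm he.1)
  have hFc : ∀ (p₀ : M) (e : Model n), e ∈ MForm.chartDomain n A p₀ → ∀ i,
      ContDiffAt ℝ ∞ (fun x => F i ((extChartAt 𝓘(ℝ, Model n) p₀).symm x)) e :=
    fun p₀ e he i => MForm.contDiffAt_comp_symm hA (hF i) he
  have hev : ∀ (p₀ : M) (e : Model n), e ∈ MForm.chartDomain n A p₀ →
      (fun x => oneFormEquiv (Model n)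
        (MForm.inChart (n := n) (k := 1) (fun p => jointForm F (T p) p) p₀ x)) =ᶠ[𝓝 e]
      fun x => ∑ i, T ((extChartAt 𝓘(ℝ, Model n) p₀).symm x) i •
        fderiv ℝ (fun x => F i ((extChartAt 𝓘(ℝ, Model n) p₀).symm x)) x := by
    intro p₀ e he
    filter_upwards [(MForm.isOpen_chartDomain hA p₀).mem_nhds he] with x hx using
      oneFormEquiv_jointForm_inChart hA hF T hx
  have hsm : MForm.SmoothOn (n := n) (k := 1) (fun p => jointForm F (T p) p) A := by
    intro p₀ e he
    have h1 : ContDiffAt ℝ ∞ (fun x => ∑ i, T ((extChartAt 𝓘(ℝ, Model n) p₀).symm x) i •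
        fderiv ℝ (fun x => F i ((extChartAt 𝓘(ℝ, Model n) p₀).symm x)) x) e :=
      ContDiffAt.sum fun i _ => ((contDiffAt_pi.1 (hTc p₀ e he)) i).smul
        ((hFc p₀ e he i).fderiv_right (m := ∞) (by simp))
    have h2 := (oneFormEquiv (Model n)).symm.contDiff.contDiffAt.comp e
      (h1.congr_of_eventuallyEq (hev p₀ e he))
    refine (h2.congr_of_eventuallyEq (Eventually.of_forall fun x => ?_)).contDiffWithinAt
    exact ((oneFormEquiv (Model n)).symm_apply_apply _).symm
  refine ⟨hsm, fun p₀ e he => ?_⟩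
  rw [extDeriv_oneForm_eq_zero_iff (((hsm p₀).contDiffAt
    ((MForm.isOpen_chartDomain hA p₀).mem_nhds he)).differentiableAt (by simp))]
  intro a b
  rw [(hev p₀ e he).fderiv_eq]
  have hTd := (hTc p₀ e he).differentiableAt (by simp)
  have hT1 : ∀ (a : Model n) i,
      fderiv ℝ (fun x => T ((extChartAt 𝓘(ℝ, Model n) p₀).symm x) i) e a =
        (mfderiv 𝓘(ℝ, Model n) 𝓘(ℝ, Fin n → ℝ) T ((extChartAt 𝓘(ℝ, Model n) p₀).symm e)
          (mfderiv 𝓘(ℝ, Model n) 𝓘(ℝ, Model n) (extChartAt 𝓘(ℝ, Model n) p₀).symm e a) :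
            Fin n → ℝ) i := by
    intro a i
    have h1 := ((hT.contMDiffAt (hA.mem_nhds he.2)).mdifferentiableAt (by simp)).hasMFDerivAt.comp e
      (mdifferentiableAt_extChartAt_symm' he.1).hasMFDerivAt
    have h2 := h1.mfderiv
    rw [mfderiv_eq_fderiv] at h2
    have h3 := congrArg (fun A : Model n →L[ℝ] (Fin n → ℝ) => A a i) h2
    refine Eq.trans ?_ h3
    rw [show (T ∘ (extChartAt 𝓘(ℝ, Model n) p₀).symm) =
      fun x => T ((extChartAt 𝓘(ℝ, Model n) p₀).symm x) from rfl]
    rw [(hasFDerivAt_pi'.1 hTd.hasFDerivAt i).fderiv]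
    rfl
  have hF1 : ∀ (a : Model n) i,
      fderiv ℝ (fun x => F i ((extChartAt 𝓘(ℝ, Model n) p₀).symm x)) e a =
        differential (F i) ((extChartAt 𝓘(ℝ, Model n) p₀).symm e)
          (mfderiv 𝓘(ℝ, Model n) 𝓘(ℝ, Model n) (extChartAt 𝓘(ℝ, Model n) p₀).symm e a) := by
    intro a i
    rw [← MForm.oneFormEquiv_ofFunction_inChart hA (hF i) he, oneFormEquiv_apply,
      MForm.inChart_one_apply, MForm.ofFunction_apply]
  refine fderiv_sum_smul_fderiv_symm
    (fun i => (contDiffAt_pi.1 (hTc p₀ e he) i).differentiableAt (by simp)) (hFc p₀ e he) ?_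
  have h := hsymm _ he.2
    (mfderiv 𝓘(ℝ, Model n) 𝓘(ℝ, Model n) (extChartAt 𝓘(ℝ, Model n) p₀).symm e a)
    (mfderiv 𝓘(ℝ, Model n) 𝓘(ℝ, Model n) (extChartAt 𝓘(ℝ, Model n) p₀).symm e b)
  simp only [hT1, hF1]
  exact (jointForm_apply F _ _ _).symm.trans (h.trans (jointForm_apply F _ _ _))

/-- The form `∑ Tᵢ dFᵢ`, where `F` is a moment map, is a section of `𝒵¹` if
`∑ dTᵢ ∧ dFᵢ = 0`. -/
theorem jointForm_var_mem_closedForms [T2Space O] (hF : S.IsMomentMap U F) {T : M → Fin n → ℝ}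
    (hT : ContMDiffOn 𝓘(ℝ, Model n) 𝓘(ℝ, Fin n → ℝ) ∞ T (S.π ⁻¹' U))
    (hsymm : ∀ p ∈ S.π ⁻¹' U, ∀ a b : TangentSpace 𝓘(ℝ, Model n) p,
      jointForm F (mfderiv 𝓘(ℝ, Model n) 𝓘(ℝ, Fin n → ℝ) T p a) p ![b] =
        jointForm F (mfderiv 𝓘(ℝ, Model n) 𝓘(ℝ, Fin n → ℝ) T p b) p ![a]) :
    (fun p => jointForm F (T p) p : MForm n 1 M) ∈ S.closedForms U := by
  obtain ⟨h1, h2⟩ := smoothOn_closedOn_jointForm (S.isOpen_preimage U) hF.smooth hT hsymm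
  exact ⟨h1, h2, fun p hp a ha => (jointForm_mem_closedForms hF (T p)).2.2 p hp a ha⟩

end IntegrableSystem

/-! ### Symplectic maps -/

section SymplecticMaps

variable {n : ℕ} {M₁ M₂ M₃ : Type u} {O₁ O₂ O₃ : Type v}
  [TopologicalSpace M₁] [ChartedSpace (Model n) M₁] [TopologicalSpace O₁]
  [TopologicalSpace M₂] [ChartedSpace (Model n) M₂] [TopologicalSpace O₂]
  [TopologicalSpace M₃] [ChartedSpace (Model n) M₃] [TopologicalSpace O₃]
  {S₁ : IntegrableSystem n M₁ O₁} {S₂ : IntegrableSystem n M₂ O₂} {S₃ : IntegrableSystem n M₃ O₃}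

/-- The map `g` is smooth at `p`, and its differential at `p` respects the symplectic forms. -/
structure IsSymplecticAt (S₁ : IntegrableSystem n M₁ O₁) (S₂ : IntegrableSystem n M₂ O₂)
    (g : M₁ → M₂) (p : M₁) : Prop where
  contMDiffAt : ContMDiffAt 𝓘(ℝ, Model n) 𝓘(ℝ, Model n) ∞ g p
  form_eq : ∀ a b : TangentSpace 𝓘(ℝ, Model n) p,
    S₂.form (g p) ![mfderiv 𝓘(ℝ, Model n) 𝓘(ℝ, Model n) g p a,
      mfderiv 𝓘(ℝ, Model n) 𝓘(ℝ, Model n) g p b] = S₁.form p ![a, b]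

namespace IsSymplecticAt

theorem form_mfderiv_congr {g g' : M₁ → M₂} {p : M₁} (h : g =ᶠ[𝓝 p] g')
    (a b : TangentSpace 𝓘(ℝ, Model n) p) :
    S₂.form (g p) ![mfderiv 𝓘(ℝ, Model n) 𝓘(ℝ, Model n) g p a,
        mfderiv 𝓘(ℝ, Model n) 𝓘(ℝ, Model n) g p b] =
      S₂.form (g' p) ![mfderiv 𝓘(ℝ, Model n) 𝓘(ℝ, Model n) g' p a,
        mfderiv 𝓘(ℝ, Model n) 𝓘(ℝ, Model n) g' p b] := by
  have key : ∀ q q' : M₂, q = q' → ∀ A B : Model n →L[ℝ] Model n, A = B →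
      (S₂.form q) ![A a, A b] = (S₂.form q') ![B a, B b] := by
    rintro q _ rfl A _ rfl; rfl
  exact key _ _ h.self_of_nhds _ _ h.mfderiv_eq

theorem congr {g g' : M₁ → M₂} {p : M₁} (hg : IsSymplecticAt S₁ S₂ g p) (h : g' =ᶠ[𝓝 p] g) :
    IsSymplecticAt S₁ S₂ g' p :=
  ⟨hg.contMDiffAt.congr_of_eventuallyEq h,
    fun a b => (form_mfderiv_congr h a b).trans (hg.form_eq a b)⟩

theorem form_mfderiv_comp {f : M₂ → M₃} {g : M₁ → M₂} {p : M₁}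
    (hf : ContMDiffAt 𝓘(ℝ, Model n) 𝓘(ℝ, Model n) ∞ f (g p))
    (hg : ContMDiffAt 𝓘(ℝ, Model n) 𝓘(ℝ, Model n) ∞ g p) (a b : TangentSpace 𝓘(ℝ, Model n) p) :
    S₃.form (f (g p)) ![mfderiv 𝓘(ℝ, Model n) 𝓘(ℝ, Model n) (fun x => f (g x)) p a,
      mfderiv 𝓘(ℝ, Model n) 𝓘(ℝ, Model n) (fun x => f (g x)) p b] =
    S₃.form (f (g p)) ![mfderiv 𝓘(ℝ, Model n) 𝓘(ℝ, Model n) f (g p)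
        (mfderiv 𝓘(ℝ, Model n) 𝓘(ℝ, Model n) g p a),
      mfderiv 𝓘(ℝ, Model n) 𝓘(ℝ, Model n) f (g p)
        (mfderiv 𝓘(ℝ, Model n) 𝓘(ℝ, Model n) g p b)] := by
  have h := ((hf.mdifferentiableAt (by simp)).hasMFDerivAt.comp p
    (hg.mdifferentiableAt (by simp)).hasMFDerivAt).mfderiv
  have h' : mfderiv 𝓘(ℝ, Model n) 𝓘(ℝ, Model n) (fun x => f (g x)) p = _ := h
  rw [h']
  rfl

theorem comp {f : M₂ → M₃} {g : M₁ → M₂} {p : M₁} (hf : IsSymplecticAt S₂ S₃ f (g p))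
    (hg : IsSymplecticAt S₁ S₂ g p) : IsSymplecticAt S₁ S₃ (fun x => f (g x)) p :=
  ⟨hf.contMDiffAt.comp p hg.contMDiffAt, fun a b => by
    rw [form_mfderiv_comp hf.contMDiffAt hg.contMDiffAt, hf.form_eq, hg.form_eq]⟩

theorem id (p : M₁) : IsSymplecticAt S₁ S₁ (fun x => x) p :=
  ⟨contMDiffAt_id, fun a b => by
    have h : mfderiv 𝓘(ℝ, Model n) 𝓘(ℝ, Model n) (fun x : M₁ => x) p = _ := mfderiv_id
    rw [h]
    rfl⟩

/-- A smooth right inverse of a symplectic map is symplectic. -/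
theorem of_comp_eq_id {f : M₂ → M₁} {g : M₁ → M₂} {p : M₁} (hf : IsSymplecticAt S₂ S₁ f (g p))
    (hg : ContMDiffAt 𝓘(ℝ, Model n) 𝓘(ℝ, Model n) ∞ g p)
    (h : (fun x => f (g x)) =ᶠ[𝓝 p] fun x => x) : IsSymplecticAt S₁ S₂ g p :=
  ⟨hg, fun a b => by
    rw [← hf.form_eq, ← form_mfderiv_comp hf.contMDiffAt hg]
    exact (form_mfderiv_congr h a b).trans ((IsSymplecticAt.id (S₁ := S₁) p).form_eq a b)⟩

end IsSymplecticAt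

/-- The condition on the differential of a symplectomorphism, evaluated on pairs of vectors. -/
theorem compContinuousLinearMap_form_eq_iff {p : M₁} {q : M₂} (A : Model n →L[ℝ] Model n) :
    ContinuousAlternatingMap.compContinuousLinearMap
      (S₂.form q : Model n [⋀^Fin 2]→L[ℝ] ℝ) A = S₁.form p ↔
      ∀ a b : Model n, (S₂.form q) ![A a, A b] = (S₁.form p) ![a, b] := by
  have key : ∀ v : Fin 2 → Model n, (fun i => A (v i)) = ![A (v 0), A (v 1)] := fun v => by
    ext1 i; fin_cases i <;> rfl
  constructor
  · intro h a b
    have := congrArg (fun Ω : Model n [⋀^Fin 2]→L[ℝ] ℝ => Ω ![a, b]) h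
    refine Eq.trans ?_ this
    exact congrArg (S₂.form q) (key ![a, b]).symm
  · intro h
    refine ContinuousAlternatingMap.ext fun v => ?_
    have h1 : v = ![v 0, v 1] := by ext1 i; fin_cases i <;> rfl
    refine Eq.trans (congrArg (S₂.form q) (key v)) ((h (v 0) (v 1)).trans ?_)
    exact congrArg (S₁.form p) h1.symm

theorem IsSymplectomorphism.isSymplecticAt {g : OpenPartialHomeomorph M₁ M₂}
    (hg : IsSymplectomorphism S₁ S₂ g) {p : M₁} (hp : p ∈ g.source) :
    IsSymplecticAt S₁ S₂ g p :=
  ⟨hg.smooth.contMDiffAt (g.open_source.mem_nhds hp),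
    (compContinuousLinearMap_form_eq_iff (S₁ := S₁) (S₂ := S₂)
      (mfderiv 𝓘(ℝ, Model n) 𝓘(ℝ, Model n) g p)).1 (hg.symplectic p hp)⟩

theorem IsSymplectomorphism.isSymplecticAt_symm {g : OpenPartialHomeomorph M₁ M₂}
    (hg : IsSymplectomorphism S₁ S₂ g) {q : M₂} (hq : q ∈ g.target) :
    IsSymplecticAt S₂ S₁ g.symm q :=
  (hg.isSymplecticAt (g.map_target hq)).of_comp_eq_id
    (hg.smooth_symm.contMDiffAt (g.open_target.mem_nhds hq)) (by
      filter_upwards [g.open_target.mem_nhds hq] with r hr using g.right_inv hr)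

theorem isSymplectomorphism_of_isSymplecticAt {g : OpenPartialHomeomorph M₁ M₂}
    (h : ∀ p ∈ g.source, IsSymplecticAt S₁ S₂ g p)
    (h' : ∀ q ∈ g.target, IsSymplecticAt S₂ S₁ g.symm q) : IsSymplectomorphism S₁ S₂ g :=
  ⟨fun p hp => (h p hp).contMDiffAt.contMDiffWithinAt,
    fun q hq => (h' q hq).contMDiffAt.contMDiffWithinAt,
    fun p hp => (compContinuousLinearMap_form_eq_iff (S₁ := S₁) (S₂ := S₂)
      (mfderiv 𝓘(ℝ, Model n) 𝓘(ℝ, Model n) g p)).2 (h p hp).form_eq⟩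

namespace SymplecticEquivalence

variable (Ψ : SymplecticEquivalence S₁ S₂)

theorem isSymplecticAt (p : M₁) : IsSymplecticAt S₁ S₂ Ψ.map p :=
  ⟨Ψ.map.contMDiff.contMDiffAt,
    (compContinuousLinearMap_form_eq_iff (S₁ := S₁) (S₂ := S₂)
      (mfderiv 𝓘(ℝ, Model n) 𝓘(ℝ, Model n) Ψ.map p)).1 (Ψ.symplectic p)⟩

theorem isSymplecticAt_symm (q : M₂) : IsSymplecticAt S₂ S₁ Ψ.map.symm q :=
  (Ψ.isSymplecticAt (Ψ.map.symm q)).of_comp_eq_id Ψ.map.symm.contMDiff.contMDiffAt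
    (Eventually.of_forall fun r => Ψ.map.apply_symm_apply r)

end SymplecticEquivalence

end SymplecticMaps

namespace IntegrableSystem

variable {n : ℕ} {M : Type u} {O : Type v}
  [TopologicalSpace M] [ChartedSpace (Model n) M] [TopologicalSpace O]
  {S : IntegrableSystem n M O}

variable [IsManifold 𝓘(ℝ, Model n) ∞ M] [T2Space O] [T2Space M] [SecondCountableTopology M]
variable {U : Opens O}

/-- Near a regular fiber, a symplectic map that preserves the fibers is the time-one flow of a
section of `𝒵¹`: on the fibers it is a translation `Φ^T` of the joint flow `Φ` of a moment map `F`,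
where the translation vector `T` is a smooth function of `F`, and `∑ Tᵢ dFᵢ` is closed because the
map is symplectic. -/
theorem exists_flow_of_not_isSingular {x : O} (hx : ¬ S.IsSingular x) (hxU : x ∈ U) {g : M → M}
    (hg : ContMDiffOn 𝓘(ℝ, Model n) 𝓘(ℝ, Model n) ∞ g (S.π ⁻¹' U))
    (hsymp : ∀ p ∈ S.π ⁻¹' U, ∀ a b : TangentSpace 𝓘(ℝ, Model n) p,
      S.form (g p) ![mfderiv 𝓘(ℝ, Model n) 𝓘(ℝ, Model n) g p a,
        mfderiv 𝓘(ℝ, Model n) 𝓘(ℝ, Model n) g p b] = S.form p ![a, b])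
    (hπ : ∀ p ∈ S.π ⁻¹' U, S.π (g p) = S.π p) :
    ∃ V : Opens O, x ∈ V ∧ V ≤ U ∧ ∃ β ∈ S.closedForms V,
      ∀ p ∈ S.π ⁻¹' V, g p = S.flow β 1 p := by
  obtain ⟨p₀, rfl⟩ := S.surjective x
  obtain ⟨U₁, hU₁, F, hF₁, hind⟩ := exists_linearIndependent_of_rank (S := S) (p := p₀)
    (fun h => hx ⟨p₀, rfl, h⟩)
  obtain ⟨W, hW⟩ : ∃ W : Opens O, W = U₁ ⊓ U := ⟨_, rfl⟩
  have hWU : W ≤ U := hW ▸ inf_le_right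
  have hF : S.IsMomentMap W F := hF₁.mono (hW ▸ inf_le_left)
  have hp₀ : S.π p₀ ∈ W := by rw [hW]; exact ⟨hU₁, hxU⟩
  have hgW : ContMDiffOn 𝓘(ℝ, Model n) 𝓘(ℝ, Model n) ∞ g (S.π ⁻¹' W) := hg.mono (preimage_mono hWU)
  have hcomm : ∀ {p : M}, S.π p ∈ W → ∀ τ, g (S.jointFlow F τ p) = S.jointFlow F τ (g p) :=
    fun hp τ => comp_jointFlow_eq hF hgW (fun p hp => hsymp p (hWU hp))
      (fun p hp => hπ p (hWU hp)) hp τ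
  have hgπ : ∀ p, S.π p ∈ W → S.π (g p) = S.π p := fun p hp => hπ p (hWU hp)
  have hgmem : ∀ p, S.π p ∈ W → S.π (g p) ∈ W := fun p hp => by rw [hgπ p hp]; exact hp
  have hgF : ∀ p, S.π p ∈ W → (fun i => F i (g p)) = fun i => F i p := fun p hp =>
    funext fun i => hF.apply_eq hp (hgπ p hp) i
  have hgs : ∀ p, S.π p ∈ W → ContMDiffAt 𝓘(ℝ, Model n) 𝓘(ℝ, Model n) ∞ g p := fun p hp =>
    hgW.contMDiffAt ((S.isOpen_preimage W).mem_nhds hp)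
  have hFs : ∀ p, S.π p ∈ W →
      ContMDiffAt 𝓘(ℝ, Model n) 𝓘(ℝ, Fin n → ℝ) ∞ (fun p i => F i p) p := fun p hp =>
    contMDiffAt_pi_space.2 fun i => (hF.smooth i).contMDiffAt ((S.isOpen_preimage W).mem_nhds hp)
  have hindf : ∀ p, S.π p = S.π p₀ → LinearIndependent ℝ fun i : Fin n =>
      differential (n := n) (F i) p :=
    fun p hp => linearIndependent_of_not_isSingular hF hp₀ hx hind hp
  obtain ⟨σ, τ, hσ, -, hσc, hτ⟩ := exists_flowCoordinates hF hp₀ hind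
  obtain ⟨τ₀, hτ₀⟩ := exists_jointFlow_eq hF hp₀ hindf (hgπ p₀ hp₀)
  obtain ⟨c₀, hc₀⟩ : ∃ c₀ : Fin n → ℝ, c₀ = fun i => F i p₀ := ⟨_, rfl⟩
  rw [← hc₀] at hσ hσc
  -- The point `r c` of the fiber through `σ c` corresponds to `g (σ c)` by a fixed translation and
  -- lies near `p₀`, where the translation coordinates `τ` are available.
  obtain ⟨r, hr⟩ : ∃ r : (Fin n → ℝ) → M, r = fun c => S.jointFlow F (-τ₀) (g (σ c)) := ⟨_, rfl⟩
  have hrs : ∀ c, ContMDiffAt 𝓘(ℝ, Fin n → ℝ) 𝓘(ℝ, Model n) ∞ σ c → S.π (σ c) ∈ W →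
      ContMDiffAt 𝓘(ℝ, Fin n → ℝ) 𝓘(ℝ, Model n) ∞ r c := by
    intro c h1 h2
    rw [hr]
    exact (contMDiffAt_jointFlow_right hF (hgmem _ h2) (-τ₀)).comp c ((hgs _ h2).comp c h1)
  have hrc₀ : r c₀ = p₀ := by
    have := jointFlow_neg hF hp₀ (-τ₀)
    rw [neg_neg, hτ₀] at this
    rw [hr]; simp only [hσ, this]
  have hσ₀ := hσc.self_of_nhds
  have hrt : Tendsto r (𝓝 c₀) (𝓝 p₀) := by
    have := (hrs c₀ hσ₀.1 hσ₀.2.1).continuousAt.tendsto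
    rwa [hrc₀] at this
  obtain ⟨T, hT⟩ : ∃ T : (Fin n → ℝ) → Fin n → ℝ, T = fun c => τ₀ + τ (r c) := ⟨_, rfl⟩
  have hev : ∀ᶠ c in 𝓝 c₀, S.π (σ c) ∈ W ∧ (fun i => F i (σ c)) = c ∧
      ContMDiffAt 𝓘(ℝ, Fin n → ℝ) 𝓘(ℝ, Fin n → ℝ) ∞ T c ∧
      g (σ c) = S.jointFlow F (T c) (σ c) := by
    filter_upwards [hσc, hrt.eventually hτ] with c h1 h2
    obtain ⟨h1, h3, h4⟩ := h1
    refine ⟨h3, h4, ?_, ?_⟩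
    · rw [hT]
      exact contMDiffAt_const.add (h2.1.comp c (hrs c h1 h3))
    · have h5 : (fun i => F i (r c)) = c := by
        rw [← h4, hr]
        funext i
        simp only [apply_jointFlow hF (hgmem _ h3), congrFun (hgF _ h3) i, h4]
      have h6 := h2.2
      rw [h5] at h6
      rw [hT, jointFlow_add hF h3, h6, hr, jointFlow_neg hF (hgmem _ h3)]
  obtain ⟨C, hC, hCo, hc₀C⟩ := eventually_nhds_iff.1 hev
  -- The saturation of the section `σ` is a neighborhood of the fiber.
  obtain ⟨V, hxV, hV⟩ := S.exists_preimage_subset (x := S.π p₀) (N := interior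
    {p | S.π p ∈ W ∧ (fun i => F i p) ∈ C ∧ ∃ τ', p = S.jointFlow F τ' (σ fun i => F i p)})
    isOpen_interior (by
      intro q hq
      have hqπ : S.π q = S.π p₀ := hq
      have hqW : S.π q ∈ W := by rw [hqπ]; exact hp₀
      have hqF : (fun i => F i q) = c₀ := by
        rw [hc₀]; exact funext fun i => hF.apply_eq hp₀ hqπ i
      obtain ⟨τq, hτq⟩ := exists_jointFlow_eq hF hp₀ hindf hqπ
      have hq0 : S.jointFlow F (-τq) q = p₀ := by
        have := jointFlow_neg hF hp₀ (-τq)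
        rwa [neg_neg, hτq] at this
      have ht : Tendsto (S.jointFlow F (-τq)) (𝓝 q) (𝓝 p₀) := by
        have := (contMDiffAt_jointFlow_right hF hqW (-τq)).continuousAt.tendsto
        rwa [hq0] at this
      rw [mem_interior_iff_mem_nhds]
      filter_upwards [ht.eventually hτ, (S.isOpen_preimage W).mem_nhds hqW,
        (hFs q hqW).continuousAt.eventually_mem (by
          rw [hqF]; exact hCo.mem_nhds hc₀C)] with p h1 h2 h3
      refine ⟨h2, h3, τq + τ (S.jointFlow F (-τq) p), ?_⟩
      have h4 := h1.2
      simp only [apply_jointFlow hF h2] at h4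
      rw [jointFlow_add hF (hC _ h3).1, h4, jointFlow_neg hF h2])
  have hV' : ∀ p, S.π p ∈ V → S.π p ∈ W ∧ (fun i => F i p) ∈ C ∧
      ∃ τ', p = S.jointFlow F τ' (σ fun i => F i p) := fun p hp => by
    have h := interior_subset (hV hp)
    exact h
  have hVW : V ≤ W := by
    intro y hy
    obtain ⟨p, rfl⟩ := S.surjective y
    exact (hV' p hy).1
  have hgT : ∀ p, S.π p ∈ V → g p = S.jointFlow F (T fun i => F i p) p := by
    intro p hp
    obtain ⟨h1, h2, τ', h3⟩ := hV' p hp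
    obtain ⟨h4, -, -, h5⟩ := hC _ h2
    have h6 := congrArg g h3
    rw [hcomm h4, h5, ← jointFlow_add hF h4, add_comm, jointFlow_add hF h4, ← h3] at h6
    exact h6
  have hTs : ContMDiffOn 𝓘(ℝ, Model n) 𝓘(ℝ, Fin n → ℝ) ∞ (fun p => T fun i => F i p)
      (S.π ⁻¹' V) := by
    intro p hp
    obtain ⟨h1, h2, -⟩ := hV' p hp
    exact (ContMDiffAt.comp (g := T) (f := fun p i => F i p) p (hC _ h2).2.2.1
      (hFs p h1)).contMDiffWithinAt
  have hFV := hF.mono hVW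
  have hβ := jointForm_var_mem_closedForms hFV hTs (by
    intro p hp a b
    refine jointForm_mfderiv_symm hFV hp ((hTs.contMDiffAt
      ((S.isOpen_preimage V).mem_nhds hp)).mdifferentiableAt (by simp)) (fun a b => ?_) a b
    rw [← hsymp p (hWU (hVW hp)) a b]
    refine (IsSymplecticAt.form_mfderiv_congr (S₂ := S) (g := g)
      (g' := fun q => S.jointFlow F (T fun i => F i q) q) ?_ a b).symm
    filter_upwards [(S.isOpen_preimage V).mem_nhds hp] with q hq using hgT q hq)
  -- `F`, and so the vector `T`, is constant on the fiber of `p`.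
  refine ⟨V, hxV, hVW.trans hWU, _, hβ, fun p hp => (hgT p hp).trans ?_⟩
  refine (flow_congr hβ (jointForm_mem_closedForms hFV (T fun i => F i p)) hp hp
    (fun q hq => ?_) 1).symm
  have : (fun i => F i q) = fun i => F i p := funext fun i => hFV.apply_eq hp hq i
  simp only [this]

end IntegrableSystem

/-! ### Local automorphisms as sections of `𝒵¹/ℛ` -/

namespace IntegrableSystem

variable {n : ℕ} {M : Type u} {O : Type v}
  [TopologicalSpace M] [ChartedSpace (Model n) M] [TopologicalSpace O]
  {S : IntegrableSystem n M O}
variable [IsManifold 𝓘(ℝ, Model n) ∞ M] [T2Space O] [T2Space M] [SecondCountableTopology M]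
variable {U : Opens O} {s s' : S.quotientSections U} {g g' : M → M}

theorem represents_iff : S.Represents U s g ↔ ∀ x ∈ U, ∃ V : Opens O, x ∈ V ∧ ∃ hV : V ≤ U,
    ∃ β ∈ S.closedForms V,
      (∀ (y : O) (hy : y ∈ V), s.1 ⟨y, hV hy⟩ = QuotientAddGroup.mk β) ∧
      ∀ p ∈ S.π ⁻¹' V, g p = S.flow β 1 p := by
  refine forall₂_congr fun x _ => exists_congr fun V => and_congr_right fun _ =>
    exists_congr fun hV => exists_congr fun β => and_congr_right fun hβ =>
    and_congr_right fun _ => ⟨?_, fun h => ⟨S.dual β, S.isDual_dual β, fun p hp =>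
      ⟨fun t => S.flow β t p, isMIntegralCurve_flow hβ hp, fun t => π_flow_mem hβ hp t,
        flow_zero hβ hp, (h p hp).symm⟩⟩⟩
  rintro ⟨Y, hY, h⟩ p hp
  obtain ⟨γ, hγ, hγV, h0, h1⟩ := h p hp
  rw [hY.eq_dual] at hγ
  rw [← h1, eq_flow hβ hγ hγV h0]

namespace Represents

theorem congr (h : S.Represents U s g) (hg : ∀ p, S.π p ∈ U → g' p = g p) :
    S.Represents U s g' := by
  rw [represents_iff] at h ⊢
  intro x hx
  obtain ⟨V, hxV, hV, β, hβ, hs, hp⟩ := h x hx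
  exact ⟨V, hxV, hV, β, hβ, hs, fun p hpV => (hg p (hV hpV)).trans (hp p hpV)⟩

theorem eqOn (h : S.Represents U s g) (h' : S.Represents U s g') {p : M} (hp : S.π p ∈ U) :
    g p = g' p := by
  obtain ⟨V, hxV, hV, β, hβ, hs, hg⟩ := represents_iff.1 h _ hp
  obtain ⟨V', hxV', hV', β', hβ', hs', hg'⟩ := represents_iff.1 h' _ hp
  obtain ⟨W, hW, -, heq⟩ := (mk_eq_mk_iff hβ hβ' hxV hxV').1 ((hs _ hxV).symm.trans (hs' _ hxV'))
  rw [hg p hxV, hg' p hxV', heq p hW]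

theorem section_ext (h : S.Represents U s g) (h' : S.Represents U s' g')
    (hg : ∀ p, S.π p ∈ U → g p = g' p) : s = s' := by
  refine Subtype.ext (funext fun x => ?_)
  obtain ⟨V, hxV, hV, β, hβ, hs, hgβ⟩ := represents_iff.1 h _ x.2
  obtain ⟨V', hxV', hV', β', hβ', hs', hgβ'⟩ := represents_iff.1 h' _ x.2
  refine (hs _ hxV).trans (Eq.trans ?_ (hs' _ hxV').symm)
  refine (mk_eq_mk_iff hβ hβ' hxV hxV').2 ⟨V ⊓ V', ⟨hxV, hxV'⟩, le_rfl, fun p hp => ?_⟩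
  rw [← hgβ p hp.1, ← hgβ' p hp.2, hg p (hV hp.1)]

theorem π_eq (h : S.Represents U s g) {p : M} (hp : S.π p ∈ U) : S.π (g p) = S.π p := by
  obtain ⟨V, hxV, -, β, hβ, -, hg⟩ := represents_iff.1 h _ hp
  rw [hg p hxV, π_flow hβ hxV]

theorem add (h : S.Represents U s g) (h' : S.Represents U s' g') :
    S.Represents U (s + s') (fun p => g (g' p)) := by
  rw [represents_iff] at h h' ⊢
  intro x hx
  obtain ⟨V, hxV, hV, β, hβ, hs, hg⟩ := h x hx
  obtain ⟨V', hxV', hV', β', hβ', hs', hg'⟩ := h' x hx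
  have h1 := S.closedForms_mono (inf_le_left : V ⊓ V' ≤ V) hβ
  have h2 := S.closedForms_mono (inf_le_right : V ⊓ V' ≤ V') hβ'
  refine ⟨V ⊓ V', ⟨hxV, hxV'⟩, inf_le_left.trans hV, β + β', add_mem h1 h2, fun y hy => ?_,
    fun p hp => ?_⟩
  · have e1 := hs y hy.1
    have e2 := hs' y hy.2
    exact congrArg₂ (· + ·) e1 e2
  · rw [hg' p hp.2, hg _ (by rw [mem_preimage, π_flow hβ' hp.2]; exact hp.1),
      flow_add_form h1 h2 hp]

theorem zero : S.Represents U 0 (fun p => p) :=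
  represents_iff.2 fun _ hx => ⟨U, hx, le_rfl, 0, zero_mem _, fun _ _ => rfl,
    fun p _ => (flow_zero_form p 1).symm⟩

theorem res {V : Opens O} (h : S.Represents U s g) (hVU : V ≤ U) :
    S.Represents V (Cech.res S.quotientSheaf hVU s) g := by
  refine represents_iff.2 fun x hx => ?_
  obtain ⟨V', hxV, hV, β, hβ, hs, hg⟩ := represents_iff.1 h x (hVU hx)
  exact ⟨V' ⊓ V, ⟨hxV, hx⟩, inf_le_right, β, S.closedForms_mono inf_le_left hβ,
    fun y hy => hs y hy.1, fun p hp => hg p hp.1⟩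

/-- The automorphisms represented by opposite sections are inverse to each other. -/
theorem apply_apply_neg (h : S.Represents U s g) (h' : S.Represents U (-s) g') {p : M}
    (hp : S.π p ∈ U) : g (g' p) = p := by
  have h1 := h.add h'
  rw [add_neg_cancel] at h1
  exact h1.eqOn zero hp

theorem isSymplecticAt (h : S.Represents U s g) {p : M} (hp : S.π p ∈ U) :
    IsSymplecticAt S S g p := by
  obtain ⟨V, hxV, -, β, hβ, -, hg⟩ := represents_iff.1 h _ hp
  have h1 : IsSymplecticAt S S (S.flow β 1) p :=
    ⟨contMDiffAt_flow_right hβ hxV 1, form_mfderiv_flow hβ hxV 1⟩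
  refine h1.congr ?_
  filter_upwards [(S.isOpen_preimage V).mem_nhds hxV] with q hq using hg q hq

end Represents

/-- Local time-one maps determine a section of `𝒵¹/ℛ`. -/
theorem exists_section_of_flow (h : ∀ x ∈ U, ∃ V : Opens O, x ∈ V ∧ V ≤ U ∧
    ∃ β ∈ S.closedForms V, ∀ p ∈ S.π ⁻¹' V, g p = S.flow β 1 p) :
    ∃ s : S.quotientSections U, S.Represents U s g := by
  choose! V hxV hVU β hβ hg using h
  have key : ∀ x ∈ U, ∀ y ∈ V x,
      (QuotientAddGroup.mk (β y) : MForm n 1 M ⧸ S.circleGerms y) = QuotientAddGroup.mk (β x) := by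
    intro x hx y hy
    have hyU := hVU x hx hy
    refine (mk_eq_mk_iff (hβ y hyU) (hβ x hx) (hxV y hyU) hy).2
      ⟨V y ⊓ V x, ⟨hxV y hyU, hy⟩, le_rfl, fun p hp => ?_⟩
    rw [← hg y hyU p hp.1, ← hg x hx p hp.2]
  refine ⟨⟨fun y => QuotientAddGroup.mk (β y.1), fun x => ⟨V x, hxV x x.2, hVU x x.2, β x,
    hβ x x.2, fun y hy => key x x.2 y hy⟩⟩, represents_iff.2 fun x hx => ⟨V x, hxV x hx, hVU x hx,
      β x, hβ x hx, fun y hy => key x hx y hy, hg x hx⟩⟩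

/-- Over each point of the base the time-one map of a local representative is taken; different
representatives give the same map by `mk_eq_mk_iff`. -/
theorem exists_represents (s : S.quotientSections U) : ∃ g : M → M, S.Represents U s g := by
  have h := s.2
  choose V hxV hVU β hβ hs using h
  classical
  refine ⟨fun p => if hp : S.π p ∈ U then S.flow (β ⟨S.π p, hp⟩) 1 p else p,
    represents_iff.2 fun x hx => ⟨V ⟨x, hx⟩, hxV _, hVU _, β _, hβ _, hs _, fun p hp => ?_⟩⟩
  have hpU := hVU _ hp
  simp only [dif_pos hpU]
  obtain ⟨W, hW, -, heq⟩ := (mk_eq_mk_iff (hβ ⟨S.π p, hpU⟩) (hβ ⟨x, hx⟩)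
    (hxV ⟨S.π p, hpU⟩) hp).1 ((hs ⟨S.π p, hpU⟩ _ (hxV _)).symm.trans (hs ⟨x, hx⟩ _ hp))
  exact heq p hW

/-- Every section of `𝒵¹/ℛ` is the class of a symplectomorphism. -/
theorem exists_symplectomorphism_represents (s : S.quotientSections U) :
    ∃ g : OpenPartialHomeomorph M M, g.source = S.π ⁻¹' U ∧ g.target = S.π ⁻¹' U ∧
      S.Represents U s g ∧ S.Represents U (-s) g.symm := by
  obtain ⟨g, hg⟩ := exists_represents s
  obtain ⟨g', hg'⟩ := exists_represents (-s)
  have hg'' : S.Represents U (- -s) g := by rwa [neg_neg]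
  have ho := S.isOpen_preimage U
  exact ⟨{
    toFun := g
    invFun := g'
    source := S.π ⁻¹' U
    target := S.π ⁻¹' U
    map_source' := fun p hp => by rw [mem_preimage, hg.π_eq hp]; exact hp
    map_target' := fun p hp => by rw [mem_preimage, hg'.π_eq hp]; exact hp
    left_inv' := fun p hp => hg'.apply_apply_neg hg'' hp
    right_inv' := fun p hp => hg.apply_apply_neg hg' hp
    open_source := ho
    open_target := ho
    continuousOn_toFun := fun p hp =>
      (hg.isSymplecticAt hp).contMDiffAt.continuousAt.continuousWithinAt
    continuousOn_invFun := fun p hp =>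
      (hg'.isSymplecticAt hp).contMDiffAt.continuousAt.continuousWithinAt }, rfl, rfl, hg, hg'⟩

/-- Every symplectomorphism that preserves the strata is given by a section of `𝒵¹/ℛ`. -/
theorem exists_section_of_symplectomorphism (h₇ : S.SymplectomorphismsAreTimeOneMaps)
    {g : OpenPartialHomeomorph M M} (hs : g.source = S.π ⁻¹' U) (ht : g.target = S.π ⁻¹' U)
    (hg : IsSymplectomorphism S S g) (hstr : ∀ p ∈ S.π ⁻¹' U, g p ∈ S.stratum p) :
    ∃ s : S.quotientSections U, S.Represents U s g := by
  refine exists_section_of_flow fun x hx => ?_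
  by_cases hsing : S.IsSingular x
  · obtain ⟨V, hxV, hVU, Y, β, hY, hβs, hβc, hYt, h1⟩ := h₇ x hsing U hx g hs ht hg hstr
    have hβ : β ∈ S.closedForms V := by
      refine mem_closedForms_of_dual_mem_tangent hβs hβc fun p hp => ?_
      rw [← hY.eq_dual]
      exact hYt p hp
    refine ⟨V, hxV, hVU, β, hβ, fun p hp => ?_⟩
    obtain ⟨γ, hγ, hγV, h0, h1⟩ := h1 p hp
    rw [hY.eq_dual] at hγ
    rw [← h1, eq_flow hβ hγ hγV h0]
  · refine exists_flow_of_not_isSingular hsing hx (hs ▸ hg.smooth) (fun p hp a b => ?_)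
      (fun p hp => π_eq_of_mem_stratum (hstr p hp))
    exact (hg.isSymplecticAt (hs ▸ hp)).form_eq a b

end IntegrableSystem

/-! ### Equality of Čech classes -/

namespace Cech

variable {X : Type v} [TopologicalSpace X] (F : (Opens X)ᵒᵖ ⥤ AddCommGrpCat.{w})

theorem res_self {U : Opens X} (s : F.obj (.op U)) : res F le_rfl s = s := by
  have : (homOfLE (le_refl U)).op = 𝟙 (Opposite.op U) := rfl
  simp only [res, this, F.map_id]
  rfl

instance : IsDirectedOrder (PointCover X) where
  directed W W' := ⟨⟨fun x => W.nhd x ⊓ W'.nhd x, fun x => ⟨W.mem x, W'.mem x⟩⟩,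
    fun _ => inf_le_left, fun _ => inf_le_right⟩

theorem refineH1_mk {W W' : PointCover X} (h : W ≤ W') (c : cocycles F W) :
    refineH1 F h (QuotientAddGroup.mk c) = QuotientAddGroup.mk (refine F h c) := rfl

instance : DirectedSystem (H1Cover F) fun _ _ h => refineH1 F h where
  map_self W c := by
    obtain ⟨c, rfl⟩ := QuotientAddGroup.mk_surjective c
    rw [refineH1_mk]
    congr 1
    exact Subtype.ext (funext fun x => funext fun y => res_self F _)
  map_map W₁ W₂ W₃ h h' c := by
    obtain ⟨c, rfl⟩ := QuotientAddGroup.mk_surjective c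
    rw [refineH1_mk, refineH1_mk, refineH1_mk]
    congr 1
    exact Subtype.ext (funext fun x => funext fun y => res_res F _ _ _)

variable {F}

theorem refineH1_mk_eq_zero_iff {W W' : PointCover X} (h : W ≤ W') (c : cocycles F W) :
    refineH1 F h (QuotientAddGroup.mk c) = 0 ↔ ∃ b : ∀ x, F.obj (.op (W'.nhd x)),
      ∀ x y, res F (inf_le_inf (h x) (h y)) (c.1 x y) =
        res F inf_le_right (b y) - res F inf_le_left (b x) := by
  rw [refineH1_mk, QuotientAddGroup.eq_zero_iff]
  rfl

theorem H1.mk_refine {W W' : PointCover X} (h : W ≤ W') (c : cocycles F W) :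
    H1.mk F W' (refine F h c) = H1.mk F W c := by
  classical
  exact AddCommGroup.DirectLimit.of_f (G := H1Cover F) (f := fun _ _ h => refineH1 F h) h
    (QuotientAddGroup.mk c)

/-- Two cocycles define the same class if and only if they are cohomologous on a common
refinement. -/
theorem H1.mk_eq_mk_iff {W₁ W₂ : PointCover X} {c₁ : cocycles F W₁} {c₂ : cocycles F W₂} :
    H1.mk F W₁ c₁ = H1.mk F W₂ c₂ ↔ ∃ (W : PointCover X) (h₁ : W₁ ≤ W) (h₂ : W₂ ≤ W)
      (b : ∀ x, F.obj (.op (W.nhd x))), ∀ x y,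
        res F (inf_le_inf (h₁ x) (h₁ y)) (c₁.1 x y) - res F (inf_le_inf (h₂ x) (h₂ y)) (c₂.1 x y) =
        res F inf_le_right (b y) - res F inf_le_left (b x) := by
  classical
  have hsub : ∀ {W : PointCover X} (h₁ : W₁ ≤ W) (h₂ : W₂ ≤ W),
      H1.mk F W (refine F h₁ c₁ - refine F h₂ c₂) = H1.mk F W₁ c₁ - H1.mk F W₂ c₂ := by
    intro W h₁ h₂
    rw [← H1.mk_refine h₁ c₁, ← H1.mk_refine h₂ c₂]
    exact map_sub (AddCommGroup.DirectLimit.of (H1Cover F) (fun _ _ h => refineH1 F h) W)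
      (QuotientAddGroup.mk (refine F h₁ c₁)) (QuotientAddGroup.mk (refine F h₂ c₂))
  constructor
  · intro h
    obtain ⟨W, h₁, h₂⟩ := exists_ge_ge W₁ W₂
    have h0 : H1.mk F W (refine F h₁ c₁ - refine F h₂ c₂) = 0 := by rw [hsub, h, sub_self]
    obtain ⟨W', hW, h3⟩ := AddCommGroup.DirectLimit.of.zero_exact (G := H1Cover F)
      (f := fun _ _ h => refineH1 F h) W _ h0
    obtain ⟨b, hb⟩ := (refineH1_mk_eq_zero_iff hW _).1 h3
    refine ⟨W', h₁.trans hW, h₂.trans hW, b, fun x y => (Eq.trans ?_ (hb x y))⟩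
    refine Eq.trans ?_ (map_sub (res F (inf_le_inf (hW x) (hW y)))
      ((refine F h₁ c₁).1 x y) ((refine F h₂ c₂).1 x y)).symm
    exact (congrArg₂ (· - ·) (res_res F _ _ _) (res_res F _ _ _)).symm
  · rintro ⟨W, h₁, h₂, b, hb⟩
    rw [← sub_eq_zero, ← hsub h₁ h₂]
    have h0 : (QuotientAddGroup.mk (refine F h₁ c₁ - refine F h₂ c₂) : H1Cover F W) = 0 :=
      (QuotientAddGroup.eq_zero_iff _).2 ⟨b, hb⟩
    exact (congrArg _ h0).trans (map_zero _)

end Cech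

/-! ### Rough equivalences and their classes -/

section Global

variable {n : ℕ} {M₀ M₁ M₂ : Type u} {O₀ O₁ O₂ : Type v}
  [TopologicalSpace M₀] [ChartedSpace (Model n) M₀] [TopologicalSpace O₀]
  [TopologicalSpace M₁] [ChartedSpace (Model n) M₁] [TopologicalSpace O₁]
  [TopologicalSpace M₂] [ChartedSpace (Model n) M₂] [TopologicalSpace O₂]
  {S₀ : IntegrableSystem n M₀ O₀} {S₁ : IntegrableSystem n M₁ O₁} {S₂ : IntegrableSystem n M₂ O₂}

namespace RoughSymplecticEquivalence

variable (E : RoughSymplecticEquivalence S₀ S₁)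

theorem mem_source {i : E.ι} {p : M₀} : p ∈ (E.Φ i).source ↔ S₀.π p ∈ E.U i := by
  rw [E.source_eq]; rfl

theorem mem_target {i : E.ι} {q : M₁} : q ∈ (E.Φ i).target ↔ E.base.symm (S₁.π q) ∈ E.U i := by
  rw [E.target_eq]
  constructor
  · rintro ⟨x, hx, h⟩
    rw [← h, E.base.symm_apply_apply]; exact hx
  · intro h
    exact ⟨_, h, E.base.apply_symm_apply _⟩

theorem base_symm_π_apply {i : E.ι} {p : M₀} (hp : S₀.π p ∈ E.U i) :
    E.base.symm (S₁.π (E.Φ i p)) = S₀.π p := by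
  rw [E.comm i p (E.mem_source.2 hp), E.base.symm_apply_apply]

theorem symm_apply {i : E.ι} {p : M₀} (hp : S₀.π p ∈ E.U i) : (E.Φ i).symm (E.Φ i p) = p :=
  (E.Φ i).left_inv (E.mem_source.2 hp)

theorem apply_symm {i : E.ι} {q : M₁} (hq : E.base.symm (S₁.π q) ∈ E.U i) :
    E.Φ i ((E.Φ i).symm q) = q :=
  (E.Φ i).right_inv (E.mem_target.2 hq)

theorem π_symm_apply {i : E.ι} {q : M₁} (hq : E.base.symm (S₁.π q) ∈ E.U i) :
    S₀.π ((E.Φ i).symm q) = E.base.symm (S₁.π q) := by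
  have h := E.base_symm_π_apply (E.mem_source.1 ((E.Φ i).map_target (E.mem_target.2 hq)))
  rw [E.apply_symm hq] at h
  exact h.symm

theorem isSymplecticAt {i : E.ι} {p : M₀} (hp : S₀.π p ∈ E.U i) :
    IsSymplecticAt S₀ S₁ (E.Φ i) p :=
  (E.symplectic i).isSymplecticAt (E.mem_source.2 hp)

theorem isSymplecticAt_symm {i : E.ι} {q : M₁} (hq : E.base.symm (S₁.π q) ∈ E.U i) :
    IsSymplecticAt S₁ S₀ (E.Φ i).symm q :=
  (E.symplectic i).isSymplecticAt_symm (E.mem_target.2 hq)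

end RoughSymplecticEquivalence

namespace SymplecticEquivalence

/-- The identity as a symplectic equivalence. -/
noncomputable def refl (S₁ : IntegrableSystem n M₁ O₁) : SymplecticEquivalence S₁ S₁ where
  base := Homeomorph.refl O₁
  map := Diffeomorph.refl 𝓘(ℝ, Model n) M₁ ∞
  comm _ := rfl
  symplectic p := (compContinuousLinearMap_form_eq_iff (S₁ := S₁) (S₂ := S₁)
    (mfderiv 𝓘(ℝ, Model n) 𝓘(ℝ, Model n) (fun x : M₁ => x) p)).2 (IsSymplecticAt.id p).form_eq

theorem refl_respectsRoughTypes (E : RoughSymplecticEquivalence S₀ S₁) :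
    (refl S₁).RespectsRoughTypes E E :=
  ⟨fun _ => rfl, fun i j => inf_comm (E.U j) (E.U i) ▸ E.admissible j i⟩

/-- Transport of a rough symplectic equivalence along a symplectic equivalence. -/
noncomputable def compRough (Ψ : SymplecticEquivalence S₁ S₂) (E : RoughSymplecticEquivalence S₀ S₁) :
    RoughSymplecticEquivalence S₀ S₂ where
  base := E.base.trans Ψ.base
  ι := E.ι
  U := E.U
  cover := E.cover
  Φ i := (E.Φ i).trans Ψ.map.toHomeomorph.toOpenPartialHomeomorph
  source_eq i := by simp [E.source_eq]
  target_eq i := by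
    ext r
    have h : Ψ.base (S₁.π (Ψ.map.symm r)) = S₂.π r := by
      rw [← Ψ.comm, Ψ.map.apply_symm_apply]
    simp only [OpenPartialHomeomorph.trans_target, Homeomorph.toOpenPartialHomeomorph_target,
      univ_inter, mem_preimage]
    change Ψ.map.symm r ∈ (E.Φ i).target ↔ _
    rw [E.target_eq, mem_preimage, ← h]
    constructor
    · rintro ⟨x, hx, hxr⟩
      exact ⟨x, hx, congrArg Ψ.base hxr⟩
    · rintro ⟨x, hx, hxr⟩
      exact ⟨x, hx, Ψ.base.injective hxr⟩
  comm i p hp := by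
    have hp' : p ∈ (E.Φ i).source := by simpa using hp
    exact (Ψ.comm _).trans (congrArg Ψ.base (E.comm i p hp'))
  symplectic i := by
    refine isSymplectomorphism_of_isSymplecticAt (fun p hp => ?_) (fun r hr => ?_)
    · have hp' : p ∈ (E.Φ i).source := by simpa using hp
      exact (Ψ.isSymplecticAt _).comp ((E.symplectic i).isSymplecticAt hp')
    · have hr' : Ψ.map.symm r ∈ (E.Φ i).target := by simpa using hr
      exact ((E.symplectic i).isSymplecticAt_symm hr').comp (Ψ.isSymplecticAt_symm r)
  admissible i j := by
    have h : (fun p => ((E.Φ i).trans Ψ.map.toHomeomorph.toOpenPartialHomeomorph).symm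
        ((E.Φ j).trans Ψ.map.toHomeomorph.toOpenPartialHomeomorph p)) =
        fun p => (E.Φ i).symm (E.Φ j p) :=
      funext fun p => congrArg (E.Φ i).symm (Ψ.map.symm_apply_apply _)
    rw [h]
    exact E.admissible i j

theorem compRough_respectsRoughTypes (Ψ : SymplecticEquivalence S₁ S₂)
    (E : RoughSymplecticEquivalence S₀ S₁) : Ψ.RespectsRoughTypes E (Ψ.compRough E) := by
  refine ⟨fun _ => rfl, fun i j => ?_⟩
  have h : (fun p => ((Ψ.compRough E).Φ j).symm (Ψ.map (E.Φ i p))) =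
      fun p => (E.Φ j).symm (E.Φ i p) :=
    funext fun p => congrArg (E.Φ j).symm (Ψ.map.symm_apply_apply _)
  rw [h]
  exact inf_comm (E.U j) (E.U i) ▸ E.admissible j i

variable [IsManifold 𝓘(ℝ, Model n) ∞ M₀] [T2Space O₀] [T2Space M₀] [SecondCountableTopology M₀]

/-- A symplectic equivalence that respects the rough types is given, through the local
identifications with the reference system, by sections of `𝒵¹/ℛ`. -/
theorem RespectsRoughTypes.exists_section (h₇ : S₀.SymplectomorphismsAreTimeOneMaps)
    {Ψ : SymplecticEquivalence S₁ S₂} {E₁ : RoughSymplecticEquivalence S₀ S₁}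
    {E₂ : RoughSymplecticEquivalence S₀ S₂} (h : Ψ.RespectsRoughTypes E₁ E₂) (i : E₁.ι)
    (j : E₂.ι) : ∃ s : S₀.quotientSections (E₁.U i ⊓ E₂.U j),
      S₀.Represents (E₁.U i ⊓ E₂.U j) s (fun p => (E₂.Φ j).symm (Ψ.map (E₁.Φ i p))) := by
  have hπ : ∀ p, S₀.π p ∈ E₁.U i → E₂.base.symm (S₂.π (Ψ.map (E₁.Φ i p))) = S₀.π p := by
    intro p hp
    rw [Ψ.comm, E₁.comm i p (E₁.mem_source.2 hp), h.1, E₂.base.symm_apply_apply]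
  have hπ' : ∀ p, S₀.π p ∈ E₂.U j → E₁.base.symm (S₁.π (Ψ.map.symm (E₂.Φ j p))) = S₀.π p := by
    intro p hp
    rw [E₁.base.symm_apply_eq, ← Ψ.base.injective.eq_iff, h.1, ← Ψ.comm, Ψ.map.apply_symm_apply,
      E₂.comm j p (E₂.mem_source.2 hp)]
  obtain ⟨g, hg⟩ : ∃ g : OpenPartialHomeomorph M₀ M₀,
      g = ((E₁.Φ i).trans Ψ.map.toHomeomorph.toOpenPartialHomeomorph).trans (E₂.Φ j).symm :=
    ⟨_, rfl⟩
  have hs : g.source = S₀.π ⁻¹' (E₁.U i ⊓ E₂.U j : Opens O₀) := by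
    ext p
    have h1 : p ∈ g.source ↔ p ∈ (E₁.Φ i).source ∧ Ψ.map (E₁.Φ i p) ∈ (E₂.Φ j).target := by
      rw [hg]; simp
    rw [h1, E₁.mem_source, E₂.mem_target]
    exact and_congr_right fun hp => by rw [hπ p hp]; rfl
  have ht : g.target = S₀.π ⁻¹' (E₁.U i ⊓ E₂.U j : Opens O₀) := by
    ext p
    have h1 : p ∈ g.target ↔ p ∈ (E₂.Φ j).source ∧ Ψ.map.symm (E₂.Φ j p) ∈ (E₁.Φ i).target := by
      rw [hg]; simp
    rw [h1, E₂.mem_source, E₁.mem_target]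
    refine (and_congr_right fun hp => ?_).trans and_comm
    rw [hπ' p hp]; rfl
  have hgs : IsSymplectomorphism S₀ S₀ g := by
    refine isSymplectomorphism_of_isSymplecticAt (fun p hp => ?_) (fun p hp => ?_)
    · rw [hs] at hp
      rw [hg]
      exact IsSymplecticAt.comp (g := fun p => Ψ.map (E₁.Φ i p))
        (E₂.isSymplecticAt_symm (by rw [hπ p hp.1]; exact hp.2)) ((Ψ.isSymplecticAt _).comp (E₁.isSymplecticAt hp.1))
    · rw [ht] at hp
      rw [hg]
      exact IsSymplecticAt.comp (g := fun p => Ψ.map.symm (E₂.Φ j p))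
        (E₁.isSymplecticAt_symm (by rw [hπ' p hp.2]; exact hp.1)) ((Ψ.isSymplecticAt_symm _).comp (E₂.isSymplecticAt hp.2))
  obtain ⟨s, hs'⟩ := IntegrableSystem.exists_section_of_symplectomorphism h₇ hs ht hgs (by
    rw [hg]; exact (h.2 i j).1)
  exact ⟨s, by rw [hg] at hs'; exact hs'⟩

end SymplecticEquivalence

variable [IsManifold 𝓘(ℝ, Model n) ∞ M₀] [T2Space O₀] [T2Space M₀] [SecondCountableTopology M₀]

namespace RoughSymplecticEquivalence

/-- The transition maps `Φᵢ⁻¹ ∘ Φⱼ` of a rough equivalence are given by sections of `𝒵¹/ℛ`. -/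
theorem exists_section (h₇ : S₀.SymplectomorphismsAreTimeOneMaps)
    (E : RoughSymplecticEquivalence S₀ S₁) (i j : E.ι) {V : Opens O₀} (hi : V ≤ E.U i)
    (hj : V ≤ E.U j) : ∃ s : S₀.quotientSections V,
      S₀.Represents V s (fun p => (E.Φ i).symm (E.Φ j p)) := by
  obtain ⟨s, hs⟩ := (SymplecticEquivalence.refl_respectsRoughTypes E).exists_section h₇ j i
  exact ⟨_, hs.res (le_inf hj hi)⟩

/-- The sections that represent the transition maps form a cocycle because a section is determined
by the map it represents. -/
theorem exists_isLagrangianClass (h₇ : S₀.SymplectomorphismsAreTimeOneMaps)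
    (E : RoughSymplecticEquivalence S₀ S₁) : ∃ c, E.IsLagrangianClass c := by
  choose i hi using E.cover
  obtain ⟨W, hW⟩ : ∃ W : PointCover O₀, W = ⟨fun x => E.U (i x), hi⟩ := ⟨_, rfl⟩
  have hWU : ∀ x, W.nhd x ≤ E.U (i x) := fun x => by rw [hW]
  have h : ∀ x y, ∃ s : S₀.quotientSections (W.nhd x ⊓ W.nhd y),
      S₀.Represents (W.nhd x ⊓ W.nhd y) s (fun p => (E.Φ (i x)).symm (E.Φ (i y) p)) := fun x y =>
    E.exists_section h₇ (i x) (i y) (inf_le_left.trans (hWU x)) (inf_le_right.trans (hWU y))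
  choose s hs using h
  refine ⟨_, W, i, hWU, ⟨s, fun x y z => ?_⟩, hs, rfl⟩
  have h1 := (hs x y).res (V := W.nhd x ⊓ W.nhd y ⊓ W.nhd z) inf_le_left
  have h2 := (hs y z).res (V := W.nhd x ⊓ W.nhd y ⊓ W.nhd z)
    (le_inf (inf_le_left.trans inf_le_right) inf_le_right)
  have h3 := (hs x z).res (V := W.nhd x ⊓ W.nhd y ⊓ W.nhd z)
    (le_inf (inf_le_left.trans inf_le_left) inf_le_right)
  refine IntegrableSystem.Represents.section_ext (h1.add h2) h3 fun p hp => ?_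
  rw [E.apply_symm]
  rw [E.base_symm_π_apply (hWU z hp.2)]
  exact hWU y hp.1.2

end RoughSymplecticEquivalence

/-- Systems that are related by a symplectic equivalence which respects the rough types have the
same Lagrangian class: read in the reference system, the equivalence is a 0-cochain whose
coboundary is the difference of the two cocycles. -/
theorem SymplecticEquivalence.RespectsRoughTypes.lagrangianClass_eq
    (h₇ : S₀.SymplectomorphismsAreTimeOneMaps)
    {Ψ : SymplecticEquivalence S₁ S₂} {E₁ : RoughSymplecticEquivalence S₀ S₁}
    {E₂ : RoughSymplecticEquivalence S₀ S₂} (h : Ψ.RespectsRoughTypes E₁ E₂)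
    {c₁ c₂ : Cech.H1 S₀.quotientSheaf} (hc₁ : E₁.IsLagrangianClass c₁)
    (hc₂ : E₂.IsLagrangianClass c₂) : c₁ = c₂ := by
  obtain ⟨W₁, i₁, hi₁, s₁, hs₁, rfl⟩ := hc₁
  obtain ⟨W₂, i₂, hi₂, s₂, hs₂, rfl⟩ := hc₂
  obtain ⟨W, h₁, h₂⟩ := exists_ge_ge W₁ W₂
  have hb : ∀ x, ∃ b : S₀.quotientSections (W.nhd x), S₀.Represents (W.nhd x) b
      (fun p => (E₂.Φ (i₂ x)).symm (Ψ.map (E₁.Φ (i₁ x) p))) := fun x => by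
    obtain ⟨b, hb⟩ := h.exists_section h₇ (i₁ x) (i₂ x)
    exact ⟨_, hb.res (le_inf ((h₁ x).trans (hi₁ x)) ((h₂ x).trans (hi₂ x)))⟩
  choose b hb using hb
  refine Cech.H1.mk_eq_mk_iff.2 ⟨W, h₁, h₂, b, fun x y => ?_⟩
  rw [sub_eq_sub_iff_add_eq_add, add_comm]
  refine Eq.trans ?_ (add_comm _ _)
  have e1 := (hs₁ x y).res (inf_le_inf (h₁ x) (h₁ y))
  have e2 := (hs₂ x y).res (inf_le_inf (h₂ x) (h₂ y))
  have e3 := (hb x).res (inf_le_left : W.nhd x ⊓ W.nhd y ≤ W.nhd x)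
  have e4 := (hb y).res (inf_le_right : W.nhd x ⊓ W.nhd y ≤ W.nhd y)
  refine IntegrableSystem.Represents.section_ext (e3.add e1) (e2.add e4) fun p hp => ?_
  have hp1x : S₀.π p ∈ E₁.U (i₁ x) := hi₁ x (h₁ x hp.1)
  have hp1y : S₀.π p ∈ E₁.U (i₁ y) := hi₁ y (h₁ y hp.2)
  have hp2y : S₀.π p ∈ E₂.U (i₂ y) := hi₂ y (h₂ y hp.2)
  rw [E₁.apply_symm (by rw [E₁.base_symm_π_apply hp1y]; exact hp1x), E₂.apply_symm]
  rw [Ψ.comm, E₁.comm _ p (E₁.mem_source.2 hp1y), h.1, E₂.base.symm_apply_apply]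
  exact hp2y

end Global

/-! ### Gluing symplectic equivalences -/

section Gluing

variable {n : ℕ} {M₀ M₁ M₂ : Type u} {O₀ O₁ O₂ : Type v}
  [TopologicalSpace M₀] [ChartedSpace (Model n) M₀] [TopologicalSpace O₀]
  [TopologicalSpace M₁] [ChartedSpace (Model n) M₁] [TopologicalSpace O₁]
  [TopologicalSpace M₂] [ChartedSpace (Model n) M₂] [TopologicalSpace O₂]
  {S₀ : IntegrableSystem n M₀ O₀} {S₁ : IntegrableSystem n M₁ O₁} {S₂ : IntegrableSystem n M₂ O₂}

/-- Symplectomorphisms over the members of an open cover of the base that agree on the overlaps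
can be glued. -/
theorem SymplecticEquivalence.exists_of_local (φ : O₁ ≃ₜ O₂) {ι : Type*} {V : ι → Set O₁}
    (hV : ∀ i, IsOpen (V i)) (hcover : ∀ y, ∃ i, y ∈ V i) {f : ι → M₁ → M₂} {f' : ι → M₂ → M₁}
    (hπ : ∀ i q, S₁.π q ∈ V i → S₂.π (f i q) = φ (S₁.π q))
    (hπ' : ∀ i r, φ.symm (S₂.π r) ∈ V i → S₁.π (f' i r) = φ.symm (S₂.π r))
    (hleft : ∀ i q, S₁.π q ∈ V i → f' i (f i q) = q)
    (hright : ∀ i r, φ.symm (S₂.π r) ∈ V i → f i (f' i r) = r)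
    (hcompat : ∀ i j q, S₁.π q ∈ V i → S₁.π q ∈ V j → f i q = f j q)
    (hsymp : ∀ i q, S₁.π q ∈ V i → IsSymplecticAt S₁ S₂ (f i) q)
    (hsymp' : ∀ i r, φ.symm (S₂.π r) ∈ V i → IsSymplecticAt S₂ S₁ (f' i) r) :
    ∃ Ψ : SymplecticEquivalence S₁ S₂, Ψ.base = φ ∧ ∀ i q, S₁.π q ∈ V i → Ψ.map q = f i q := by
  choose k hk using hcover
  have hcompat' : ∀ i j r, φ.symm (S₂.π r) ∈ V i → φ.symm (S₂.π r) ∈ V j → f' i r = f' j r := by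
    intro i j r hi hj
    have h1 := hπ' j r hj
    rw [← hleft i (f' j r) (by rw [h1]; exact hi),
      hcompat i j (f' j r) (by rw [h1]; exact hi) (by rw [h1]; exact hj), hright j r hj]
  obtain ⟨F, hF⟩ : ∃ F : M₁ → M₂, F = fun q => f (k (S₁.π q)) q := ⟨_, rfl⟩
  obtain ⟨F', hF'⟩ : ∃ F' : M₂ → M₁, F' = fun r => f' (k (φ.symm (S₂.π r))) r := ⟨_, rfl⟩
  have hFf : ∀ i q, S₁.π q ∈ V i → F q = f i q := fun i q hq => by
    rw [hF]; exact hcompat _ _ q (hk _) hq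
  have hFf' : ∀ i r, φ.symm (S₂.π r) ∈ V i → F' r = f' i r := fun i r hr => by
    rw [hF']; exact hcompat' _ _ r (hk _) hr
  have hFπ : ∀ q, S₂.π (F q) = φ (S₁.π q) := fun q => by rw [hF]; exact hπ _ q (hk _)
  have hFs : ∀ q, IsSymplecticAt S₁ S₂ F q := fun q => by
    refine (hsymp _ q (hk (S₁.π q))).congr ?_
    filter_upwards [((hV (k (S₁.π q))).preimage S₁.isProperMap.continuous).mem_nhds (hk _)] with p hp
      using hFf _ p hp
  have hFs' : ∀ r, IsSymplecticAt S₂ S₁ F' r := fun r => by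
    refine (hsymp' _ r (hk (φ.symm (S₂.π r)))).congr ?_
    filter_upwards [((hV (k (φ.symm (S₂.π r)))).preimage
      (φ.symm.continuous.comp S₂.isProperMap.continuous)).mem_nhds (hk _)] with p hp
      using hFf' _ p hp
  refine ⟨{
    base := φ
    map :=
      { toFun := F
        invFun := F'
        left_inv := fun q => ?_
        right_inv := fun r => ?_
        contMDiff_toFun := fun q => (hFs q).contMDiffAt
        contMDiff_invFun := fun r => (hFs' r).contMDiffAt }
    comm := hFπ
    symplectic := fun p => (compContinuousLinearMap_form_eq_iff (S₁ := S₁) (S₂ := S₂)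
      (mfderiv 𝓘(ℝ, Model n) 𝓘(ℝ, Model n) F p)).2 (hFs p).form_eq }, rfl, hFf⟩
  · have h1 := hk (S₁.π q)
    rw [hFf' (k (S₁.π q)) (F q) (by rw [hFπ, φ.symm_apply_apply]; exact h1), hFf _ q h1,
      hleft _ q h1]
  · have h1 := hk (φ.symm (S₂.π r))
    have h2 := hπ' _ r h1
    rw [hFf' _ r h1, hFf _ _ (by rw [h2]; exact h1), hright _ r h1]

variable [IsManifold 𝓘(ℝ, Model n) ∞ M₀] [T2Space O₀] [T2Space M₀] [SecondCountableTopology M₀]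

/-- Uniqueness is the case of the identity equivalence of
`SymplecticEquivalence.RespectsRoughTypes.lagrangianClass_eq`. -/
theorem RoughSymplecticEquivalence.existsUnique_isLagrangianClass
    (h₇ : S₀.SymplectomorphismsAreTimeOneMaps) (E : RoughSymplecticEquivalence S₀ S₁) :
    ∃! c, E.IsLagrangianClass c := by
  obtain ⟨c, hc⟩ := E.exists_isLagrangianClass h₇
  exact ⟨c, hc, fun c' hc' =>
    (SymplecticEquivalence.refl_respectsRoughTypes E).lagrangianClass_eq h₇ hc' hc⟩

/-- A 0-cochain whose coboundary is the difference of the cocycles of two rough equivalences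
corrects the local identifications of the two systems, so that they agree on overlaps. -/
theorem RoughSymplecticEquivalence.SameLagrangianClass.exists_respectsRoughTypes
    (h₁ : S₀.FiniteStrata) (h₇ : S₀.SymplectomorphismsAreTimeOneMaps)
    {E₁ : RoughSymplecticEquivalence S₀ S₁} {E₂ : RoughSymplecticEquivalence S₀ S₂}
    (h : E₁.SameLagrangianClass E₂) :
    ∃ Ψ : SymplecticEquivalence S₁ S₂, Ψ.RespectsRoughTypes E₁ E₂ := by
  obtain ⟨c, ⟨W₁, i₁, hi₁, s₁, hs₁, hc₁⟩, ⟨W₂, i₂, hi₂, s₂, hs₂, hc₂⟩⟩ := h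
  obtain ⟨W, h₁W, h₂W, b, hb⟩ := Cech.H1.mk_eq_mk_iff.1 (hc₁.symm.trans hc₂)
  have hU₁ : ∀ x, W.nhd x ≤ E₁.U (i₁ x) := fun x => (h₁W x).trans (hi₁ x)
  have hU₂ : ∀ x, W.nhd x ≤ E₂.U (i₂ x) := fun x => (h₂W x).trans (hi₂ x)
  have hg := fun x => IntegrableSystem.exists_symplectomorphism_represents (S := S₀) (b x)
  choose g hgs hgt hg hg' using hg
  -- The corrected identifications agree on overlaps.
  have key : ∀ x y p, S₀.π p ∈ W.nhd x → S₀.π p ∈ W.nhd y →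
      g x ((E₁.Φ (i₁ x)).symm (E₁.Φ (i₁ y) p)) = (E₂.Φ (i₂ x)).symm (E₂.Φ (i₂ y) (g y p)) := by
    intro x y p hx hy
    have e1 := (hs₁ x y).res (inf_le_inf (h₁W x) (h₁W y))
    have e2 := (hs₂ x y).res (inf_le_inf (h₂W x) (h₂W y))
    have e3 := (hg x).res (inf_le_left : W.nhd x ⊓ W.nhd y ≤ W.nhd x)
    have e4 := (hg y).res (inf_le_right : W.nhd x ⊓ W.nhd y ≤ W.nhd y)
    have hxy := hb x y
    rw [sub_eq_sub_iff_add_eq_add, add_comm, add_comm (Cech.res _ _ (b y))] at hxy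
    have e5 := e2.add e4
    have e6 := e3.add e1
    exact e6.eqOn (hxy ▸ e5) ⟨hx, hy⟩
  have hgπ : ∀ x p, S₀.π p ∈ W.nhd x → S₀.π (g x p) = S₀.π p := fun x p hp => (hg x).π_eq hp
  have hgπ' : ∀ x p, S₀.π p ∈ W.nhd x → S₀.π ((g x).symm p) = S₀.π p := fun x p hp =>
    (hg' x).π_eq hp
  have hgl : ∀ x p, S₀.π p ∈ W.nhd x → (g x).symm (g x p) = p := fun x p hp =>
    (g x).left_inv (by rw [hgs]; exact hp)
  have hgr : ∀ x p, S₀.π p ∈ W.nhd x → g x ((g x).symm p) = p := fun x p hp =>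
    (g x).right_inv (by rw [hgt]; exact hp)
  obtain ⟨f, hf⟩ : ∃ f : O₀ → M₁ → M₂,
      f = fun x q => E₂.Φ (i₂ x) (g x ((E₁.Φ (i₁ x)).symm q)) := ⟨_, rfl⟩
  obtain ⟨f', hf'⟩ : ∃ f' : O₀ → M₂ → M₁,
      f' = fun x r => E₁.Φ (i₁ x) ((g x).symm ((E₂.Φ (i₂ x)).symm r)) := ⟨_, rfl⟩
  have hq₁ : ∀ x q, E₁.base.symm (S₁.π q) ∈ W.nhd x →
      S₀.π ((E₁.Φ (i₁ x)).symm q) = E₁.base.symm (S₁.π q) := fun x q hq =>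
    E₁.π_symm_apply (hU₁ x hq)
  have hr₂ : ∀ x r, E₂.base.symm (S₂.π r) ∈ W.nhd x →
      S₀.π ((E₂.Φ (i₂ x)).symm r) = E₂.base.symm (S₂.π r) := fun x r hr =>
    E₂.π_symm_apply (hU₂ x hr)
  have hgq : ∀ x q, E₁.base.symm (S₁.π q) ∈ W.nhd x →
      S₀.π (g x ((E₁.Φ (i₁ x)).symm q)) = E₁.base.symm (S₁.π q) := fun x q hq => by
    rw [hgπ x _ (by rw [hq₁ x q hq]; exact hq), hq₁ x q hq]
  have hgr' : ∀ x r, E₂.base.symm (S₂.π r) ∈ W.nhd x →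
      S₀.π ((g x).symm ((E₂.Φ (i₂ x)).symm r)) = E₂.base.symm (S₂.π r) := fun x r hr => by
    rw [hgπ' x _ (by rw [hr₂ x r hr]; exact hr), hr₂ x r hr]
  have hφ : ∀ {x : O₀} {r : M₂}, (E₁.base.symm.trans E₂.base).symm (S₂.π r) ∈
      E₁.base.symm ⁻¹' (W.nhd x) → E₂.base.symm (S₂.π r) ∈ W.nhd x := fun {x r} hr => by
    have h : E₁.base.symm (E₁.base (E₂.base.symm (S₂.π r))) ∈ W.nhd x := hr
    rwa [E₁.base.symm_apply_apply] at h
  obtain ⟨Ψ, hΨb, hΨ⟩ := SymplecticEquivalence.exists_of_local (S₁ := S₁) (S₂ := S₂)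
    (E₁.base.symm.trans E₂.base) (ι := O₀) (V := fun x => E₁.base.symm ⁻¹' (W.nhd x))
    (fun x => (W.nhd x).isOpen.preimage E₁.base.symm.continuous)
    (fun y => ⟨E₁.base.symm y, W.mem _⟩) (f := f) (f' := f')
    (fun x q hq => by
      have h1 := hgq x q hq
      rw [hf]
      refine (E₂.comm _ _ (E₂.mem_source.2 ?_)).trans (congrArg E₂.base h1)
      rw [h1]; exact hU₂ x hq)
    (fun x r hr => by
      have hr' := hφ hr
      have h1 := hgr' x r hr'
      rw [hf']
      refine (E₁.comm _ _ (E₁.mem_source.2 ?_)).trans (congrArg E₁.base h1)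
      rw [h1]; exact hU₁ x hr')
    (fun x q hq => by
      simp only [hf, hf']
      rw [E₂.symm_apply (by rw [hgq x q hq]; exact hU₂ x hq), hgl x _ (by
        rw [hq₁ x q hq]; exact hq), E₁.apply_symm (hU₁ x hq)])
    (fun x r hr => by
      have hr' := hφ hr
      simp only [hf, hf']
      rw [E₁.symm_apply (by rw [hgr' x r hr']; exact hU₁ x hr'), hgr x _ (by
        rw [hr₂ x r hr']; exact hr'), E₂.apply_symm (hU₂ x hr')])
    (fun x y q hx hy => by
      simp only [hf]
      have h1 := hq₁ y q hy
      have h2 := key x y ((E₁.Φ (i₁ y)).symm q) (by rw [h1]; exact hx) (by rw [h1]; exact hy)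
      rw [E₁.apply_symm (hU₁ y hy)] at h2
      rw [h2, E₂.apply_symm]
      rw [E₂.base_symm_π_apply (by rw [hgq y q hy]; exact hU₂ y hy), hgq y q hy]
      exact hU₂ x hx)
    (fun x q hq => by
      simp only [hf]
      have h1 : IsSymplecticAt S₁ S₀ (fun q => g x ((E₁.Φ (i₁ x)).symm q)) q :=
        ((hg x).isSymplecticAt (by rw [hq₁ x q hq]; exact hq)).comp
          (E₁.isSymplecticAt_symm (hU₁ x hq))
      exact (E₂.isSymplecticAt (by rw [hgq x q hq]; exact hU₂ x hq)).comp h1)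
    (fun x r hr => by
      have hr' := hφ hr
      simp only [hf']
      have h1 : IsSymplecticAt S₂ S₀ (fun r => (g x).symm ((E₂.Φ (i₂ x)).symm r)) r :=
        ((hg' x).isSymplecticAt (by rw [hr₂ x r hr']; exact hr')).comp
          (E₂.isSymplecticAt_symm (hU₂ x hr'))
      exact (E₁.isSymplecticAt (by rw [hgr' x r hr']; exact hU₁ x hr')).comp h1)
  refine ⟨Ψ, fun x => ?_, fun i j => IntegrableSystem.isAdmissible_of_flow h₁ fun z hz => ?_⟩
  · rw [hΨb]
    exact congrArg E₂.base (E₁.base.symm_apply_apply x)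
  -- Near `z`, all the maps of which the automorphism is composed are given by sections of `𝒵¹/ℛ`.
  · obtain ⟨V, hV⟩ : ∃ V : Opens O₀, V = W.nhd z ⊓ (E₁.U i ⊓ E₂.U j) := ⟨_, rfl⟩
    have hVW : V ≤ W.nhd z := hV ▸ inf_le_left
    have hVi : V ≤ E₁.U i := hV ▸ inf_le_right.trans inf_le_left
    have hVj : V ≤ E₂.U j := hV ▸ inf_le_right.trans inf_le_right
    obtain ⟨a₁, ha₁⟩ := E₁.exists_section h₇ (i₁ z) i (hVW.trans (hU₁ z)) hVi
    obtain ⟨a₂, ha₂⟩ := E₂.exists_section h₇ j (i₂ z) hVj (hVW.trans (hU₂ z))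
    have h3 := ha₂.add (((hg z).res hVW).add ha₁)
    have h4 := h3.congr (g' := fun p => (E₂.Φ j).symm (Ψ.map (E₁.Φ i p))) fun p hp => by
      have h5 := hΨ z (E₁.Φ i p) (by
        rw [mem_preimage, E₁.base_symm_π_apply (hVi hp)]; exact hVW hp)
      rw [h5, hf]
    obtain ⟨V', hzV', -, β, hβ, -, hflow⟩ := IntegrableSystem.represents_iff.1 h4 z
      (by rw [hV]; exact ⟨W.mem z, hz⟩)
    exact ⟨V', hzV', β, hβ, hflow⟩

end Gluing

/-! ### Classification by the Lagrangian class -/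

theorem theorem1p2 {n : ℕ} {M₀ M₁ M₂ : Type u} {O₀ O₁ O₂ : Type v}
    [TopologicalSpace M₀] [T2Space M₀] [SecondCountableTopology M₀]
    [ChartedSpace (Model n) M₀] [IsManifold 𝓘(ℝ, Model n) ∞ M₀]
    [TopologicalSpace M₁] [T2Space M₁] [SecondCountableTopology M₁]
    [ChartedSpace (Model n) M₁] [IsManifold 𝓘(ℝ, Model n) ∞ M₁]
    [TopologicalSpace M₂] [T2Space M₂] [SecondCountableTopology M₂]
    [ChartedSpace (Model n) M₂] [IsManifold 𝓘(ℝ, Model n) ∞ M₂]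
    [TopologicalSpace O₀] [T2Space O₀] [ParacompactSpace O₀]
    [TopologicalSpace O₁] [T2Space O₁] [ParacompactSpace O₁]
    [TopologicalSpace O₂] [T2Space O₂] [ParacompactSpace O₂]
    (S₀ : IntegrableSystem n M₀ O₀) (S₁ : IntegrableSystem n M₁ O₁)
    (S₂ : IntegrableSystem n M₂ O₂)
    (h₁ : S₀.FiniteStrata) (h₇ : S₀.SymplectomorphismsAreTimeOneMaps)
    (r₁ : Nonempty (RoughSymplecticEquivalence S₀ S₁))
    (r₂ : Nonempty (RoughSymplecticEquivalence S₀ S₂)) :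
    (∀ E₁ : RoughSymplecticEquivalence S₀ S₁,
      ∃! c : Cech.H1 S₀.quotientSheaf, E₁.IsLagrangianClass c) ∧
    (∀ E₂ : RoughSymplecticEquivalence S₀ S₂,
      ∃! c : Cech.H1 S₀.quotientSheaf, E₂.IsLagrangianClass c) ∧
    (Nonempty (SymplecticEquivalence S₁ S₂) ↔
      ∃ (E₁ : RoughSymplecticEquivalence S₀ S₁) (E₂ : RoughSymplecticEquivalence S₀ S₂),
        E₁.SameLagrangianClass E₂) ∧
    (∀ E₁ : RoughSymplecticEquivalence S₀ S₁, Nonempty (SymplecticEquivalence S₁ S₂) →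
      ∃ E₂ : RoughSymplecticEquivalence S₀ S₂, E₁.SameLagrangianClass E₂) ∧
    (∀ (E₁ : RoughSymplecticEquivalence S₀ S₁) (E₂ : RoughSymplecticEquivalence S₀ S₂),
      E₁.SameLagrangianClass E₂ ↔
        ∃ Ψ : SymplecticEquivalence S₁ S₂, Ψ.RespectsRoughTypes E₁ E₂) := by
  have hsame : ∀ (E₁ : RoughSymplecticEquivalence S₀ S₁) (E₂ : RoughSymplecticEquivalence S₀ S₂),
      E₁.SameLagrangianClass E₂ ↔
        ∃ Ψ : SymplecticEquivalence S₁ S₂, Ψ.RespectsRoughTypes E₁ E₂ := by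
    refine fun E₁ E₂ => ⟨fun h => h.exists_respectsRoughTypes h₁ h₇, fun ⟨Ψ, hΨ⟩ => ?_⟩
    obtain ⟨c₁, hc₁⟩ := E₁.exists_isLagrangianClass h₇
    obtain ⟨c₂, hc₂⟩ := E₂.exists_isLagrangianClass h₇
    exact ⟨c₁, hc₁, hΨ.lagrangianClass_eq h₇ hc₁ hc₂ ▸ hc₂⟩
  have hprescribed : ∀ E₁ : RoughSymplecticEquivalence S₀ S₁,
      Nonempty (SymplecticEquivalence S₁ S₂) →
      ∃ E₂ : RoughSymplecticEquivalence S₀ S₂, E₁.SameLagrangianClass E₂ :=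
    fun E₁ ⟨Ψ⟩ => ⟨Ψ.compRough E₁, (hsame _ _).2 ⟨Ψ, Ψ.compRough_respectsRoughTypes E₁⟩⟩
  refine ⟨fun E₁ => E₁.existsUnique_isLagrangianClass h₇,
    fun E₂ => E₂.existsUnique_isLagrangianClass h₇, ⟨fun h => ?_, fun ⟨E₁, E₂, h⟩ => ?_⟩,
    hprescribed, hsame⟩
  · obtain ⟨E₁⟩ := r₁
    exact ⟨E₁, hprescribed E₁ h⟩
  · obtain ⟨Ψ, -⟩ := (hsame E₁ E₂).1 h
    exact ⟨Ψ⟩
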